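/- Let $A$ be an associative ring with $1$, let $\mu\geqslant 1$, let $F_\mu$ be the free group on $z_1,\dots,z_\mu$, and let $\epsilon: A[F_\mu]\to A$, $z_i\mapsto 1$, be the augmentation. Modules are left modules, and for an $A$-module $P$ write $P[F_\mu]=A[F_\mu]\otimes_A P$. A f.g. projective Seifert $A$-module is a triple $(P,e,\{\pi_i\})$ with $P$ a f.g. projective $A$-module, $e:P\to P$ an endomorphism and $\pi_1,\dots,\pi_\mu:P\to P$ orthogonal idempotents with sum $1$; a morphism $g:(P,e,\{\pi_i\})\to(P',e',\{\pi'_i\})$ is an $A$-module morphism with $ge=e'g$ and $g\pi_i=\pi_i'g$. They form a category $\mathcal{S}\mathit{ei}(A)$, in which a sequence is short exact if the underlying sequence of $A$-modules is. An $A[F_\mu]$-module $M$ is Blanchfield if $\mathrm{Tor}^{A[F_\mu]}_*(A,M)=0$, with $A$ a right $A[F_\mu]$-module via $\epsilon$. Let $\mathcal{B}\mathit{la}(A)$ be the full subcategory of the category of $A[F_\mu]$-modules with objects the Blanchfield modules $M$ of homological dimension 1, i.e. with a resolution $0\to K\to L\to M\to 0$ by f.g. projective $A[F_\mu]$-modules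 $K,L$. Let $\mathcal{F}\mathit{lk}(A)\subseteq\mathcal{B}\mathit{la}(A)$ be the full subcategory of the $M$ with a resolution $0\to P[F_\mu]\to Q[F_\mu]\to M\to 0$ for some f.g. projective $A$-modules $P,Q$; a sequence in $\mathcal{F}\mathit{lk}(A)$ is short exact if it is short exact as a sequence of $A[F_\mu]$-modules. For a Seifert module put $z=\sum_i\pi_iz_i:P[F_\mu]\to P[F_\mu]$, $g\otimes x\mapsto\sum_i gz_i\otimes\pi_i(x)$ $(g\in F_\mu,\ x\in P)$, and $$B(P,e,\{\pi_i\})=\mathrm{coker}\bigl(1-e+ez:P[F_\mu]\to P[F_\mu]\bigr),$$ which is functorial in $(P,e,\{\pi_i\})$. Let $\Xi$ be the class of morphisms $f$ of $\mathcal{S}\mathit{ei}(A)$ such that $B(f)$ is an isomorphism, and call a sequence in the category of fractions $\Xi^{-1}\mathcal{S}\mathit{ei}(A)$ short exact if it is isomorphic in $\Xi^{-1}\mathcal{S}\mathit{ei}(A)$ to the image of a short exact sequence of $\mathcal{S}\mathit{ei}(A)$. (i) $\Xi$ admits a left calculus of fractions in $\mathcal{S}\mathit{ei}(A)$. The covering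 functor $B$ takes values in $\mathcal{F}\mathit{lk}(A)$ and induces an equivalence of exact categories $$\overline{B}:\ \Xi^{-1}\mathcal{S}\mathit{ei}(A)\ \xrightarrow{\ \approx\ }\ \mathcal{F}\mathit{lk}(A);$$ that is, $\Xi^{-1}\mathcal{S}\mathit{ei}(A)$ (with a preadditive structure for which the localization functor is additive) and $\mathcal{F}\mathit{lk}(A)$ are additive categories which are exact in the sense of Quillen with the above short exact sequences, and $\overline{B}$ is an additive equivalence of categories such that a sequence in $\Xi^{-1}\mathcal{S}\mathit{ei}(A)$ is short exact if and only if its image under $\overline{B}$ is short exact in $\mathcal{F}\mathit{lk}(A)$. (ii) $\mathcal{B}\mathit{la}(A)$ is the idempotent completion of $\mathcal{F}\mathit{lk}(A)$: the inclusion $\mathcal{F}\mathit{lk}(A)\to\mathcal{B}\mathit{la}(A)$ extends, up to natural isomorphism, along $M\mapsto(M,1)$ to an additive equivalence from the idempotent completion of $\mathcal{F}\mathit{lk}(A)$ (objects the pairs $(M,p)$ with $p=p^2:M\to M$ in $\mathcal{F}\mathit{lk}(A)$, morphisms $(M,p)\to(N,q)$ the $f:M\to N$ with $qfp=f$) to $\mathcal{B}\mathit{la}(A)$.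 -/

import Mathlib

open CategoryTheory CategoryTheory.Limits
open scoped TensorProduct

universe u v w

noncomputable section

namespace SeifertBlanchfield

/-! ### The group ring `A[F_μ]`, induced modules `P[F_μ]`, and the functors `Tor_n(A, -)` -/

/-- The group ring `A[F_μ]` of the free group `F_μ` on `μ` generators
(the coefficients in `A` commute with the elements of `F_μ`). -/
abbrev GroupRing (A : Type u) [Ring A] (μ : ℕ) : Type u :=
  MonoidAlgebra A (FreeGroup (Fin μ))

/-- The augmentation `ε : A[F_μ] → A`, the ring morphism which is the identity on `A`
and sends every generator `z_i` to `1`. -/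
def augmentation (A : Type u) [Ring A] (μ : ℕ) : GroupRing A μ →+* A :=
  MonoidAlgebra.liftNCRingHom (RingHom.id A) (1 : FreeGroup (Fin μ) →* A)
    (fun _ _ => Commute.one_right _)

/-- The underlying additive group of the induced module `P[F_μ] = A[F_μ] ⊗_A P = ⨁_{g ∈ F_μ} g P`:
the finite formal sums `∑ g x_g` with `x_g ∈ P`. -/
def Induced (μ : ℕ) (P : Type u) [AddCommGroup P] : Type u :=
  FreeGroup (Fin μ) →₀ P

instance (μ : ℕ) (P : Type u) [AddCommGroup P] : AddCommGroup (Induced μ P) :=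
  inferInstanceAs (AddCommGroup (FreeGroup (Fin μ) →₀ P))

namespace Induced

variable {A : Type u} [Ring A] {μ : ℕ} {P Q : Type u} [AddCommGroup P] [AddCommGroup Q]

/-- The element `g x` of `P[F_μ]`. -/
def single (g : FreeGroup (Fin μ)) (x : P) : Induced μ P := Finsupp.single g x

/-- The action of `a ∈ A` on `P[F_μ]`, `a (∑ g x_g) = ∑ g (a x_g)`. -/
def coeffAction (A : Type u) [Ring A] (μ : ℕ) (P : Type u) [AddCommGroup P] [Module A P] :
    A →+* AddMonoid.End (Induced μ P) :=
  Module.toAddMonoidEnd A (FreeGroup (Fin μ) →₀ P)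

/-- The action of `h ∈ F_μ` on `P[F_μ]`, `h (∑ g x_g) = ∑ (h g) x_g`. -/
def groupAction (μ : ℕ) (P : Type u) [AddCommGroup P] :
    FreeGroup (Fin μ) →* AddMonoid.End (Induced μ P) where
  toFun h := Finsupp.mapDomain.addMonoidHom (fun g => h * g)
  map_one' := by
    refine Finsupp.addHom_ext fun g x => ?_
    change Finsupp.mapDomain _ (Finsupp.single g x) = Finsupp.single g x
    rw [Finsupp.mapDomain_single, one_mul]
  map_mul' h k := by
    refine Finsupp.addHom_ext fun g x => ?_
    change Finsupp.mapDomain _ (Finsupp.single g x)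
      = Finsupp.mapDomain _ (Finsupp.mapDomain _ (Finsupp.single g x))
    rw [Finsupp.mapDomain_single, Finsupp.mapDomain_single, Finsupp.mapDomain_single, mul_assoc]

lemma commute_actions [Module A P] (a : A) (h : FreeGroup (Fin μ)) :
    Commute (coeffAction A μ P a) (groupAction μ P h) := by
  refine Finsupp.addHom_ext fun g x => ?_
  change a • Finsupp.mapDomain _ (Finsupp.single g x)
    = Finsupp.mapDomain _ (a • Finsupp.single g x)
  rw [Finsupp.smul_single, Finsupp.mapDomain_single, Finsupp.mapDomain_single,
    Finsupp.smul_single]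

/-- The left `A[F_μ]`-module structure of `P[F_μ]`. -/
instance [Module A P] : Module (GroupRing A μ) (Induced μ P) :=
  Module.compHom _ (MonoidAlgebra.liftNCRingHom (coeffAction A μ P) (groupAction μ P)
    commute_actions)

/-- The defining formula `(a h) (g x) = (h g) (a x)`. -/
lemma single_smul_single [Module A P] (h g : FreeGroup (Fin μ)) (a : A) (x : P) :
    (MonoidAlgebra.single h a : GroupRing A μ) • single g x = single (h * g) (a • x) := by
  change MonoidAlgebra.liftNCRingHom (coeffAction A μ P) (groupAction μ P) commute_actions
    (MonoidAlgebra.single h a) (single g x) = _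
  rw [MonoidAlgebra.liftNCRingHom_single]
  change a • Finsupp.mapDomain _ (Finsupp.single g x) = Finsupp.single _ _
  rw [Finsupp.mapDomain_single, Finsupp.smul_single]

lemma addHom_ext {N : Type w} [AddCommGroup N] {f f' : Induced μ P →+ N}
    (H : ∀ g x, f (single g x) = f' (single g x)) : f = f' :=
  Finsupp.addHom_ext H

/-- The additive map underlying `twist`. -/
def twistAdd (k : FreeGroup (Fin μ)) (φ : P →+ Q) : Induced μ P →+ Induced μ Q :=
  (Finsupp.mapDomain.addMonoidHom (fun g => g * k) :
    (FreeGroup (Fin μ) →₀ Q) →+ (FreeGroup (Fin μ) →₀ Q)).comp (Finsupp.mapRange.addMonoidHom φ)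

lemma twistAdd_single (k g : FreeGroup (Fin μ)) (φ : P →+ Q) (x : P) :
    twistAdd k φ (single g x) = single (g * k) (φ x) := by
  change Finsupp.mapDomain _ (Finsupp.mapRange φ φ.map_zero (Finsupp.single g x))
    = Finsupp.single _ _
  rw [Finsupp.mapRange_single, Finsupp.mapDomain_single]

variable [Module A P] [Module A Q]

/-- For `k ∈ F_μ` and an `A`-module morphism `φ : P → Q`, the `A[F_μ]`-module morphism
`P[F_μ] → Q[F_μ]`, `g x ↦ (g k) φ(x)`, which is usually written `φ k`. -/
def twist (k : FreeGroup (Fin μ)) (φ : P →ₗ[A] Q) :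
    Induced μ P →ₗ[GroupRing A μ] Induced μ Q where
  toFun := twistAdd k φ.toAddMonoidHom
  map_add' := map_add _
  map_smul' r x := by
    induction r using MonoidAlgebra.induction_linear with
    | zero => simp
    | add r s hr hs => simp only [add_smul, map_add, hr, hs, RingHom.id_apply]
    | single h a =>
      have key : (twistAdd k φ.toAddMonoidHom).comp
            (DistribSMul.toAddMonoidHom (Induced μ P) (MonoidAlgebra.single h a : GroupRing A μ))
          = (DistribSMul.toAddMonoidHom (Induced μ Q)
              (MonoidAlgebra.single h a : GroupRing A μ)).comp (twistAdd k φ.toAddMonoidHom) := by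
        refine addHom_ext fun g x => ?_
        simp only [AddMonoidHom.comp_apply, DistribSMul.toAddMonoidHom_apply,
          single_smul_single, twistAdd_single, mul_assoc]
        congr 1
        exact φ.map_smul a x
      exact DFunLike.congr_fun key x

lemma twist_single (k g : FreeGroup (Fin μ)) (φ : P →ₗ[A] Q) (x : P) :
    twist k φ (single g x) = single (g * k) (φ x) :=
  twistAdd_single k g φ.toAddMonoidHom x

lemma linearMap_ext {N : Type w} [AddCommGroup N] [Module (GroupRing A μ) N]
    {f f' : Induced μ P →ₗ[GroupRing A μ] N}
    (H : ∀ g x, f (single g x) = f' (single g x)) : f = f' :=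
  LinearMap.toAddMonoidHom_injective (addHom_ext H)

/-- The `A[F_μ]`-module morphism `P[F_μ] → Q[F_μ]` induced by an `A`-module morphism `P → Q`. -/
def map (φ : P →ₗ[A] Q) : Induced μ P →ₗ[GroupRing A μ] Induced μ Q :=
  twist 1 φ

lemma map_single (φ : P →ₗ[A] Q) (g : FreeGroup (Fin μ)) (x : P) :
    map φ (single g x) = single g (φ x) := by
  rw [map, twist_single, mul_one]

end Induced

/-! The tensor product over a noncommutative ring, and its left derived functors. -/

section Tor

variable {R S : Type u} [Ring R] [Ring S]

/-- The subgroup of `S ⊗_ℤ M` generated by the elements `s φ(r) ⊗ m - s ⊗ r m`. -/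
def balancing (φ : R →+* S) (M : Type u) [AddCommGroup M] [Module R M] :
    Submodule ℤ (S ⊗[ℤ] M) :=
  Submodule.span ℤ
    {t | ∃ (s : S) (r : R) (m : M), t = (s * φ r) ⊗ₜ[ℤ] m - s ⊗ₜ[ℤ] (r • m)}

lemma balancing_le_comap (φ : R →+* S) {M N : Type u} [AddCommGroup M] [Module R M]
    [AddCommGroup N] [Module R N] (f : M →ₗ[R] N) :
    balancing φ M ≤
      (balancing φ N).comap (TensorProduct.map LinearMap.id (f.toAddMonoidHom.toIntLinearMap)) := by
  refine Submodule.span_le.2 ?_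
  rintro _ ⟨s, r, m, rfl⟩
  refine Submodule.subset_span ⟨s, r, f m, ?_⟩
  simp

lemma tensor_ext (φ : R →+* S) {M N : Type u} [AddCommGroup M] [Module R M] [AddCommGroup N]
    {f g : ((S ⊗[ℤ] M) ⧸ balancing φ M) →ₗ[ℤ] N}
    (H : ∀ s m, f (Submodule.Quotient.mk (s ⊗ₜ[ℤ] m)) = g (Submodule.Quotient.mk (s ⊗ₜ[ℤ] m))) :
    f = g :=
  Submodule.linearMap_qext _ (TensorProduct.ext' H)

/-- The functor `M ↦ S ⊗_R M` from left `R`-modules to abelian groups, with `S` a right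
`R`-module via the ring morphism `φ : R → S`. -/
def tensorFunctor (φ : R →+* S) : ModuleCat.{u} R ⥤ ModuleCat.{u} ℤ where
  obj M := ModuleCat.of ℤ ((S ⊗[ℤ] M) ⧸ balancing φ M)
  map f := ModuleCat.ofHom (Submodule.mapQ _ _ _ (balancing_le_comap φ f.hom))
  map_id _ := ModuleCat.hom_ext (tensor_ext φ fun _ _ => rfl)
  map_comp _ _ := ModuleCat.hom_ext (tensor_ext φ fun _ _ => rfl)

instance (φ : R →+* S) : (tensorFunctor φ).Additive where
  map_add {_ N f g} := ModuleCat.hom_ext (tensor_ext φ fun s m =>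
    congrArg (Submodule.Quotient.mk (p := balancing φ N))
      (TensorProduct.tmul_add s (f.hom m) (g.hom m)))

/-- `Tor_n^R(S, -)`, the left derived functors of `S ⊗_R -`. -/
def torFunctor (φ : R →+* S) (n : ℕ) : ModuleCat.{u} R ⥤ ModuleCat.{u} ℤ :=
  (tensorFunctor φ).leftDerived n

end Tor

/-! ### Blanchfield modules -/

section Blanchfield

variable (A : Type u) [Ring A] (μ : ℕ)

/-- An `A[F_μ]`-module `M` is Blanchfield if `Tor_n^{A[F_μ]}(A, M) = 0` for all `n`,
with `A` a right `A[F_μ]`-module via the augmentation. -/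
def IsBlanchfield (M : ModuleCat.{u} (GroupRing A μ)) : Prop :=
  ∀ n : ℕ, IsZero ((torFunctor (augmentation A μ) n).obj M)

/-- The h.d. 1 Blanchfield `A[F_μ]`-modules: the Blanchfield modules with a 1-dimensional
f.g. projective `A[F_μ]`-module resolution `0 → K → L → M → 0`. -/
def isBla : ObjectProperty (ModuleCat.{u} (GroupRing A μ)) := fun M =>
  IsBlanchfield A μ M ∧
    ∃ (K L : ModuleCat.{u} (GroupRing A μ)) (d : K →ₗ[GroupRing A μ] L)
      (q : L →ₗ[GroupRing A μ] M),
      Module.Finite (GroupRing A μ) K ∧ Module.Projective (GroupRing A μ) K ∧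
      Module.Finite (GroupRing A μ) L ∧ Module.Projective (GroupRing A μ) L ∧
      Function.Injective d ∧ Function.Exact d q ∧ Function.Surjective q

/-- The h.d. 1 `F_μ`-link modules: the h.d. 1 Blanchfield modules `M` with a resolution
`0 → P[F_μ] → Q[F_μ] → M → 0` induced from f.g. projective `A`-modules `P`, `Q`. -/
def isFlk : ObjectProperty (ModuleCat.{u} (GroupRing A μ)) := fun M =>
  isBla A μ M ∧
    ∃ (P Q : ModuleCat.{u} A) (d : Induced μ P →ₗ[GroupRing A μ] Induced μ Q)
      (q : Induced μ Q →ₗ[GroupRing A μ] M),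
      Module.Finite A P ∧ Module.Projective A P ∧
      Module.Finite A Q ∧ Module.Projective A Q ∧
      Function.Injective d ∧ Function.Exact d q ∧ Function.Surjective q

/-- The category of h.d. 1 Blanchfield `A[F_μ]`-modules, a full subcategory of the category of
left `A[F_μ]`-modules. -/
abbrev Bla := (isBla A μ).FullSubcategory

/-- The category of h.d. 1 `F_μ`-link modules, a full subcategory of the category of
left `A[F_μ]`-modules. -/
abbrev Flk := (isFlk A μ).FullSubcategory

/-- The inclusion of the h.d. 1 `F_μ`-link modules in the h.d. 1 Blanchfield modules. -/
abbrev flkToBla : Flk A μ ⥤ Bla A μ :=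
  ObjectProperty.ιOfLE (fun _ h => h.1)

end Blanchfield

/-! ### Seifert modules -/

/-- A Seifert `A`-module `(P, e, {π_i})`: an `A`-module `P`, an endomorphism `e`, and a complete
system of `μ` orthogonal idempotents `π_i`, that is a `μ`-fold direct sum decomposition of `P`. -/
structure SeifertModule (A : Type u) [Ring A] (μ : ℕ) where
  /-- the underlying `A`-module -/
  P : ModuleCat.{u} A
  /-- the endomorphism -/
  e : Module.End A P
  /-- the idempotents -/
  π : Fin μ → Module.End A P
  complete : CompleteOrthogonalIdempotents π

namespace SeifertModule

variable {A : Type u} [Ring A] {μ : ℕ}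

/-- A morphism of Seifert modules: an `A`-module morphism `g` with `g e = e' g` and
`g π_i = π'_i g`. -/
@[ext]
structure Hom (V W : SeifertModule A μ) where
  /-- the underlying `A`-module morphism -/
  hom : V.P →ₗ[A] W.P
  comm_e : hom ∘ₗ V.e = W.e ∘ₗ hom
  comm_π : ∀ i, hom ∘ₗ V.π i = W.π i ∘ₗ hom

/-- The category of all Seifert `A`-modules. -/
instance : Category (SeifertModule A μ) where
  Hom := Hom
  id V := ⟨LinearMap.id, by simp, by simp⟩
  comp f g := ⟨g.hom ∘ₗ f.hom,
    by rw [LinearMap.comp_assoc, f.comm_e, ← LinearMap.comp_assoc, g.comm_e,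
      LinearMap.comp_assoc],
    fun i => by rw [LinearMap.comp_assoc, f.comm_π, ← LinearMap.comp_assoc, g.comm_π,
      LinearMap.comp_assoc]⟩

@[ext]
lemma hom_ext {V W : SeifertModule A μ} {f g : V ⟶ W} (h : Hom.hom f = Hom.hom g) : f = g :=
  Hom.ext h

@[simp]
lemma id_hom (V : SeifertModule A μ) : Hom.hom (𝟙 V) = LinearMap.id := rfl

@[simp]
lemma comp_hom {U V W : SeifertModule A μ} (f : U ⟶ V) (g : V ⟶ W) :
    Hom.hom (f ≫ g) = Hom.hom g ∘ₗ Hom.hom f := rfl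

section

variable (V W : SeifertModule A μ)

instance : Zero (V ⟶ W) := ⟨(⟨0, by simp, by simp⟩ : Hom V W)⟩

instance : Add (V ⟶ W) := ⟨fun f g => (⟨Hom.hom f + Hom.hom g,
  by rw [LinearMap.add_comp, LinearMap.comp_add, Hom.comm_e, Hom.comm_e],
  fun i => by rw [LinearMap.add_comp, LinearMap.comp_add, Hom.comm_π, Hom.comm_π]⟩ : Hom V W)⟩

instance : Neg (V ⟶ W) := ⟨fun f => (⟨-Hom.hom f,
  by rw [LinearMap.neg_comp, LinearMap.comp_neg, Hom.comm_e],
  fun i => by rw [LinearMap.neg_comp, LinearMap.comp_neg, Hom.comm_π]⟩ : Hom V W)⟩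

/-- Morphisms of Seifert modules are added as `A`-module morphisms. -/
instance : AddCommGroup (V ⟶ W) where
  add_assoc f g h := hom_ext (add_assoc (Hom.hom f) (Hom.hom g) (Hom.hom h))
  zero_add f := hom_ext (zero_add (Hom.hom f))
  add_zero f := hom_ext (add_zero (Hom.hom f))
  neg_add_cancel f := hom_ext (neg_add_cancel (Hom.hom f))
  add_comm f g := hom_ext (add_comm (Hom.hom f) (Hom.hom g))
  nsmul := nsmulRec
  zsmul := zsmulRec

end

instance : Preadditive (SeifertModule A μ) where
  add_comp _ _ _ f f' g := hom_ext (LinearMap.comp_add (Hom.hom f) (Hom.hom f') (Hom.hom g))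
  comp_add _ _ _ f g g' := hom_ext (LinearMap.add_comp (Hom.hom f) (Hom.hom g') (Hom.hom g))

/-! ### The covering functor -/

/-- The `A[F_μ]`-module endomorphism `z = ∑ π_i z_i` of `P[F_μ]`. -/
def z (V : SeifertModule A μ) : Module.End (GroupRing A μ) (Induced μ V.P) :=
  ∑ i, Induced.twist (FreeGroup.of i) (V.π i)

/-- The `A[F_μ]`-module endomorphism `1 - e + e z` of `P[F_μ]`. -/
def presentation (V : SeifertModule A μ) : Module.End (GroupRing A μ) (Induced μ V.P) :=
  1 - Induced.map V.e + Induced.map V.e * V.z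

lemma map_comp_presentation {V W : SeifertModule A μ} (f : Hom V W) :
    Induced.map f.hom ∘ₗ V.presentation = W.presentation ∘ₗ Induced.map f.hom := by
  have he : ∀ x, f.hom (V.e x) = W.e (f.hom x) := fun x => LinearMap.congr_fun f.comm_e x
  have hπ : ∀ i x, f.hom (V.π i x) = W.π i (f.hom x) :=
    fun i x => LinearMap.congr_fun (f.comm_π i) x
  refine Induced.linearMap_ext fun g x => ?_
  simp [presentation, z, LinearMap.sum_apply, Induced.twist_single, Induced.map_single, he, hπ]

/-- The covering `B(P, e, {π_i}) = coker(1 - e + e z : P[F_μ] → P[F_μ])`, as a functor with values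
in the category of left `A[F_μ]`-modules. -/
def covering (A : Type u) [Ring A] (μ : ℕ) :
    SeifertModule A μ ⥤ ModuleCat.{u} (GroupRing A μ) where
  obj V := ModuleCat.of _ (Induced μ V.P ⧸ LinearMap.range V.presentation)
  map {V W} f := ModuleCat.ofHom (Submodule.mapQ _ _ (Induced.map (Hom.hom f)) (by
    rintro _ ⟨y, rfl⟩
    exact ⟨Induced.map (Hom.hom f) y, (LinearMap.congr_fun (map_comp_presentation f) y).symm⟩))
  map_id V := ModuleCat.hom_ext (Submodule.linearMap_qext _ (Induced.linearMap_ext fun g x =>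
    congrArg Submodule.Quotient.mk (Induced.map_single LinearMap.id g x)))
  map_comp {U V W} f g := ModuleCat.hom_ext (Submodule.linearMap_qext _
    (Induced.linearMap_ext fun k x => congrArg Submodule.Quotient.mk (by
      change Induced.map (Hom.hom g ∘ₗ Hom.hom f) (Induced.single k x)
        = Induced.map (Hom.hom g) (Induced.map (Hom.hom f) (Induced.single k x))
      rw [Induced.map_single, Induced.map_single, Induced.map_single]; rfl)))

end SeifertModule

section Seifert

variable (A : Type u) [Ring A] (μ : ℕ)

/-- The f.g. projective Seifert `A`-modules. -/
def isSei : ObjectProperty (SeifertModule A μ) := fun V =>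
  Module.Finite A V.P ∧ Module.Projective A V.P

/-- The category of f.g. projective Seifert `A`-modules. -/
abbrev Sei := (isSei A μ).FullSubcategory

/-- The covering functor on the f.g. projective Seifert modules, with values in the category of
left `A[F_μ]`-modules. -/
abbrev seiCovering : Sei A μ ⥤ ModuleCat.{u} (GroupRing A μ) :=
  (isSei A μ).ι ⋙ SeifertModule.covering A μ

/-- The class `Ξ` of the morphisms in the category of f.g. projective Seifert modules which the
covering functor sends to isomorphisms. -/
def Xi : MorphismProperty (Sei A μ) :=
  (MorphismProperty.isomorphisms (ModuleCat.{u} (GroupRing A μ))).inverseImage (seiCovering A μ)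

variable {A μ}

/-- The covering functor with values in the category of h.d. 1 `F_μ`-link modules, given that
the coverings of f.g. projective Seifert modules are h.d. 1 `F_μ`-link modules. -/
abbrev coveringFlk (hB : ∀ V : Sei A μ, isFlk A μ ((seiCovering A μ).obj V)) : Sei A μ ⥤ Flk A μ :=
  (isFlk A μ).lift (seiCovering A μ) hB

lemma coveringFlk_inverts (hB : ∀ V : Sei A μ, isFlk A μ ((seiCovering A μ).obj V)) :
    (Xi A μ).IsInvertedBy (coveringFlk hB) := fun _ _ f hf =>
  ((isFlk A μ).isIso_hom_iff ((coveringFlk hB).map f)).1 hf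

/-- The functor induced by the covering functor on the category of fractions of the f.g. projective
Seifert modules with respect to `Ξ`: the unique functor whose composite with the localization
functor is the covering functor. -/
def inducedCovering (hB : ∀ V : Sei A μ, isFlk A μ ((seiCovering A μ).obj V)) :
    (Xi A μ).Localization ⥤ Flk A μ :=
  Localization.Construction.lift (coveringFlk hB) (coveringFlk_inverts hB)

end Seifert

/-! ### Exact categories -/

/-- A class of composable pairs `X ⟶ Y ⟶ Z` in a category. -/
abbrev PairClass (C : Type v) [Category.{w} C] :=
  ∀ ⦃X Y Z : C⦄, (X ⟶ Y) → (Y ⟶ Z) → Prop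

section Exact

variable {C : Type v} [Category.{w} C]

/-- An inflation (admissible monomorphism) is the first morphism of a pair in the class. -/
def IsInflation (E : PairClass C) ⦃X Y : C⦄ (i : X ⟶ Y) : Prop :=
  ∃ (Z : C) (p : Y ⟶ Z), E i p

/-- A deflation (admissible epimorphism) is the second morphism of a pair in the class. -/
def IsDeflation (E : PairClass C) ⦃Y Z : C⦄ (p : Y ⟶ Z) : Prop :=
  ∃ (X : C) (i : X ⟶ Y), E i p

/-- The category `C` is additive, and the class `E` of pairs is the class of short exact sequences
of a Quillen exact structure on `C`. -/
structure IsExactStructure (C : Type v) [Category.{w} C] [Preadditive C] (E : PairClass C) :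
    Prop where
  hasFiniteBiproducts : HasFiniteBiproducts C
  isKernelCokernel : ∀ ⦃X Y Z : C⦄ (i : X ⟶ Y) (p : Y ⟶ Z), E i p →
    ∃ h : i ≫ p = 0, Nonempty (IsLimit (KernelFork.ofι i h)) ∧
      Nonempty (IsColimit (CokernelCofork.ofπ p h))
  iso_closed : ∀ ⦃X Y Z X' Y' Z' : C⦄ (i : X ⟶ Y) (p : Y ⟶ Z) (i' : X' ⟶ Y') (p' : Y' ⟶ Z')
    (a : X ≅ X') (b : Y ≅ Y') (c : Z ≅ Z'), i ≫ b.hom = a.hom ≫ i' → p ≫ c.hom = b.hom ≫ p' →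
    E i p → E i' p'
  id_inflation : ∀ X : C, IsInflation E (𝟙 X)
  id_deflation : ∀ X : C, IsDeflation E (𝟙 X)
  comp_inflation : ∀ ⦃X Y Z : C⦄ (i : X ⟶ Y) (j : Y ⟶ Z),
    IsInflation E i → IsInflation E j → IsInflation E (i ≫ j)
  comp_deflation : ∀ ⦃X Y Z : C⦄ (p : X ⟶ Y) (q : Y ⟶ Z),
    IsDeflation E p → IsDeflation E q → IsDeflation E (p ≫ q)
  pushout_inflation : ∀ ⦃X Y X' : C⦄ (i : X ⟶ Y) (f : X ⟶ X'), IsInflation E i →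
    ∃ (Y' : C) (f' : Y ⟶ Y') (i' : X' ⟶ Y'), IsPushout i f f' i' ∧ IsInflation E i'
  pullback_deflation : ∀ ⦃Y Z Z' : C⦄ (p : Y ⟶ Z) (f : Z' ⟶ Z), IsDeflation E p →
    ∃ (Y' : C) (f' : Y' ⟶ Y) (p' : Y' ⟶ Z'), IsPullback f' p' p f ∧ IsDeflation E p'

end Exact

section ShortExact

variable (A : Type u) [Ring A] (μ : ℕ)

/-- The short exact sequences of f.g. projective Seifert modules: the pairs of morphisms for which
the underlying sequence of `A`-modules `0 → P → P' → P'' → 0` is exact. -/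
def seiShortExact : PairClass (Sei A μ) := fun _ _ _ i p =>
  Function.Injective (SeifertModule.Hom.hom i.hom) ∧
    Function.Exact (SeifertModule.Hom.hom i.hom) (SeifertModule.Hom.hom p.hom) ∧
      Function.Surjective (SeifertModule.Hom.hom p.hom)

/-- The short exact sequences of h.d. 1 `F_μ`-link modules: the pairs of morphisms which are
short exact sequences of `A[F_μ]`-modules. -/
def flkShortExact : PairClass (Flk A μ) := fun _ _ _ i p =>
  Function.Injective i.hom.hom ∧ Function.Exact i.hom.hom p.hom.hom ∧
    Function.Surjective p.hom.hom

/-- The short exact sequences of the category of fractions: the pairs of morphisms which are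
isomorphic, in the category of fractions, to the image under the localization functor
of a short exact sequence of f.g. projective Seifert modules. -/
def fractionsShortExact : PairClass (Xi A μ).Localization := fun X Y Z i p =>
  ∃ (U V W : Sei A μ) (j : U ⟶ V) (q : V ⟶ W)
    (a : (Xi A μ).Q.obj U ≅ X) (b : (Xi A μ).Q.obj V ≅ Y) (c : (Xi A μ).Q.obj W ≅ Z),
    seiShortExact A μ j q ∧
      (Xi A μ).Q.map j ≫ b.hom = a.hom ≫ i ∧ (Xi A μ).Q.map q ≫ c.hom = b.hom ≫ p

end ShortExact

end SeifertBlanchfield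

end

open SeifertBlanchfield

/-! A Seifert module is handled through the endomorphisms `δ_i = e π_i`, for which `1 - e + e z = 1
- ∑ δ_i (1 - z_i)`; a `FoxModule` is any module `N` with such `δ_i`. In its covering the class of `x
∈ N` satisfies `x = ∑ (1 - z_i) δ_i x`. The coordinates of an element relative to the `1 - z_i` are
unique there (`FoxModule.Cov.eq_zero_of_sum_smul_eq_zero`), because the augmentation ideal is free
on them. So the `δ_i` are Fox derivatives, and `N` behaves like a lattice in its covering that is
stable under them.

Injectivity of presentations rests on `Words.eq_zero_of_eq_sum`: `P[F_μ]` embeds in families indexed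
by words, on which `F_μ` acts by operators that are the identity up to higher word length. An
identity `y = ∑ φ_k (1 - k) y` therefore raises the vanishing order of `y` without end.

Fractions come from enlarging the lattice. The shift adjoins the elements `z_k⁻¹ (1 - z_j) x` to `N`
and leaves the covering unchanged (`FoxModule.toShift_isCovEquiv`). Finitely many shifts kill a f.g.
family of elements of trivial class (`FoxModule.exists_isCovEquiv_comp_eq_zero`) and represent a
f.g. family of elements of the covering (`FoxModule.exists_isCovEquiv_lift`). Hence every morphism
of coverings is a left fraction, and a morphism with zero covering is killed by a morphism of `Ξ`;
this gives the calculus of fractions, fullness and faithfulness. The shift with `k = none` is itself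
a Seifert module, which leads back to `Sei A μ`.

For essential surjectivity, a projective resolution of length one resolves a Blanchfield module
exactly when it is an isomorphism modulo the augmentation (`isBlanchfield_iff`). A link module is
thus a cokernel of some `∑ d_k k` with `∑ d_k = 1`, and Fox calculus on words of bounded length
turns this into a covering (`nonempty_linearization_equiv`). Extensions of link modules lift to
extensions of Seifert modules in the same way (`FoxModule.exists_extension`); so link modules are
closed under extensions, which makes them an exact category, and the exact structure is carried over
to the fractions.

For the idempotent completion, a resolution `d : K → L` of a Blanchfield module has an inverse `c`
modulo the augmentation. The swap `(k, l) ↦ (c l, d k)`, extended by the identity to a free module,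
has a link module as cokernel, with the given module as a retract (`exists_retract_of_isBla`). -/

noncomputable section

namespace SeifertBlanchfield

/-! ### Induced modules -/

section InducedBasics

variable {A : Type u} [Ring A] {μ : ℕ}

/-- The element of the group ring given by `g ∈ F_μ`. -/
abbrev grp (A : Type u) [Ring A] {μ : ℕ} (g : FreeGroup (Fin μ)) : GroupRing A μ :=
  MonoidAlgebra.single g 1

lemma grp_one : grp A (1 : FreeGroup (Fin μ)) = 1 := rfl

lemma grp_mul (g h : FreeGroup (Fin μ)) : grp A (g * h) = grp A g * grp A h := by
  rw [grp, MonoidAlgebra.single_mul_single, one_mul]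

lemma grp_mul_smul {M : Type v} [AddCommGroup M] [Module (GroupRing A μ) M]
    (g h : FreeGroup (Fin μ)) (m : M) : grp A (g * h) • m = grp A g • grp A h • m := by
  rw [grp_mul, mul_smul]

lemma grp_inv_smul_smul {M : Type v} [AddCommGroup M] [Module (GroupRing A μ) M]
    (g : FreeGroup (Fin μ)) (m : M) : grp A g⁻¹ • grp A g • m = m := by
  rw [← grp_mul_smul, inv_mul_cancel, grp_one, one_smul]

lemma grp_smul_inv_smul {M : Type v} [AddCommGroup M] [Module (GroupRing A μ) M]
    (g : FreeGroup (Fin μ)) (m : M) : grp A g • grp A g⁻¹ • m = m := by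
  rw [← grp_mul_smul, mul_inv_cancel, grp_one, one_smul]

@[simp]
lemma augmentation_single (g : FreeGroup (Fin μ)) (a : A) :
    augmentation A μ (MonoidAlgebra.single g a) = a := by
  simp [augmentation, MonoidAlgebra.liftNCRingHom_single]

namespace Induced

section Additive

variable {P : Type u} [AddCommGroup P]

lemma single_zero (g : FreeGroup (Fin μ)) : single g (0 : P) = 0 := Finsupp.single_zero g

lemma single_add (g : FreeGroup (Fin μ)) (x y : P) :
    single g (x + y) = single g x + single g y := Finsupp.single_add g x y

/-- The inclusion of the summand `g P` in `P[F_μ]`. -/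
def singleHom (g : FreeGroup (Fin μ)) : P →+ Induced μ P := Finsupp.singleAddHom g

lemma single_sum {ι : Type*} (g : FreeGroup (Fin μ)) (s : Finset ι) (x : ι → P) :
    single g (∑ i ∈ s, x i) = ∑ i ∈ s, single g (x i) := map_sum (singleHom g) x s

/-- The coefficient at `g` of an element of `P[F_μ]`. -/
def coeff (g : FreeGroup (Fin μ)) : Induced μ P →+ P := Finsupp.applyAddHom g

lemma coeff_single (g h : FreeGroup (Fin μ)) (x : P) :
    coeff h (single g x) = if g = h then x else 0 := by
  classical
  change Finsupp.single g x h = _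
  rw [Finsupp.single_apply]

lemma ext_coeff {y y' : Induced μ P} (h : ∀ g, coeff g y = coeff g y') : y = y' :=
  Finsupp.ext h

/-- The finite set of the `g` with non-zero coefficient. -/
def support (y : Induced μ P) : Finset (FreeGroup (Fin μ)) := Finsupp.support y

lemma mem_support {y : Induced μ P} {g : FreeGroup (Fin μ)} : g ∈ support y ↔ coeff g y ≠ 0 :=
  Finsupp.mem_support_iff

lemma eq_sum_of_support_subset {y : Induced μ P} {s : Finset (FreeGroup (Fin μ))}
    (hs : support y ⊆ s) : y = ∑ g ∈ s, single g (coeff g y) := by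
  refine (Finsupp.sum_single y).symm.trans ?_
  exact Finsupp.sum_of_support_subset y hs _ fun g _ => Finsupp.single_zero g

lemma eq_sum_support (y : Induced μ P) : y = ∑ g ∈ support y, single g (coeff g y) :=
  eq_sum_of_support_subset subset_rfl

/-- The sum of the coefficients. -/
def total : Induced μ P →+ P := Finsupp.liftAddHom fun _ => AddMonoidHom.id P

lemma total_single (g : FreeGroup (Fin μ)) (x : P) : total (single g x) = x :=
  (Finsupp.liftAddHom_apply_single _ g x)

/-- The additive map `g x ↦ g f(x)`. -/
def descAdd {M : Type v} [AddCommGroup M] [Module (GroupRing A μ) M] (f : P →+ M) : Induced μ P →+ M :=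
  Finsupp.liftAddHom fun g => (DistribSMul.toAddMonoidHom M (grp A g)).comp f

lemma descAdd_single {M : Type v} [AddCommGroup M] [Module (GroupRing A μ) M] (f : P →+ M) (g : FreeGroup (Fin μ)) (x : P) :
    descAdd (A := A) f (single g x) = grp A g • f x :=
  Finsupp.liftAddHom_apply_single
    (fun g : FreeGroup (Fin μ) => (DistribSMul.toAddMonoidHom M (grp A g)).comp f) g x

end Additive

variable {P Q R : Type u} [AddCommGroup P] [AddCommGroup Q] [AddCommGroup R]
  [Module A P] [Module A Q] [Module A R]
  {M : Type v} [AddCommGroup M] [Module (GroupRing A μ) M]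

lemma grp_smul_single (h g : FreeGroup (Fin μ)) (x : P) :
    grp A h • single g x = single (h * g) x := by
  rw [single_smul_single, one_smul]

lemma single_eq_grp_smul (g : FreeGroup (Fin μ)) (x : P) :
    single g x = grp A g • single 1 x := by
  rw [grp_smul_single, mul_one]

lemma const_smul_single (a : A) (g : FreeGroup (Fin μ)) (x : P) :
    (MonoidAlgebra.single 1 a : GroupRing A μ) • single g x = single g (a • x) := by
  rw [single_smul_single, one_mul]

lemma coeff_const_smul (a : A) (g : FreeGroup (Fin μ)) (y : Induced μ P) :
    coeff g ((MonoidAlgebra.single 1 a : GroupRing A μ) • y) = a • coeff g y := by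
  rw [eq_sum_support y, Finset.smul_sum, map_sum, map_sum, Finset.smul_sum]
  refine Finset.sum_congr rfl fun h _ => ?_
  rw [const_smul_single, coeff_single, coeff_single, smul_ite, smul_zero]

/-- The sum of the coefficients is the concrete form of the projection `P[F_μ] → A ⊗ P[F_μ] = P`
along the augmentation. -/
lemma total_smul (r : GroupRing A μ) (y : Induced μ P) :
    total (r • y) = augmentation A μ r • total y := by
  induction r using MonoidAlgebra.induction_linear with
  | zero => simp
  | add r s hr hs => simp only [add_smul, map_add, hr, hs]
  | single h a =>
    rw [eq_sum_support y, Finset.smul_sum, map_sum, map_sum, Finset.smul_sum]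
    refine Finset.sum_congr rfl fun g _ => ?_
    rw [single_smul_single, total_single, total_single, augmentation_single]

lemma linearMap_ext_one {f f' : Induced μ P →ₗ[GroupRing A μ] M}
    (H : ∀ x, f (single 1 x) = f' (single 1 x)) : f = f' :=
  linearMap_ext fun g x => by
    rw [single_eq_grp_smul (A := A), map_smul, map_smul, H]

/-- The `A[F_μ]`-module morphism on `P[F_μ]` which extends an additive map compatible with the
action of `A`. -/
def desc (f : P →+ M)
    (hf : ∀ (a : A) x, f (a • x) = (MonoidAlgebra.single 1 a : GroupRing A μ) • f x) :
    Induced μ P →ₗ[GroupRing A μ] M where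
  toFun := descAdd (A := A) f
  map_add' := map_add _
  map_smul' r y := by
    rw [RingHom.id_apply]
    induction r using MonoidAlgebra.induction_linear with
    | zero => simp
    | add r s hr hs => simp only [add_smul, map_add, hr, hs]
    | single h a =>
      rw [eq_sum_support y, Finset.smul_sum, map_sum, map_sum, Finset.smul_sum]
      refine Finset.sum_congr rfl fun g _ => ?_
      rw [single_smul_single, descAdd_single, descAdd_single, hf, smul_smul, smul_smul,
        MonoidAlgebra.single_mul_single, MonoidAlgebra.single_mul_single]
      simp

lemma desc_single (f : P →+ M) (hf) (g : FreeGroup (Fin μ)) (x : P) :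
    desc (A := A) (M := M) f hf (single g x) = grp A g • f x :=
  descAdd_single f g x

lemma desc_single_one (f : P →+ M) (hf) (x : P) :
    desc (A := A) (μ := μ) (M := M) f hf (single 1 x) = f x := by
  rw [desc_single, grp_one, one_smul]

lemma map_single_one (φ : P →ₗ[A] Q) (x : P) :
    map (μ := μ) φ (single 1 x) = single 1 (φ x) := map_single φ 1 x

lemma map_surjective {φ : P →ₗ[A] Q} (h : Function.Surjective φ) :
    Function.Surjective (map (μ := μ) φ) := by
  intro y
  choose s hs using h
  refine ⟨∑ g ∈ support y, single g (s (coeff g y)), ?_⟩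
  rw [map_sum]
  conv_rhs => rw [eq_sum_support y]
  exact Finset.sum_congr rfl fun g _ => by rw [map_single, hs]

/-- The coefficient `P → Q` at `k` of a morphism `P[F_μ] → Q[F_μ]`. -/
def coeffMap (f : Induced μ P →ₗ[GroupRing A μ] Induced μ Q) (k : FreeGroup (Fin μ)) :
    P →ₗ[A] Q where
  toFun x := coeff k (f (single 1 x))
  map_add' x y := by rw [single_add, map_add, map_add]
  map_smul' a x := by
    rw [← const_smul_single, map_smul, coeff_const_smul, RingHom.id_apply]

/-- A morphism `P[F_μ] → Q[F_μ]` with `P` f.g. is a finite sum of twists. -/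
lemma exists_eq_sum_twist [Module.Finite A P] (f : Induced μ P →ₗ[GroupRing A μ] Induced μ Q) :
    ∃ s : Finset (FreeGroup (Fin μ)), f = ∑ k ∈ s, twist k (coeffMap f k) := by
  classical
  obtain ⟨t, ht⟩ := (Module.Finite.fg_top : (⊤ : Submodule A P).FG)
  -- Finitely many generators have finitely many nonzero coefficients in all, so only finitely many
  -- `coeffMap f k` are nonzero.
  let s := t.biUnion fun x => support (f (single 1 x))
  have hs : ∀ k ∉ s, coeffMap f k = 0 := fun k hk => by
    refine LinearMap.ext_on ht fun x hx => ?_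
    by_contra h
    exact hk (Finset.mem_biUnion.2 ⟨x, hx, mem_support.2 h⟩)
  refine ⟨s, linearMap_ext_one fun x => ?_⟩
  have hx : support (f (single 1 x)) ⊆ s := fun k hk => by
    by_contra h
    exact mem_support.1 hk (LinearMap.congr_fun (hs k h) x)
  rw [eq_sum_of_support_subset hx, LinearMap.sum_apply]
  exact Finset.sum_congr rfl fun k _ => by rw [twist_single, one_mul]; rfl

instance finite [Module.Finite A P] : Module.Finite (GroupRing A μ) (Induced μ P) := by
  classical
  obtain ⟨t, ht⟩ := (Module.Finite.fg_top : (⊤ : Submodule A P).FG)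
  refine ⟨⟨t.image (single 1), ?_⟩⟩
  rw [eq_top_iff]
  rintro y -
  rw [eq_sum_support y]
  refine Submodule.sum_mem _ fun g _ => ?_
  rw [single_eq_grp_smul (A := A)]
  refine Submodule.smul_mem _ _ ?_
  have : ∀ x ∈ (⊤ : Submodule A P), single 1 x ∈ Submodule.span (GroupRing A μ)
      ((t.image (single 1) : Finset (Induced μ P)) : Set (Induced μ P)) := by
    intro x hx
    rw [← ht] at hx
    induction hx using Submodule.span_induction with
    | mem x hx => exact Submodule.subset_span (by simpa using ⟨x, hx, rfl⟩)
    | zero => rw [single_zero]; exact Submodule.zero_mem _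
    | add x y _ _ hx hy => rw [single_add]; exact Submodule.add_mem _ hx hy
    | smul a x _ hx => rw [← const_smul_single]; exact Submodule.smul_mem _ _ hx
  exact this _ trivial

/-- Morphisms out of `P[F_μ]` are `A`-linear maps out of `P`, so after restriction of scalars along
`A → A[F_μ]` projectivity of `P` over `A` is enough. No condition is put on `M` or `M'`. -/
lemma exists_lift [Module.Projective A P] {M' : Type w} [AddCommGroup M']
    [Module (GroupRing A μ) M'] (p : M →ₗ[GroupRing A μ] M') (hp : Function.Surjective p)
    (f : Induced μ P →ₗ[GroupRing A μ] M') :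
    ∃ h : Induced μ P →ₗ[GroupRing A μ] M, p ∘ₗ h = f := by
  let _ : Module A M := Module.compHom M (MonoidAlgebra.singleOneRingHom : A →+* GroupRing A μ)
  let _ : Module A M' := Module.compHom M' (MonoidAlgebra.singleOneRingHom : A →+* GroupRing A μ)
  let p' : M →ₗ[A] M' :=
    { toFun := p, map_add' := map_add p, map_smul' := fun a x => map_smul p _ x }
  let i : P →ₗ[A] M' :=
    { toFun := fun x => f (single 1 x), map_add' := fun x y => by rw [single_add, map_add]
      map_smul' := fun a x => by rw [← const_smul_single, map_smul]; rfl }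
  obtain ⟨h, hh⟩ := Module.projective_lifting_property p' i hp
  have hs : ∀ (a : A) x, h.toAddMonoidHom (a • x) =
      (MonoidAlgebra.single 1 a : GroupRing A μ) • h.toAddMonoidHom x := fun a x => map_smul h a x
  refine ⟨desc h.toAddMonoidHom hs, linearMap_ext_one fun x => ?_⟩
  exact (congrArg p (desc_single_one h.toAddMonoidHom hs x)).trans (LinearMap.congr_fun hh x)

instance projective [Module.Projective A P] :
    Module.Projective (GroupRing A μ) (Induced μ P) :=
  Module.Projective.of_lifting_property'' fun f hf => exists_lift f hf LinearMap.id

/-- A f.g. `A[F_μ]`-module is a quotient of an induced module `Aⁿ[F_μ]`. -/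
lemma exists_surjective (M : Type u) [AddCommGroup M] [Module (GroupRing A μ) M]
    [Module.Finite (GroupRing A μ) M] :
    ∃ (n : ℕ) (f : Induced μ (ULift.{u} (Fin n) → A) →ₗ[GroupRing A μ] M),
      Function.Surjective f := by
  obtain ⟨n, v, hv⟩ := Module.Finite.exists_fin (R := GroupRing A μ) (M := M)
  let f : Induced μ (ULift.{u} (Fin n) → A) →ₗ[GroupRing A μ] M :=
    desc (AddMonoidHom.mk' (fun x => ∑ i, (MonoidAlgebra.single 1 (x i) : GroupRing A μ) • v i.down)
        (fun x y => by simp [add_smul, Finset.sum_add_distrib, MonoidAlgebra.single_add]))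
      (fun a x => by
        simp [Finset.smul_sum, smul_smul, MonoidAlgebra.single_mul_single])
  refine ⟨n, f, ?_⟩
  rw [← LinearMap.range_eq_top, eq_top_iff, ← hv, Submodule.span_le]
  rintro _ ⟨i, rfl⟩
  refine ⟨single 1 (Pi.single ⟨i⟩ 1), ?_⟩
  rw [desc_single_one]
  change ∑ j : ULift.{u} (Fin n), _ = _
  rw [Finset.sum_eq_single ⟨i⟩]
  · simp only [Pi.single_eq_same]
    exact one_smul _ _
  · intro j _ hj
    rw [Pi.single_eq_of_ne hj, MonoidAlgebra.single_zero, zero_smul]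
  · simp

end Induced

end InducedBasics

/-! ### Free groups act on words with operators of the form identity plus degree-raising -/

namespace Words

variable {μ : ℕ} {N N' : Type u} [AddCommGroup N] [AddCommGroup N']

/-- The operator on families indexed by words which prepends the letter `c` to a word which does
not begin with `c`, and kills the words which begin with `c`. -/
def prepend (N : Type u) [AddCommGroup N] (c : Fin μ × Bool) :
    AddMonoid.End (List (Fin μ × Bool) → N) where
  toFun f
    | [] => 0
    | b :: t => if b = c ∧ t.head? ≠ some c then f t else 0
  map_zero' := by
    funext w
    cases w <;> simp
  map_add' f g := by
    funext w
    cases w with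
    | nil => simp
    | cons b t =>
      simp only [Pi.add_apply]
      split_ifs <;> simp

lemma prepend_cons (c b : Fin μ × Bool) (t : List (Fin μ × Bool)) (f : List (Fin μ × Bool) → N) :
    prepend N c f (b :: t) = if b = c ∧ t.head? ≠ some c then f t else 0 := rfl

/-- This is what the condition on `t.head?` in `prepend` is for: with square zero, `1 + prepend c`
has the inverse `1 - prepend c`, and no infinite series occurs. -/
lemma prepend_mul_self (c : Fin μ × Bool) : prepend N c * prepend N c = 0 := by
  ext f w
  cases w with
  | nil => rfl
  | cons b t =>
    change prepend N c (prepend N c f) (b :: t) = 0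
    rw [prepend_cons]
    split_ifs with h
    · cases t with
      | nil => rfl
      | cons b' t' =>
        rw [prepend_cons, if_neg]
        rintro ⟨rfl, -⟩
        exact h.2 rfl
    · rfl

/-- The invertible operator `1 + prepend c`. -/
def unit (N : Type u) [AddCommGroup N] (c : Fin μ × Bool) :
    (AddMonoid.End (List (Fin μ × Bool) → N))ˣ where
  val := 1 + prepend N c
  inv := 1 - prepend N c
  val_inv := by rw [mul_sub, add_mul, add_mul, prepend_mul_self]; simp
  inv_val := by rw [mul_add, sub_mul, sub_mul, prepend_mul_self]; simp

/-- The action of the free group with `z_i = (1 + prepend (i, true)) (1 + prepend (i, false))`. -/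
def action (μ : ℕ) (N : Type u) [AddCommGroup N] :
    FreeGroup (Fin μ) →* (AddMonoid.End (List (Fin μ × Bool) → N))ˣ :=
  -- Two square-zero operators per generator give `z_i` and `z_i⁻¹` the leading terms `(i, true)(i,
  -- false)` and `(i, false)(i, true)`, both with coefficient `1`. With a single operator `x` of
  -- square zero, `(1 + x)^m = 1 + m x` would lose powers in positive characteristic.
  FreeGroup.lift fun i => unit N (i, true) * unit N (i, false)

/-- The action of `g` as an additive endomorphism. -/
def act (g : FreeGroup (Fin μ)) : AddMonoid.End (List (Fin μ × Bool) → N) :=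
  (action μ N g : AddMonoid.End (List (Fin μ × Bool) → N))

lemma act_one : act (N := N) (1 : FreeGroup (Fin μ)) = 1 := by
  rw [act, map_one, Units.val_one]

lemma act_mul (g h : FreeGroup (Fin μ)) : act (N := N) (g * h) = act g * act h := by
  rw [act, map_mul, Units.val_mul]; rfl

lemma act_of (i : Fin μ) :
    act (N := N) (FreeGroup.of i) = (1 + prepend N (i, true)) * (1 + prepend N (i, false)) := by
  rw [act, action, FreeGroup.lift_apply_of, Units.val_mul]; rfl

lemma act_of_inv (i : Fin μ) :
    act (N := N) (FreeGroup.of i)⁻¹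
      = (1 - prepend N (i, false)) * (1 - prepend N (i, true)) := by
  rw [act, map_inv, action, FreeGroup.lift_apply_of, mul_inv_rev, Units.val_mul]; rfl

/-- The family `f` vanishes on the words of length less than `n`. -/
def VanishBelow (n : ℕ) (f : List (Fin μ × Bool) → N) : Prop := ∀ w, w.length < n → f w = 0

lemma VanishBelow.add {n : ℕ} {f g : List (Fin μ × Bool) → N} (hf : VanishBelow n f)
    (hg : VanishBelow n g) : VanishBelow n (f + g) := fun w hw => by
  rw [Pi.add_apply, hf w hw, hg w hw, add_zero]

lemma VanishBelow.neg {n : ℕ} {f : List (Fin μ × Bool) → N} (hf : VanishBelow n f) :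
    VanishBelow n (-f) := fun w hw => by
  rw [Pi.neg_apply, hf w hw, neg_zero]

lemma VanishBelow.mono {n m : ℕ} {f : List (Fin μ × Bool) → N} (hf : VanishBelow n f)
    (h : m ≤ n) : VanishBelow m f := fun w hw => hf w (hw.trans_le h)

lemma VanishBelow.prepend {n : ℕ} {f : List (Fin μ × Bool) → N} (hf : VanishBelow n f)
    (c : Fin μ × Bool) : VanishBelow (n + 1) (prepend N c f) := fun w hw => by
  cases w with
  | nil => rfl
  | cons b t =>
    rw [prepend_cons]
    split_ifs
    · exact hf t (by simpa using hw)
    · rfl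

/-- The operator `T - 1` raises the degree. -/
def IsUnipotent (T : AddMonoid.End (List (Fin μ × Bool) → N)) : Prop :=
  ∀ n f, VanishBelow n f → VanishBelow (n + 1) (T f - f)

lemma IsUnipotent.mul {T S : AddMonoid.End (List (Fin μ × Bool) → N)} (hT : IsUnipotent T)
    (hS : IsUnipotent S) : IsUnipotent (T * S) := fun n f hf => by
  have h1 := hS n f hf
  have h2 : VanishBelow n (S f) := by
    simpa using (h1.mono n.le_succ).add hf
  have := (hT n _ h2).add h1
  rwa [sub_add_sub_cancel] at this

lemma isUnipotent_one : IsUnipotent (1 : AddMonoid.End (List (Fin μ × Bool) → N)) :=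
  fun n f _ w _ => by
    change f w - f w = 0
    exact sub_self _

lemma isUnipotent_add (c : Fin μ × Bool) : IsUnipotent (1 + prepend N c) := fun n f hf => by
  have : (1 + prepend N c) f - f = prepend N c f := add_sub_cancel_left f _
  rw [this]
  exact hf.prepend c

lemma isUnipotent_sub (c : Fin μ × Bool) : IsUnipotent (1 - prepend N c) := fun n f hf => by
  have : (1 - prepend N c) f - f = -prepend N c f := by
    change f - _ - f = _
    abel
  rw [this]
  exact (hf.prepend c).neg

lemma isUnipotent_act (g : FreeGroup (Fin μ)) : IsUnipotent (act (N := N) g) := by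
  induction g using FreeGroup.induction_on with
  | C1 => rw [act_one]; exact isUnipotent_one
  | of i => rw [act_of]; exact (isUnipotent_add _).mul (isUnipotent_add _)
  | inv_of i _ => rw [act_of_inv]; exact (isUnipotent_sub _).mul (isUnipotent_sub _)
  | mul g h hg hh => rw [act_mul]; exact hg.mul hh

lemma prepend_comp (φ : N →+ N') (c : Fin μ × Bool) (f : List (Fin μ × Bool) → N) :
    prepend N' c (φ ∘ f) = φ ∘ prepend N c f := by
  funext w
  cases w with
  | nil => exact (map_zero φ).symm
  | cons b t =>
    rw [Function.comp_apply, prepend_cons, prepend_cons, apply_ite φ, map_zero]; rfl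

lemma act_comp (φ : N →+ N') (g : FreeGroup (Fin μ)) (f : List (Fin μ × Bool) → N) :
    act g (φ ∘ f) = φ ∘ act g f := by
  have hadd : ∀ c (f : List (Fin μ × Bool) → N),
      (1 + prepend N' c) (φ ∘ f) = φ ∘ (1 + prepend N c) f := fun c f => by
    change φ ∘ f + prepend N' c (φ ∘ f) = _
    rw [prepend_comp]
    funext w
    exact (map_add φ _ _).symm
  have hsub : ∀ c (f : List (Fin μ × Bool) → N),
      (1 - prepend N' c) (φ ∘ f) = φ ∘ (1 - prepend N c) f := fun c f => by
    change φ ∘ f - prepend N' c (φ ∘ f) = _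
    rw [prepend_comp]
    funext w
    exact (map_sub φ _ _).symm
  induction g using FreeGroup.induction_on generalizing f with
  | C1 => rw [act_one, act_one]; rfl
  | of i =>
    rw [act_of, act_of]
    change (1 + prepend N' _) ((1 + prepend N' _) _) = _
    rw [hadd, hadd]; rfl
  | inv_of i _ =>
    rw [act_of_inv, act_of_inv]
    change (1 - prepend N' _) ((1 - prepend N' _) _) = _
    rw [hsub, hsub]; rfl
  | mul g h hg hh =>
    rw [act_mul, act_mul]
    change act g (act h _) = _
    rw [hh, hg]; rfl

/-- The word in which each letter `z_i^{±1}` of `l` is replaced by two letters. -/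
def double : List (Fin μ × Bool) → List (Fin μ × Bool)
  | [] => []
  | a :: l => a :: (a.1, !a.2) :: double l

lemma double_length (l : List (Fin μ × Bool)) : (double l).length = 2 * l.length := by
  induction l with
  | nil => rfl
  | cons a l ih => simp only [double, List.length_cons, ih]; ring

lemma double_injective : Function.Injective (double (μ := μ)) := by
  intro l l' h
  induction l generalizing l' with
  | nil => cases l' with
    | nil => rfl
    | cons => simp [double] at h
  | cons a l ih => cases l' with
    | nil => simp [double] at h
    | cons a' l' =>
      simp only [double, List.cons.injEq] at h
      rw [h.1, ih h.2.2]

/-- The family with value `x` at the empty word. -/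
def base (μ : ℕ) : N →+ (List (Fin μ × Bool) → N) := AddMonoidHom.single (fun _ => N) []

/-- The sign `ε` separates a letter from its inverse, but it affects only the linear terms: the
quadratic term, the only one that lengthens words by two, has coefficient `1` in both cases. -/
lemma act_mk_cons (a : Fin μ × Bool) (l : List (Fin μ × Bool)) (f : List (Fin μ × Bool) → N) :
    ∃ ε : ℤ, ε * ε = 1 ∧ act (FreeGroup.mk (a :: l)) f
      = act (FreeGroup.mk l) f + ε • prepend N a (act (FreeGroup.mk l) f)
        + ε • prepend N (a.1, !a.2) (act (FreeGroup.mk l) f)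
        + prepend N a (prepend N (a.1, !a.2) (act (FreeGroup.mk l) f)) := by
  have hmk : FreeGroup.mk (a :: l) = FreeGroup.mk [a] * FreeGroup.mk l := by
    rw [FreeGroup.mul_mk]; rfl
  rw [hmk, act_mul]
  set f' := act (FreeGroup.mk l) f with hf'
  obtain ⟨i, b⟩ := a
  cases b with
  | true =>
    refine ⟨1, one_mul 1, ?_⟩
    change act (FreeGroup.of i) f' = _
    rw [act_of]
    change (f' + prepend N _ f') + prepend N _ (f' + prepend N _ f') = _
    rw [map_add]
    simp only [Bool.not_true, one_smul]
    abel
  | false =>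
    refine ⟨-1, by norm_num, ?_⟩
    have : FreeGroup.mk [(i, false)] = (FreeGroup.of i)⁻¹ := rfl
    change act (FreeGroup.mk [(i, false)]) f' = _
    rw [this, act_of_inv]
    change (f' - prepend N _ f') - prepend N _ (f' - prepend N _ f') = _
    rw [map_sub]
    simp only [Bool.not_false, neg_smul, one_smul]
    abel

/-- Each letter lengthens words by at most two, and only its quadratic term attains two. At words of
length at least `2 * l.length` one therefore sees only the product of the leading terms, which is
supported on `double l`. -/
lemma act_base (l : List (Fin μ × Bool)) (hl : FreeGroup.IsReduced l) (x : N)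
    (w : List (Fin μ × Bool)) (hw : 2 * l.length ≤ w.length) :
    act (FreeGroup.mk l) (base μ x) w = if w = double l then x else 0 := by
  induction l generalizing w with
  | nil =>
    change act (1 : FreeGroup (Fin μ)) _ _ = _
    rw [act_one]
    change Pi.single (M := fun _ => N) [] x w = _
    rw [Pi.single_apply]; rfl
  | cons a l ih =>
    have hl' : FreeGroup.IsReduced l := hl.infix (List.suffix_cons a l).isInfix
    have ih := ih hl'
    obtain ⟨ε, -, h⟩ := act_mk_cons a l (base μ x)
    rw [h]
    set f' := act (FreeGroup.mk l) (base μ x) with hf'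
    have hz : ∀ t : List (Fin μ × Bool), 2 * l.length < t.length → f' t = 0 := fun t ht => by
      rw [ih t ht.le, if_neg]
      rintro rfl
      rw [double_length] at ht
      exact lt_irrefl _ ht
    obtain _ | ⟨b, _ | ⟨b', t⟩⟩ := w
    · simp at hw
    · simp only [List.length_cons, List.length_nil] at hw
      omega
    simp only [List.length_cons] at hw
    have h1 : ∀ c, prepend N c f' (b :: b' :: t) = 0 := fun c => by
      rw [prepend_cons, hz (b' :: t) (by simp only [List.length_cons]; omega), ite_self]
    simp only [Pi.add_apply, Pi.smul_apply, h1, smul_zero, add_zero]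
    rw [hz (b :: b' :: t) (by simp only [List.length_cons]; omega), zero_add, prepend_cons,
      prepend_cons, ih t (by omega)]
    -- Reducedness enters here: the first letter of `l` is not inverse to `a`, so prepending `(a.1,
    -- !a.2)` does not kill the word `double l`.
    have hhead : t = double l → t.head? ≠ some (a.1, !a.2) := by
      rintro rfl
      cases l with
      | nil => simp [double]
      | cons a' l =>
        rw [FreeGroup.isReduced_cons_cons] at hl
        simp only [double, List.head?_cons, ne_eq, Option.some.injEq]
        rintro rfl
        simpa using hl.1 rfl
    have hne : (a.1, !a.2) ≠ a := fun h => by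
      simpa using congrArg Prod.snd h
    by_cases hw : b :: b' :: t = double (a :: l)
    · rw [if_pos hw]
      simp only [double, List.cons.injEq] at hw
      obtain ⟨rfl, rfl, h3⟩ := hw
      rw [if_pos ⟨rfl, by simpa using hne⟩, if_pos ⟨rfl, hhead h3⟩, if_pos h3]
    · rw [if_neg hw]
      simp only [double, List.cons.injEq, not_and] at hw
      split_ifs with h1 h2 h3
      · exact absurd h3 (hw h1.1 h2.1)
      all_goals rfl

/-- The additive map `g x ↦ g⁻¹ · x` from `P[F_μ]` to families indexed by words. -/
def ofInduced : Induced μ N →+ (List (Fin μ × Bool) → N) :=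
  Finsupp.liftAddHom fun g => (act (N := N) g⁻¹).comp (base μ)

lemma ofInduced_single (g : FreeGroup (Fin μ)) (x : N) :
    ofInduced (Induced.single g x) = act g⁻¹ (base μ x) :=
  Finsupp.liftAddHom_apply_single (fun g => (act (N := N) g⁻¹).comp (base μ)) g x

/-- For `g` of maximal length in the support, `act_base` shows that at the word `double
(g⁻¹).toWord` only the summand at `g` contributes, and its contribution is the coefficient at `g`.
-/
lemma ofInduced_injective : Function.Injective (ofInduced (μ := μ) (N := N)) := by
  rw [injective_iff_map_eq_zero]
  intro y hy
  by_contra hne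
  have hs : (Induced.support y).Nonempty := by
    rw [Finset.nonempty_iff_ne_empty]
    intro h
    exact hne (by rw [Induced.eq_sum_support y, h, Finset.sum_empty])
  obtain ⟨g, hg, hmax⟩ := (Induced.support y).exists_max_image FreeGroup.norm hs
  have key : ∀ h ∈ Induced.support y, ofInduced (Induced.single h (Induced.coeff h y))
      (double (g⁻¹).toWord) = if h = g then Induced.coeff g y else 0 := fun h hh => by
    have hle : (h⁻¹).toWord.length ≤ (g⁻¹).toWord.length := by
      have := hmax h hh
      rwa [← FreeGroup.norm_inv_eq (x := h), ← FreeGroup.norm_inv_eq (x := g)] at this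
    have := act_base (h⁻¹).toWord FreeGroup.isReduced_toWord (Induced.coeff h y)
      (double (g⁻¹).toWord) (by rw [double_length]; omega)
    rw [FreeGroup.mk_toWord] at this
    rw [ofInduced_single, this]
    by_cases hgh : h = g
    · rw [if_pos hgh, hgh, if_pos rfl]
    · rw [if_neg hgh, if_neg]
      intro h'
      exact hgh (inv_injective (FreeGroup.toWord_injective (double_injective h').symm))
  have h0 : ofInduced y (double (g⁻¹).toWord) = Induced.coeff g y := by
    conv_lhs => rw [Induced.eq_sum_support y, map_sum, Finset.sum_apply]
    rw [Finset.sum_congr rfl key, Finset.sum_ite_eq' _ g fun _ => Induced.coeff g y, if_pos hg]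
  rw [hy] at h0
  exact Induced.mem_support.1 hg h0.symm

variable {A : Type u} [Ring A] [Module A N] [Module A N']

/-- The inverse in `ofInduced` exists for this: a twist multiplies by `k` on the right, which
becomes the left action of `k⁻¹`. -/
lemma ofInduced_twist (k : FreeGroup (Fin μ)) (φ : N →ₗ[A] N') (y : Induced μ N) :
    ofInduced (Induced.twist k φ y) = φ ∘ act k⁻¹ (ofInduced y) := by
  rw [Induced.eq_sum_support y, map_sum, map_sum, map_sum, map_sum]
  funext w
  rw [Function.comp_apply, Finset.sum_apply, Finset.sum_apply, map_sum]
  refine Finset.sum_congr rfl fun g _ => ?_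
  rw [Induced.twist_single, ofInduced_single, ofInduced_single, mul_inv_rev, act_mul]
  change act k⁻¹ (act g⁻¹ _) w = φ (act k⁻¹ (act g⁻¹ _) w)
  have hb : base μ (φ (Induced.coeff g y)) = φ.toAddMonoidHom ∘ base μ (Induced.coeff g y) := by
    funext v
    change Pi.single (M := fun _ => N') [] _ v = φ (Pi.single (M := fun _ => N) [] _ v)
    rw [Pi.single_apply, Pi.single_apply, apply_ite φ, map_zero]
  rw [hb, act_comp, act_comp]
  rfl

/-- If `y = ∑ φ_k (1 - k) y` then `y = 0`. -/
lemma eq_zero_of_eq_sum {ι : Type*} (s : Finset ι) (k : ι → FreeGroup (Fin μ))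
    (φ : ι → N →ₗ[A] N) (y : Induced μ N)
    (hy : y = ∑ j ∈ s, (Induced.map (φ j) y - Induced.twist (k j) (φ j) y)) : y = 0 := by
  refine ofInduced_injective ?_
  rw [map_zero]
  have hY : ofInduced y = ∑ j ∈ s, (φ j ∘ (ofInduced y - act (k j)⁻¹ (ofInduced y))) := by
    conv_lhs => rw [hy, map_sum]
    refine Finset.sum_congr rfl fun j _ => ?_
    rw [map_sub, Induced.map, ofInduced_twist, ofInduced_twist, inv_one, act_one]
    funext w
    exact (map_sub (φ j) _ _).symm
  -- Every `1 - k_j⁻¹` raises the vanishing order by one and the `φ_j` preserve it, so the equation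
  -- for `y` improves any vanishing order.
  have hv : ∀ n, VanishBelow n (ofInduced y) := fun n => by
    induction n with
    | zero => exact fun w hw => absurd hw (Nat.not_lt_zero _)
    | succ n ih =>
      intro w hw
      rw [hY, Finset.sum_apply]
      refine Finset.sum_eq_zero fun j _ => ?_
      have := isUnipotent_act (k j)⁻¹ n _ ih w hw
      rw [Pi.sub_apply, sub_eq_zero] at this
      rw [Function.comp_apply, Pi.sub_apply, this, sub_self, map_zero]
  funext w
  exact hv (w.length + 1) w (Nat.lt_succ_self _)

end Words

/-! ### Injectivity of endomorphisms with identity augmentation -/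

section Injectivity

variable {A : Type u} [Ring A] {μ : ℕ} {P : Type u} [AddCommGroup P] [Module A P]

lemma Induced.total_eq_sum_coeffMap {s : Finset (FreeGroup (Fin μ))}
    {f : Induced μ P →ₗ[GroupRing A μ] Induced μ P}
    (hs : f = ∑ k ∈ s, Induced.twist k (Induced.coeffMap f k)) (x : P) :
    Induced.total (f (Induced.single 1 x)) = ∑ k ∈ s, Induced.coeffMap f k x := by
  conv_lhs => rw [hs, LinearMap.sum_apply, map_sum]
  exact Finset.sum_congr rfl fun k _ => by rw [Induced.twist_single, Induced.total_single]

/-- An endomorphism of `P[F_μ]` whose augmentation is the identity is injective. -/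
lemma Induced.injective_of_total_eq [Module.Finite A P]
    (f : Induced μ P →ₗ[GroupRing A μ] Induced μ P)
    (hf : ∀ x, Induced.total (f (Induced.single 1 x)) = x) : Function.Injective f := by
  rw [injective_iff_map_eq_zero]
  intro y hy
  obtain ⟨s, hs⟩ := Induced.exists_eq_sum_twist f
  -- For `f = ∑ f_k k` with `∑ f_k = 1` and `f y = 0` one has `y = y - f y = ∑ f_k (1 - k) y`.
  refine Words.eq_zero_of_eq_sum s id (Induced.coeffMap f) y ?_
  have h1 : ∑ k ∈ s, Induced.map (Induced.coeffMap f k) = LinearMap.id (R := GroupRing A μ) :=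
    Induced.linearMap_ext_one fun x => by
      rw [LinearMap.sum_apply, LinearMap.id_apply]
      conv_rhs => rw [← hf x, Induced.total_eq_sum_coeffMap hs x, Induced.single_sum]
      exact Finset.sum_congr rfl fun k _ => Induced.map_single_one _ x
  rw [Finset.sum_sub_distrib, ← LinearMap.sum_apply, h1, ← LinearMap.sum_apply]
  have : (∑ k ∈ s, Induced.twist (id k) (Induced.coeffMap f k)) y = 0 := by
    rw [← hy]
    exact LinearMap.congr_fun hs.symm y
  rw [this, sub_zero]
  rfl

end Injectivity

/-! ### Modules with `μ` endomorphisms and their coverings -/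

/-- An `A`-module with `μ` endomorphisms. -/
structure FoxModule (A : Type u) [Ring A] (μ : ℕ) where
  /-- the underlying module -/
  N : ModuleCat.{u} A
  /-- the endomorphisms -/
  δ : Fin μ → Module.End A N

namespace FoxModule

variable {A : Type u} [Ring A] {μ : ℕ}

/-- The morphisms of modules with `μ` endomorphisms. -/
structure Hom (D E : FoxModule A μ) where
  /-- the underlying linear map -/
  hom : D.N →ₗ[A] E.N
  comm : ∀ i x, hom (D.δ i x) = E.δ i (hom x)

/-- The composite of two morphisms. -/
def Hom.comp {D E G : FoxModule A μ} (t : Hom E G) (s : Hom D E) : Hom D G :=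
  ⟨t.hom ∘ₗ s.hom, fun i x => by
    rw [LinearMap.comp_apply, LinearMap.comp_apply, s.comm, t.comm]⟩

/-- The identity morphism. -/
def Hom.id (D : FoxModule A μ) : Hom D D := ⟨LinearMap.id, fun _ _ => rfl⟩

variable (D : FoxModule A μ)

/-- The endomorphism `1 - ∑ δ_i (1 - z_i)` of `N[F_μ]`. -/
def pres : Module.End (GroupRing A μ) (Induced μ D.N) :=
  LinearMap.id - ∑ i, (Induced.map (D.δ i) - Induced.twist (FreeGroup.of i) (D.δ i))

lemma pres_single (g : FreeGroup (Fin μ)) (x : D.N) :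
    D.pres (Induced.single g x) = Induced.single g x
      - ∑ i, (Induced.single g (D.δ i x) - Induced.single (g * FreeGroup.of i) (D.δ i x)) := by
  simp [pres, LinearMap.sum_apply, Induced.map_single, Induced.twist_single]

lemma pres_injective : Function.Injective D.pres := by
  rw [injective_iff_map_eq_zero]
  intro y hy
  refine Words.eq_zero_of_eq_sum Finset.univ FreeGroup.of D.δ y ?_
  have := sub_eq_zero.1 hy
  rw [LinearMap.id_apply, LinearMap.sum_apply] at this
  exact this

/-- The augmentation kills every `1 - z_i`, so `pres` augments to the identity. This is why
coverings are Blanchfield modules. -/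
lemma total_pres (y : Induced μ D.N) : Induced.total (D.pres y) = Induced.total y := by
  rw [Induced.eq_sum_support y, map_sum, map_sum, map_sum]
  refine Finset.sum_congr rfl fun g _ => ?_
  simp [pres_single, Induced.total_single]

/-- The covering `N[F_μ] / (1 - ∑ δ_i (1 - z_i))`. -/
abbrev Cov : Type u := Induced μ D.N ⧸ LinearMap.range D.pres

/-- The class in the covering of an element of `N`. -/
def cls : D.N →+ D.Cov :=
  (Submodule.mkQ (LinearMap.range D.pres)).toAddMonoidHom.comp (Induced.singleHom 1)

lemma cls_apply (x : D.N) : D.cls x = (LinearMap.range D.pres).mkQ (Induced.single 1 x) := rfl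

lemma cls_const_smul (a : A) (x : D.N) :
    D.cls (a • x) = (MonoidAlgebra.single 1 a : GroupRing A μ) • D.cls x := by
  rw [cls_apply, cls_apply, ← map_smul, Induced.const_smul_single]

/-- The defining relation of the covering: the `δ_i x` represent the coordinates of the class of `x`
relative to the `1 - z_i`. -/
lemma cls_eq (x : D.N) : D.cls x = ∑ i, (1 - grp A (FreeGroup.of i)) • D.cls (D.δ i x) := by
  rw [← sub_eq_zero]
  have h : D.cls x - ∑ i, (1 - grp A (FreeGroup.of i)) • D.cls (D.δ i x)
      = (LinearMap.range D.pres).mkQ (D.pres (Induced.single 1 x)) := by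
    rw [pres_single, map_sub, map_sum, cls_apply]
    congr 1
    refine Finset.sum_congr rfl fun i _ => ?_
    rw [cls_apply, sub_smul, one_smul, map_sub, one_mul, ← map_smul, Induced.grp_smul_single,
      mul_one]
  rw [h]
  exact (Submodule.Quotient.mk_eq_zero _).2 ⟨_, rfl⟩

section Desc

variable {M : Type v} [AddCommGroup M] [Module (GroupRing A μ) M]

lemma pres_le_ker (f : Induced μ D.N →ₗ[GroupRing A μ] M)
    (hf : ∀ x, f (Induced.single 1 x)
      = ∑ i, (1 - grp A (FreeGroup.of i)) • f (Induced.single 1 (D.δ i x))) :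
    LinearMap.range D.pres ≤ LinearMap.ker f := by
  have h : f ∘ₗ D.pres = 0 := Induced.linearMap_ext_one fun x => by
    rw [LinearMap.comp_apply, pres_single, map_sub, map_sum, LinearMap.zero_apply, sub_eq_zero, hf]
    refine Finset.sum_congr rfl fun i _ => ?_
    rw [sub_smul, one_smul, map_sub, one_mul, ← map_smul, Induced.grp_smul_single, mul_one]
  rintro _ ⟨y, rfl⟩
  exact LinearMap.congr_fun h y

/-- The morphism on the covering given by a morphism on the induced module. -/
def covDesc (f : Induced μ D.N →ₗ[GroupRing A μ] M)
    (hf : ∀ x, f (Induced.single 1 x)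
      = ∑ i, (1 - grp A (FreeGroup.of i)) • f (Induced.single 1 (D.δ i x))) :
    D.Cov →ₗ[GroupRing A μ] M :=
  (LinearMap.range D.pres).liftQ f (D.pres_le_ker f hf)

/-- The morphism on the covering given by an additive map on the module. -/
def covLift (f : D.N →+ M)
    (hs : ∀ (a : A) x, f (a • x) = (MonoidAlgebra.single 1 a : GroupRing A μ) • f x)
    (hf : ∀ x, f x = ∑ i, (1 - grp A (FreeGroup.of i)) • f (D.δ i x)) :
    D.Cov →ₗ[GroupRing A μ] M :=
  D.covDesc (Induced.desc f hs) fun x => by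
    simp only [Induced.desc_single_one]
    exact hf x

lemma covLift_cls (f : D.N →+ M) (hs) (hf) (x : D.N) : D.covLift f hs hf (D.cls x) = f x :=
  Induced.desc_single_one f hs x

lemma cov_hom_ext {f f' : D.Cov →ₗ[GroupRing A μ] M} (h : ∀ x, f (D.cls x) = f' (D.cls x)) :
    f = f' :=
  Submodule.linearMap_qext _ (Induced.linearMap_ext_one h)

end Desc

/-- The covering of a morphism. -/
def covMap {D E : FoxModule A μ} (s : Hom D E) : D.Cov →ₗ[GroupRing A μ] E.Cov :=
  D.covLift (E.cls.comp s.hom.toAddMonoidHom)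
    (fun a x => by
      change E.cls (s.hom (a • x)) = _ • E.cls (s.hom x)
      rw [map_smul, cls_const_smul])
    (fun x => by
      change E.cls (s.hom x) = ∑ i, _ • E.cls (s.hom (D.δ i x))
      simp only [s.comm]
      exact E.cls_eq _)

lemma covMap_cls {D E : FoxModule A μ} (s : Hom D E) (x : D.N) :
    covMap s (D.cls x) = E.cls (s.hom x) := D.covLift_cls _ _ _ x

lemma covMap_comp {D E G : FoxModule A μ} (t : Hom E G) (s : Hom D E) :
    covMap (t.comp s) = covMap t ∘ₗ covMap s :=
  D.cov_hom_ext fun x => by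
    rw [LinearMap.comp_apply, covMap_cls, covMap_cls, covMap_cls]; rfl

lemma covMap_id (D : FoxModule A μ) : covMap (Hom.id D) = LinearMap.id :=
  D.cov_hom_ext fun x => by rw [covMap_cls]; rfl

/-- The morphism induces an isomorphism of coverings. -/
def Hom.IsCovEquiv {D E : FoxModule A μ} (s : Hom D E) : Prop := Function.Bijective (covMap s)

lemma Hom.IsCovEquiv.comp {D E G : FoxModule A μ} {t : Hom E G} {s : Hom D E}
    (ht : t.IsCovEquiv) (hs : s.IsCovEquiv) : (t.comp s).IsCovEquiv := by
  rw [IsCovEquiv, covMap_comp, LinearMap.coe_comp]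
  exact Function.Bijective.comp ht hs

lemma Hom.isCovEquiv_id (D : FoxModule A μ) : (Hom.id D).IsCovEquiv := by
  rw [IsCovEquiv, covMap_id]
  exact Function.bijective_id

/-! ### Shifts -/

/-- The letter given by `k`, or `1`. -/
def base (k : Option (Fin μ)) : FreeGroup (Fin μ) := k.elim 1 FreeGroup.of

/-- The endomorphisms of the shift. -/
def shiftδ (k : Option (Fin μ)) (i : Fin μ) : (Fin μ → D.N) →ₗ[A] (Fin μ → D.N) where
  -- The family `n` stands for `m = z_k⁻¹ ∑ (1 - z_j) n_j`. Since `m = (1 - z_k) m + z_k m`, the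
  -- `i`-th coordinate of `m` is `n_i`, plus `m` itself if `i = k`; here `n_i` is rewritten in the
  -- shift as in `toShiftHom`.
  toFun n j := (if k = some i then n j else 0) + D.δ j (n i) - (if k = some j then n i else 0)
  map_add' m n := by
    funext j
    simp only [Pi.add_apply, map_add]
    split_ifs <;> abel
  map_smul' a n := by
    funext j
    simp only [Pi.smul_apply, map_smul, RingHom.id_apply, smul_sub, smul_add, smul_ite, smul_zero]

/-- The module `⨁_j z_k⁻¹ (1 - z_j) N`, with `z_k` replaced by `1` for `k = none`. -/
def shift (k : Option (Fin μ)) : FoxModule A μ where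
  N := ModuleCat.of A (Fin μ → D.N)
  δ := D.shiftδ k

/-- The components of an element of the shift. -/
def entry (k : Option (Fin μ)) (j : Fin μ) : (D.shift k).N →ₗ[A] D.N :=
  (LinearMap.proj j : (Fin μ → D.N) →ₗ[A] D.N)

/-- The inclusions of the summands in the shift. -/
def incl (k : Option (Fin μ)) (j : Fin μ) : D.N →ₗ[A] (D.shift k).N :=
  (LinearMap.single A (fun _ : Fin μ => D.N) j : D.N →ₗ[A] (Fin μ → D.N))

lemma entry_incl (k : Option (Fin μ)) (i j : Fin μ) (x : D.N) :
    D.entry k i (D.incl k j x) = if i = j then x else 0 :=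
  Pi.single_apply (M := D.N) j x i

variable {D} in
lemma shift_ext {k : Option (Fin μ)} {m n : (D.shift k).N}
    (h : ∀ j, D.entry k j m = D.entry k j n) : m = n := funext h

lemma entry_δ (k : Option (Fin μ)) (i j : Fin μ) (n : (D.shift k).N) :
    D.entry k j ((D.shift k).δ i n) = (if k = some i then D.entry k j n else 0)
      + D.δ j (D.entry k i n) - (if k = some j then D.entry k i n else 0) := rfl

/-- The linear map underlying the morphism to the shift. -/
def toShiftHom (k : Option (Fin μ)) : D.N →ₗ[A] (D.shift k).N :=
  -- From `z_k x = x - (1 - z_k) x`, where `x = ∑ (1 - z_j) δ_j x`.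
  (LinearMap.pi fun j => D.δ j - (if k = some j then LinearMap.id else 0) :
    D.N →ₗ[A] (Fin μ → D.N))

lemma entry_toShiftHom (k : Option (Fin μ)) (x : D.N) (j : Fin μ) :
    D.entry k j (D.toShiftHom k x) = D.δ j x - (if k = some j then x else 0) := by
  change (D.δ j - (if k = some j then LinearMap.id else 0 : D.N →ₗ[A] D.N)) x = _
  rw [LinearMap.sub_apply]
  split_ifs <;> rfl

/-- The morphism from a module to its shift. -/
def toShift (k : Option (Fin μ)) : Hom D (D.shift k) where
  hom := D.toShiftHom k
  comm i x := by
    refine shift_ext fun j => ?_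
    rw [entry_δ, entry_toShiftHom, entry_toShiftHom, entry_toShiftHom, map_sub]
    split_ifs <;> simp

lemma entry_toShift (k : Option (Fin μ)) (x : D.N) (j : Fin μ) :
    D.entry k j ((D.toShift k).hom x) = D.δ j x - (if k = some j then x else 0) :=
  D.entry_toShiftHom k x j

lemma shift_δ_eq (k : Option (Fin μ)) (i : Fin μ) (n : (D.shift k).N) :
    (D.shift k).δ i n = (if k = some i then n else 0) + (D.toShift k).hom (D.entry k i n) := by
  refine shift_ext fun j => ?_
  rw [entry_δ, map_add, entry_toShift, apply_ite (D.entry k j), map_zero, add_sub_assoc]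

lemma sum_base {M : Type v} [AddCommGroup M] [Module (GroupRing A μ) M]
    (k : Option (Fin μ)) (m : M) :
    ∑ i, (1 - grp A (FreeGroup.of i)) • (if k = some i then m else 0) = m - grp A (base k) • m := by
  cases k with
  | none => simp [base, grp_one]
  | some k => simp [base, sub_smul]

/-- Cancelling the term `(1 - z_k) m` in `cls_eq` leaves `z_k m = ∑ (1 - z_j) n_j`: in the covering
of the shift, a family does stand for the element it was designed to be. -/
lemma shift_smul_cls (k : Option (Fin μ)) (n : (D.shift k).N) :
    grp A (base k) • (D.shift k).cls n = ∑ i, (1 - grp A (FreeGroup.of i)) •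
      (D.shift k).cls ((D.toShift k).hom (D.entry k i n)) := by
  have h := (D.shift k).cls_eq n
  simp only [shift_δ_eq, map_add, smul_add, Finset.sum_add_distrib] at h
  have h2 : ∀ i, (D.shift k).cls (if k = some i then n else 0)
      = if k = some i then (D.shift k).cls n else 0 := fun i => by
    rw [apply_ite (D.shift k).cls, map_zero]
  simp only [h2, sum_base] at h
  rw [sub_add_eq_add_sub, eq_sub_iff_add_eq] at h
  exact add_left_cancel h

/-- The inverse on coverings of the morphism to the shift. -/
def ofShift (k : Option (Fin μ)) : (D.shift k).Cov →ₗ[GroupRing A μ] D.Cov :=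
  (D.shift k).covLift
    { toFun n := grp A (base k)⁻¹ • ∑ j, (1 - grp A (FreeGroup.of j)) • D.cls (D.entry k j n)
      map_zero' := by simp
      map_add' m n := by
        rw [← smul_add, ← Finset.sum_add_distrib]
        refine congrArg _ (Finset.sum_congr rfl fun j _ => ?_)
        rw [map_add, map_add, smul_add] }
    (fun a n => by
      change grp A (base k)⁻¹ • ∑ j, (1 - grp A (FreeGroup.of j)) • D.cls (D.entry k j (a • n))
        = _ • (grp A (base k)⁻¹ • ∑ j, (1 - grp A (FreeGroup.of j)) • D.cls (D.entry k j n))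
      have hc : ∀ g : FreeGroup (Fin μ), (MonoidAlgebra.single 1 a : GroupRing A μ) * grp A g
          = grp A g * MonoidAlgebra.single 1 a := fun g => by
        rw [MonoidAlgebra.single_mul_single, MonoidAlgebra.single_mul_single, one_mul, mul_one,
          one_mul, mul_one]
      rw [smul_smul, hc, mul_smul]
      congr 1
      rw [Finset.smul_sum]
      refine Finset.sum_congr rfl fun j _ => ?_
      rw [map_smul, cls_const_smul, smul_smul, smul_smul, sub_mul, mul_sub, hc, one_mul, mul_one])
    (fun n => by
      change grp A (base k)⁻¹ • ∑ j, (1 - grp A (FreeGroup.of j)) • D.cls (D.entry k j n)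
        = ∑ i, (1 - grp A (FreeGroup.of i)) • (grp A (base k)⁻¹ • ∑ j,
          (1 - grp A (FreeGroup.of j)) • D.cls (D.entry k j ((D.shift k).δ i n)))
      have h : ∀ i, (grp A (base k)⁻¹ • ∑ j,
          (1 - grp A (FreeGroup.of j)) • D.cls (D.entry k j ((D.shift k).δ i n)))
          = (if k = some i then grp A (base k)⁻¹ • ∑ j, (1 - grp A (FreeGroup.of j)) •
              D.cls (D.entry k j n) else 0)
            + D.cls (D.entry k i n) := fun i => by
        have h1 : ∀ j, D.cls (D.entry k j ((D.shift k).δ i n))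
            = (if k = some i then D.cls (D.entry k j n) else 0)
              + D.cls (D.δ j (D.entry k i n))
              - (if k = some j then D.cls (D.entry k i n) else 0) := fun j => by
          rw [entry_δ, map_sub, map_add, apply_ite D.cls, apply_ite D.cls, map_zero]
        simp only [h1, smul_add, smul_sub, Finset.sum_add_distrib, Finset.sum_sub_distrib]
        rw [← D.cls_eq, sum_base, smul_sub, grp_inv_smul_smul]
        split_ifs
        · abel
        · simp
      simp only [h]
      rw [Finset.sum_congr rfl fun i _ => smul_add _ _ _, Finset.sum_add_distrib, sum_base,
        grp_smul_inv_smul, sub_add_cancel])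

lemma ofShift_cls (k : Option (Fin μ)) (n : (D.shift k).N) :
    D.ofShift k ((D.shift k).cls n) = grp A (base k)⁻¹ •
      ∑ j, (1 - grp A (FreeGroup.of j)) • D.cls (D.entry k j n) :=
  (D.shift k).covLift_cls _ _ _ n

/-- The elements adjoined by the shift already exist in the covering of `D`, where `ofShift`
evaluates them. Both composites are the identity by `cls_eq` for `D` and by `shift_smul_cls`. -/
lemma toShift_isCovEquiv (k : Option (Fin μ)) : (D.toShift k).IsCovEquiv := by
  refine Function.bijective_iff_has_inverse.2 ⟨D.ofShift k, ?_, ?_⟩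
  · have h : D.ofShift k ∘ₗ covMap (D.toShift k) = LinearMap.id := D.cov_hom_ext fun x => by
      rw [LinearMap.comp_apply, covMap_cls, ofShift_cls, LinearMap.id_apply]
      have h1 : ∀ j, D.cls (D.entry k j ((D.toShift k).hom x))
          = D.cls (D.δ j x) - (if k = some j then D.cls x else 0) := fun j => by
        rw [entry_toShift, map_sub, apply_ite D.cls, map_zero]
      simp only [h1, smul_sub (1 - _ : GroupRing A μ), Finset.sum_sub_distrib, smul_sub (grp A (base k)⁻¹)]
      rw [← D.cls_eq, sum_base, smul_sub, grp_inv_smul_smul]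
      abel
    exact LinearMap.congr_fun h
  · have h : covMap (D.toShift k) ∘ₗ D.ofShift k = LinearMap.id :=
      (D.shift k).cov_hom_ext fun n => by
        rw [LinearMap.comp_apply, ofShift_cls, map_smul, map_sum, LinearMap.id_apply]
        simp only [map_smul, covMap_cls]
        rw [← shift_smul_cls, grp_inv_smul_smul]
    exact LinearMap.congr_fun h

/-! ### Killing elements with trivial class, and representing classes, after an equivalence -/

/-- The condition that the underlying module is f.g. projective. -/
def IsFGProj (D : FoxModule A μ) : Prop := Module.Finite A D.N ∧ Module.Projective A D.N

lemma IsFGProj.shift {D : FoxModule A μ} (h : D.IsFGProj) (k : Option (Fin μ)) :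
    (D.shift k).IsFGProj := by
  have := h.1
  have := h.2
  refine ⟨inferInstanceAs (Module.Finite A (Fin μ → D.N)), ?_⟩
  have : Module.Projective A (Π₀ _ : Fin μ, D.N) := inferInstance
  exact Module.Projective.of_equiv
    (DFinsupp.linearEquivFunOnFintype (R := A) (M := fun _ : Fin μ => D.N))

variable {D}

lemma exists_sum_single {K : Type u} [AddCommGroup K] [Module A K] [Module.Finite A K]
    {P : Type u} [AddCommGroup P] [Module A P]
    (f : Induced μ K →ₗ[GroupRing A μ] Induced μ P) :
    ∃ s : Finset (FreeGroup (Fin μ)), ∀ x,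
      f (Induced.single 1 x) = ∑ g ∈ s, Induced.single g (Induced.coeffMap f g x) := by
  obtain ⟨s, hs⟩ := Induced.exists_eq_sum_twist f
  refine ⟨s, fun x => ?_⟩
  conv_lhs => rw [hs, LinearMap.sum_apply]
  exact Finset.sum_congr rfl fun g _ => by rw [Induced.twist_single, one_mul]

lemma coeff_sum_single {K P : Type u} [AddCommGroup K] [Module A K] [AddCommGroup P] [Module A P]
    (s : Finset (FreeGroup (Fin μ))) (y : FreeGroup (Fin μ) → K →ₗ[A] P) (hy : ∀ g ∉ s, y g = 0)
    (x : K) (h : FreeGroup (Fin μ)) :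
    Induced.coeff h (∑ g ∈ s, Induced.single g (y g x)) = y h x := by
  classical
  rw [map_sum, Finset.sum_congr rfl fun g _ => Induced.coeff_single g h (y g x),
    Finset.sum_ite_eq' s h fun g => y g x]
  split_ifs with hh
  · rfl
  · rw [hy h hh]; rfl

lemma coeff_pres (y : Induced μ D.N) (h : FreeGroup (Fin μ)) :
    Induced.coeff h (D.pres y) = Induced.coeff h y
      - ∑ i, (D.δ i (Induced.coeff h y) - D.δ i (Induced.coeff (h * (FreeGroup.of i)⁻¹) y)) := by
  classical
  have key : ∀ g (x : D.N), Induced.coeff h (D.pres (Induced.single g x))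
      = Induced.coeff h (Induced.single g x) - ∑ i, (D.δ i (Induced.coeff h (Induced.single g x))
        - D.δ i (Induced.coeff (h * (FreeGroup.of i)⁻¹) (Induced.single g x))) := fun g x => by
    rw [pres_single, map_sub, map_sum]
    congr 1
    refine Finset.sum_congr rfl fun i _ => ?_
    rw [map_sub, Induced.coeff_single, Induced.coeff_single, Induced.coeff_single,
      Induced.coeff_single, apply_ite (D.δ i), apply_ite (D.δ i), map_zero]
    simp only [eq_mul_inv_iff_mul_eq]
  let L : Induced μ D.N →+ D.N := (Induced.coeff h).comp D.pres.toAddMonoidHom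
  let R : Induced μ D.N →+ D.N := Induced.coeff h - ∑ i,
    ((D.δ i).toAddMonoidHom.comp (Induced.coeff h)
      - (D.δ i).toAddMonoidHom.comp (Induced.coeff (h * (FreeGroup.of i)⁻¹)))
  have hLR : L = R := Induced.addHom_ext fun g x => by
    simpa [L, R, AddMonoidHom.finsetSum_apply] using key g x
  simpa [L, R, AddMonoidHom.finsetSum_apply] using DFunLike.congr_fun hLR y

end FoxModule

/-! ### Killing elements with trivial class, and representing classes -/

section FreeGroupWords

lemma mk_letter_true {α : Type*} (i : α) : FreeGroup.mk [(i, true)] = FreeGroup.of i := rfl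

lemma mk_letter_false {α : Type*} (i : α) : FreeGroup.mk [(i, false)] = (FreeGroup.of i)⁻¹ := rfl

variable {α : Type*} [DecidableEq α]

lemma toWord_mul_letter (g : FreeGroup α) (a : α × Bool)
    (h : ∀ b ∈ g.toWord.getLast?, b.1 = a.1 → b.2 = a.2) :
    (g * FreeGroup.mk [a]).toWord = g.toWord ++ [a] := by
  have hr : FreeGroup.IsReduced (g.toWord ++ [a]) := by
    refine List.isChain_append.2 ⟨FreeGroup.isReduced_toWord, List.isChain_singleton a, ?_⟩
    intro x hx y hy
    simp only [List.head?_cons, Option.mem_def, Option.some.injEq] at hy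
    subst hy
    exact h x hx
  conv_lhs => rw [← FreeGroup.mk_toWord (x := g), FreeGroup.mul_mk, FreeGroup.toWord_mk,
    hr.reduce_eq]

lemma norm_lt_norm_mul_letter (g : FreeGroup α) (a : α × Bool)
    (h : ∀ b ∈ g.toWord.getLast?, b.1 = a.1 → b.2 = a.2) :
    g.norm < (g * FreeGroup.mk [a]).norm := by
  rw [FreeGroup.norm, FreeGroup.norm, toWord_mul_letter g a h, List.length_append]
  simp

end FreeGroupWords

namespace FoxModule

variable {A : Type u} [Ring A] {μ : ℕ}

section Kill

variable {K : Type u} [AddCommGroup K] [Module A K]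

/-- The hypothesis `hy` says that `pres` maps `∑ g (y g)` to `x`; compare coefficients around a
longest `g`. If `g` does not end in `z_i⁻¹`, the coefficient at `g z_i` leaves only `δ_i (y g) = 0`.
If no such exception occurs, all `δ_i` kill `y g`, and `k = none` works. If `g` ends in `z_k⁻¹`, the
coefficient at `g` also gives `y g = δ_k (y g)`, and the values of `y g` lie in the kernel of
`toShift (some k)`. -/
lemma exists_shift_kills {D : FoxModule A μ} (s : Finset (FreeGroup (Fin μ)))
    (x : K →ₗ[A] D.N) (y : FreeGroup (Fin μ) → K →ₗ[A] D.N) (hs : ∀ g ∉ s, y g = 0)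
    (hy : ∀ h c, y h c - ∑ i, (D.δ i (y h c) - D.δ i (y (h * (FreeGroup.of i)⁻¹) c))
      = if h = 1 then x c else 0)
    (g : FreeGroup (Fin μ)) (hg : ∀ h ∈ s, h.norm ≤ g.norm) :
    ∃ k, (D.toShift k).hom ∘ₗ y g = 0 := by
  have hlong : ∀ h : FreeGroup (Fin μ), g.norm < h.norm → y h = 0 := fun h hh =>
    hs h fun hm => absurd (hg h hm) (not_le.2 hh)
  have hδ : ∀ i c, g.toWord.getLast? ≠ some (i, false) → D.δ i (y g c) = 0 := fun i c hi => by
    have h1 : ∀ b ∈ g.toWord.getLast?, b.1 = (i, true).1 → b.2 = (i, true).2 := by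
      rintro ⟨j, b⟩ hb h
      cases b
      · exact absurd ((Option.mem_def.1 hb).trans (by rw [show j = i from h])) hi
      · rfl
    have h2 := norm_lt_norm_mul_letter g (i, true) h1
    have h3 := toWord_mul_letter g (i, true) h1
    rw [mk_letter_true] at h2 h3
    have h4 : ∀ j, j ≠ i → y (g * FreeGroup.of i * (FreeGroup.of j)⁻¹) = 0 := fun j hj => by
      refine hlong _ (h2.trans ?_)
      rw [← mk_letter_false j]
      refine norm_lt_norm_mul_letter _ _ fun b hb h => ?_
      rw [h3, List.getLast?_append] at hb
      simp only [List.getLast?_singleton, Option.some_or, Option.mem_def, Option.some.injEq] at hb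
      subst hb
      exact absurd h.symm hj
    have h5 := hy (g * FreeGroup.of i) c
    rw [if_neg (fun h => by rw [h, FreeGroup.norm_one] at h2; exact absurd h2 (Nat.not_lt_zero _)),
      hlong _ h2, Finset.sum_eq_single i] at h5
    · rw [mul_inv_cancel_right] at h5
      simpa using h5
    · intro j _ hj
      rw [h4 j hj]
      simp
    · simp
  by_cases hlast : ∃ k, g.toWord.getLast? = some (k, false)
  · obtain ⟨k, hk⟩ := hlast
    refine ⟨some k, LinearMap.ext fun c => shift_ext fun j => ?_⟩
    have h0 : ∀ i, i ≠ k → D.δ i (y g c) = 0 := fun i hi => hδ i c (by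
      rw [hk]
      rintro h
      exact hi (congrArg Prod.fst (Option.some.inj h)).symm)
    have hne : g ≠ 1 := by
      rintro rfl
      simp at hk
    have h1 := hy g c
    rw [if_neg hne, Finset.sum_eq_single k] at h1
    · rw [hlong (g * (FreeGroup.of k)⁻¹)] at h1
      · rw [LinearMap.comp_apply, entry_toShift, LinearMap.zero_apply, map_zero]
        by_cases hj : j = k
        · subst hj
          rw [if_pos rfl]
          have h2 : y g c - D.δ j (y g c) = 0 := by simpa using h1
          rw [← neg_sub, h2, neg_zero]
        · rw [if_neg (fun h => hj (Option.some.inj h).symm), h0 j hj, sub_zero]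
      · refine norm_lt_norm_mul_letter g (k, false) fun b hb _ => ?_
        rw [hk] at hb
        rw [← Option.some.inj hb]
    · intro i _ hi
      rw [hlong (g * (FreeGroup.of i)⁻¹), h0 i hi]
      · simp
      · refine norm_lt_norm_mul_letter g (i, false) fun b hb _ => ?_
        rw [hk] at hb
        rw [← Option.some.inj hb]
    · simp
  · refine ⟨none, LinearMap.ext fun c => shift_ext fun j => ?_⟩
    rw [LinearMap.comp_apply, entry_toShift, hδ j c (fun h => hlast ⟨j, h⟩)]
    simp

/-- Induction on the size of the support of `y`. The relation between `x` and `y` is preserved by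
morphisms, so a suitable shift removes a longest `g` from the support; with empty support the
relation reads `x = 0`. -/
lemma exists_isCovEquiv_comp_eq_zero_aux (n : ℕ) (D : FoxModule A μ) (hD : D.IsFGProj)
    (s : Finset (FreeGroup (Fin μ))) (hn : s.card = n)
    (x : K →ₗ[A] D.N) (y : FreeGroup (Fin μ) → K →ₗ[A] D.N) (hs : ∀ g ∉ s, y g = 0)
    (hy : ∀ h c, y h c - ∑ i, (D.δ i (y h c) - D.δ i (y (h * (FreeGroup.of i)⁻¹) c))
      = if h = 1 then x c else 0) :
    ∃ (E : FoxModule A μ) (t : Hom D E), E.IsFGProj ∧ t.IsCovEquiv ∧ t.hom ∘ₗ x = 0 := by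
  classical
  induction n generalizing D s with
  | zero =>
    refine ⟨D, Hom.id D, hD, Hom.isCovEquiv_id D, LinearMap.ext fun c => ?_⟩
    have h0 : ∀ g, y g = 0 := fun g => hs g (by rw [Finset.card_eq_zero.1 hn]; simp)
    have := hy 1 c
    simp only [h0, if_pos] at this
    simpa using! this.symm
  | succ n ih =>
    obtain ⟨g, hg, hmax⟩ := s.exists_max_image FreeGroup.norm (Finset.card_pos.1 (by omega))
    obtain ⟨k, hk⟩ := exists_shift_kills s x y hs hy g hmax
    obtain ⟨E, t, hE, ht, htx⟩ := ih (D.shift k) (hD.shift k) (s.erase g)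
      (by rw [Finset.card_erase_of_mem hg, hn]; rfl)
      ((D.toShift k).hom ∘ₗ x) (fun h => (D.toShift k).hom ∘ₗ y h)
      (fun h hh => by
        by_cases hhg : h = g
        · rw [hhg, hk]
        · rw [hs h fun hm => hh (Finset.mem_erase.2 ⟨hhg, hm⟩), LinearMap.comp_zero])
      (fun h c => by
        simp only [LinearMap.comp_apply, ← (D.toShift k).comm]
        simp only [← map_sub, ← map_sum]
        have := hy h c
        simp only [← map_sub] at this
        rw [this, apply_ite (D.toShift k).hom, map_zero])
    exact ⟨E, t.comp (D.toShift k), hE, ht.comp (D.toShift_isCovEquiv k), htx⟩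

/-- A linear map from a f.g. projective module whose values have trivial class is killed by
an equivalence. -/
lemma exists_isCovEquiv_comp_eq_zero [Module.Finite A K] [Module.Projective A K]
    {D : FoxModule A μ} (hD : D.IsFGProj) (x : K →ₗ[A] D.N) (hx : ∀ c, D.cls (x c) = 0) :
    ∃ (E : FoxModule A μ) (t : Hom D E), E.IsFGProj ∧ t.IsCovEquiv ∧ t.hom ∘ₗ x = 0 := by
  have hx' : ∀ c, Induced.map x c ∈ LinearMap.range D.pres := fun c => by
    rw [Induced.eq_sum_support c, map_sum]
    refine Submodule.sum_mem _ fun g _ => ?_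
    rw [Induced.map_single, Induced.single_eq_grp_smul (A := A)]
    exact Submodule.smul_mem _ _ ((Submodule.Quotient.mk_eq_zero _).1 (hx _))
  -- Trivial classes put the image of `x` in the range of `pres`; projectivity of `K[F_μ]` then
  -- chooses preimages linearly, and their finitely many coefficients form the family `y`.
  obtain ⟨f, hf⟩ := Induced.exists_lift D.pres.rangeRestrict D.pres.surjective_rangeRestrict
    ((Induced.map x).codRestrict _ hx')
  have hf' : ∀ c, D.pres (f c) = Induced.map x c := fun c =>
    congrArg Subtype.val (LinearMap.congr_fun hf c)
  classical
  obtain ⟨s, hs⟩ := exists_sum_single f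
  let y : FreeGroup (Fin μ) → K →ₗ[A] D.N := fun g => if g ∈ s then Induced.coeffMap f g else 0
  have hys : ∀ g ∉ s, y g = 0 := fun g hg => if_neg hg
  have hc : ∀ h c, Induced.coeff h (f (Induced.single 1 c)) = y h c := fun h c => by
    rw [← coeff_sum_single s y hys c h, hs c]
    refine congrArg _ (Finset.sum_congr rfl fun g hg => ?_)
    simp only [y, if_pos hg]
  refine exists_isCovEquiv_comp_eq_zero_aux s.card D hD s rfl x y hys fun h c => ?_
  have := congrArg (Induced.coeff h) (hf' (Induced.single 1 c))
  rw [coeff_pres, Induced.map_single_one, Induced.coeff_single] at this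
  simp only [hc] at this
  rw [this]
  simp only [eq_comm]

end Kill

/-- After an equivalence the translates by `g` of the classes of elements of the module are
represented. -/
lemma exists_isCovEquiv_grp_smul (g : FreeGroup (Fin μ)) {D : FoxModule A μ} (hD : D.IsFGProj) :
    ∃ (E : FoxModule A μ) (t : Hom D E) (a : D.N →ₗ[A] E.N), E.IsFGProj ∧ t.IsCovEquiv ∧
      ∀ x, grp A g • E.cls (t.hom x) = E.cls (a x) := by
  induction g using FreeGroup.induction_on generalizing D with
  | C1 =>
    exact ⟨D, Hom.id D, LinearMap.id, hD, Hom.isCovEquiv_id D, fun x => one_smul _ _⟩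
  | of i =>
    -- `z_i x = x - (1 - z_i) x`, and `(1 - z_i) x` is the element `incl none i x` of the shift.
    refine ⟨D.shift none, D.toShift none, (D.toShift none).hom - D.incl none i, hD.shift none,
      D.toShift_isCovEquiv none, fun x => ?_⟩
    have h := D.shift_smul_cls none (D.incl none i x)
    rw [Finset.sum_eq_single i, entry_incl, if_pos rfl] at h
    · rw [LinearMap.sub_apply, map_sub, ← one_smul (GroupRing A μ) ((D.shift none).cls (D.incl none i x)),
        ← grp_one]
      change _ = _ - grp A (base none) • _
      rw [h, sub_smul, one_smul, sub_sub_cancel]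
    · intro j _ hj
      rw [entry_incl, if_neg hj, map_zero, map_zero, smul_zero]
    · simp
  | inv_of i _ =>
    -- `z_i⁻¹ x = z_i⁻¹ (1 - z_i) x + x`, whose first term is `incl (some i) i x`.
    refine ⟨D.shift (some i), D.toShift (some i), D.incl (some i) i + (D.toShift (some i)).hom,
      hD.shift _, D.toShift_isCovEquiv _, fun x => ?_⟩
    have h := D.shift_smul_cls (some i) (D.incl (some i) i x)
    rw [Finset.sum_eq_single i, entry_incl, if_pos rfl] at h
    · have h2 := congrArg (fun m => grp A (FreeGroup.of i)⁻¹ • m) h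
      simp only [base, Option.elim_some, grp_inv_smul_smul, sub_smul, one_smul, smul_sub] at h2
      rw [LinearMap.add_apply, map_add, h2, sub_add_cancel]
    · intro j _ hj
      rw [entry_incl, if_neg hj, map_zero, map_zero, smul_zero]
    · simp
  | mul g h hg hh =>
    obtain ⟨E, t, a, hE, ht, ha⟩ := hh hD
    obtain ⟨G, t', a', hG, ht', ha'⟩ := hg hE
    refine ⟨G, t'.comp t, a' ∘ₗ a, hG, ht'.comp ht, fun x => ?_⟩
    rw [grp_mul_smul]
    change grp A g • grp A h • G.cls (t'.hom (t.hom x)) = _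
    rw [← covMap_cls t', ← map_smul, ha, covMap_cls, ha']
    rfl

lemma exists_isCovEquiv_sum {K : Type u} [AddCommGroup K] [Module A K]
    (s : Finset (FreeGroup (Fin μ))) {D : FoxModule A μ} (hD : D.IsFGProj)
    (y : FreeGroup (Fin μ) → K →ₗ[A] D.N) :
    ∃ (E : FoxModule A μ) (t : Hom D E) (a : K →ₗ[A] E.N), E.IsFGProj ∧ t.IsCovEquiv ∧
      ∀ x, ∑ g ∈ s, grp A g • E.cls (t.hom (y g x)) = E.cls (a x) := by
  classical
  induction s using Finset.induction_on with
  | empty =>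
    exact ⟨D, Hom.id D, 0, hD, Hom.isCovEquiv_id D, fun x => by simp⟩
  | insert g s hg ih =>
    obtain ⟨E, t, a, hE, ht, ha⟩ := ih
    obtain ⟨G, t', a', hG, ht', ha'⟩ := exists_isCovEquiv_grp_smul g hE
    refine ⟨G, t'.comp t, a' ∘ₗ t.hom ∘ₗ y g + t'.hom ∘ₗ a, hG, ht'.comp ht, fun x => ?_⟩
    rw [Finset.sum_insert hg, LinearMap.add_apply, map_add]
    congr 1
    · exact ha' _
    · rw [LinearMap.comp_apply, ← covMap_cls, ← ha, map_sum]
      refine Finset.sum_congr rfl fun h _ => ?_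
      rw [map_smul, covMap_cls]
      rfl

/-- A morphism from an induced module to the covering is represented by a linear map, after
an equivalence. -/
lemma exists_isCovEquiv_lift {K : Type u} [AddCommGroup K] [Module A K] [Module.Finite A K]
    [Module.Projective A K] {D : FoxModule A μ} (hD : D.IsFGProj)
    (f : Induced μ K →ₗ[GroupRing A μ] D.Cov) :
    ∃ (E : FoxModule A μ) (t : Hom D E) (a : K →ₗ[A] E.N), E.IsFGProj ∧ t.IsCovEquiv ∧
      ∀ x, covMap t (f (Induced.single 1 x)) = E.cls (a x) := by
  obtain ⟨f', hf'⟩ := Induced.exists_lift (LinearMap.range D.pres).mkQ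
    (Submodule.mkQ_surjective _) f
  obtain ⟨s, hs⟩ := exists_sum_single f'
  obtain ⟨E, t, a, hE, ht, ha⟩ := exists_isCovEquiv_sum s hD (Induced.coeffMap f')
  refine ⟨E, t, a, hE, ht, fun x => ?_⟩
  rw [← ha, ← hf', LinearMap.comp_apply, hs, map_sum, map_sum]
  refine Finset.sum_congr rfl fun g _ => ?_
  rw [Induced.single_eq_grp_smul (A := A), map_smul, map_smul, ← cls_apply, covMap_cls]

end FoxModule

/-! ### The augmentation ideal is free on the `1 - z_i` -/

section AugmentationIdeal

variable {A : Type u} [Ring A] {μ : ℕ}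

/-- Linear independence of the `1 - z_i`, in coefficients. For a longest `g` in the support: if `g`
does not end in `z_i`, the equation at `g z_i⁻¹` leaves only `c i g`; if it does, every `g z_j` is
longer and the equation at `g` leaves only `c i g`. So `g` leaves the support. -/
lemma eq_zero_of_sum_sub_eq_zero {N : Type u} [AddCommGroup N] (n : ℕ)
    (s : Finset (FreeGroup (Fin μ))) (hn : s.card = n) (c : Fin μ → FreeGroup (Fin μ) → N)
    (hs : ∀ i, ∀ g ∉ s, c i g = 0) (hc : ∀ k, ∑ i, (c i k - c i (k * FreeGroup.of i)) = 0)
    (i : Fin μ) (g : FreeGroup (Fin μ)) : c i g = 0 := by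
  induction n generalizing s with
  | zero => exact hs i g (by rw [Finset.card_eq_zero.1 hn]; simp)
  | succ n ih =>
    obtain ⟨g, hg, hmax⟩ := s.exists_max_image FreeGroup.norm (Finset.card_pos.1 (by omega))
    have hlong : ∀ i h, g.norm < h.norm → c i h = 0 := fun i h hh =>
      hs i h fun hm => absurd (hmax h hm) (not_le.2 hh)
    have hfirst : ∀ i, g.toWord.getLast? ≠ some (i, true) → c i g = 0 := fun i hi => by
      have h1 : ∀ b ∈ g.toWord.getLast?, b.1 = (i, false).1 → b.2 = (i, false).2 := by
        rintro ⟨j, b⟩ hb h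
        cases b
        · rfl
        · exact absurd ((Option.mem_def.1 hb).trans (by rw [show j = i from h])) hi
      have h2 := norm_lt_norm_mul_letter g (i, false) h1
      have h3 := toWord_mul_letter g (i, false) h1
      rw [mk_letter_false] at h2 h3
      have h4 : ∀ j, j ≠ i → c j (g * (FreeGroup.of i)⁻¹ * FreeGroup.of j) = 0 := fun j hj => by
        refine hlong _ _ (h2.trans ?_)
        rw [← mk_letter_true j]
        refine norm_lt_norm_mul_letter _ _ fun b hb h => ?_
        rw [h3, List.getLast?_append] at hb
        simp only [List.getLast?_singleton, Option.some_or, Option.mem_def,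
          Option.some.injEq] at hb
        subst hb
        exact absurd h.symm hj
      have h5 := hc (g * (FreeGroup.of i)⁻¹)
      rw [Finset.sum_eq_single i] at h5
      · rw [inv_mul_cancel_right, hlong i _ h2] at h5
        simpa using h5
      · intro j _ hj
        rw [h4 j hj, hlong j _ h2, sub_zero]
      · simp
    have hzero : ∀ i, c i g = 0 := fun i => by
      by_cases hi : g.toWord.getLast? = some (i, true)
      · have h1 := hc g
        have h2 : ∀ j, c j (g * FreeGroup.of j) = 0 := fun j => by
          refine hlong _ _ (norm_lt_norm_mul_letter g (j, true) fun b hb _ => ?_)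
          rw [hi] at hb
          rw [← Option.some.inj hb]
        simp only [h2, sub_zero] at h1
        rw [Finset.sum_eq_single i] at h1
        · exact h1
        · intro j _ hj
          refine hfirst j ?_
          rw [hi]
          intro h
          exact hj (congrArg Prod.fst (Option.some.inj h)).symm
        · simp
      · exact hfirst i hi
    refine ih (s.erase g) (by rw [Finset.card_erase_of_mem hg, hn]; rfl) fun j h hh => ?_
    by_cases hhg : h = g
    · rw [hhg, hzero]
    · exact hs j h fun hm => hh (Finset.mem_erase.2 ⟨hhg, hm⟩)

namespace Induced

variable {P : Type u} [AddCommGroup P] [Module A P]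

lemma coeff_grp_smul (g h : FreeGroup (Fin μ)) (y : Induced μ P) :
    coeff h (grp A g • y) = coeff (g⁻¹ * h) y := by
  classical
  rw [eq_sum_support y, Finset.smul_sum, map_sum, map_sum]
  refine Finset.sum_congr rfl fun k _ => ?_
  rw [grp_smul_single, coeff_single, coeff_single]
  simp only [eq_inv_mul_iff_mul_eq]

lemma eq_zero_of_sum_smul_eq_zero (y : Fin μ → Induced μ P)
    (hy : ∑ i, (1 - grp A (FreeGroup.of i)) • y i = 0) (i : Fin μ) : y i = 0 := by
  classical
  let s : Finset (FreeGroup (Fin μ)) := Finset.univ.biUnion fun i => (support (y i)).image (·⁻¹)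
  -- Inverting group elements turns left multiplication by `z_i` into the right multiplication of
  -- the combinatorial lemma.
  have key := eq_zero_of_sum_sub_eq_zero s.card s rfl (fun i g => coeff g⁻¹ (y i))
    (fun j g hg => by
      by_contra h
      refine hg (Finset.mem_biUnion.2 ⟨j, Finset.mem_univ _, Finset.mem_image.2
        ⟨g⁻¹, mem_support.2 h, inv_inv g⟩⟩))
    (fun k => by
      have := congrArg (coeff k⁻¹) hy
      rw [map_sum, map_zero] at this
      simpa only [sub_smul, one_smul, map_sub, coeff_grp_smul, ← mul_inv_rev] using this)
  refine ext_coeff fun g => ?_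
  simpa using key i g⁻¹

end Induced

/-- Fox's product rule: `g h m - m = (g (h m) - h m) + (h m - m)`. -/
lemma exists_grp_smul_sub_eq {M : Type v} [AddCommGroup M] [Module (GroupRing A μ) M]
    (g : FreeGroup (Fin μ)) (m : M) :
    ∃ u : Fin μ → M, grp A g • m - m = ∑ i, (1 - grp A (FreeGroup.of i)) • u i := by
  induction g using FreeGroup.induction_on generalizing m with
  | C1 => exact ⟨0, by simp [grp_one]⟩
  | of i =>
    refine ⟨Pi.single i (-m), ?_⟩
    rw [Finset.sum_eq_single i]
    · rw [Pi.single_eq_same, sub_smul, one_smul, smul_neg]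
      abel
    · intro j _ hj
      rw [Pi.single_eq_of_ne hj, smul_zero]
    · simp
  | inv_of i _ =>
    refine ⟨Pi.single i (grp A (FreeGroup.of i)⁻¹ • m), ?_⟩
    rw [Finset.sum_eq_single i]
    · rw [Pi.single_eq_same, sub_smul, one_smul, grp_smul_inv_smul]
    · intro j _ hj
      rw [Pi.single_eq_of_ne hj, smul_zero]
    · simp
  | mul g h hg hh =>
    obtain ⟨u, hu⟩ := hg (grp A h • m)
    obtain ⟨v, hv⟩ := hh m
    refine ⟨u + v, ?_⟩
    simp only [Pi.add_apply, smul_add, Finset.sum_add_distrib]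
    rw [← hu, ← hv, grp_mul_smul, sub_add_sub_cancel]

/-- If the coefficients sum to zero, `∑ g y_g = ∑ (g - 1) y_g`, and each `g - 1` is expanded in the
`1 - z_i`. -/
lemma Induced.exists_eq_sum_smul {P : Type u} [AddCommGroup P] [Module A P] (y : Induced μ P)
    (hy : Induced.total y = 0) :
    ∃ u : Fin μ → Induced μ P, y = ∑ i : Fin μ, (1 - grp A (FreeGroup.of i)) • u i := by
  choose u hu using fun (g : FreeGroup (Fin μ)) (x : P) => exists_grp_smul_sub_eq (A := A) g (Induced.single (μ := μ) 1 x)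
  refine ⟨fun i => ∑ g ∈ Induced.support y, u g (Induced.coeff g y) i, ?_⟩
  have h1 : ∑ g ∈ Induced.support y, Induced.single (μ := μ) 1 (Induced.coeff g y) = 0 := by
    rw [← Induced.single_sum]
    have : ∑ g ∈ Induced.support y, Induced.coeff g y = 0 := by
      rw [← hy]
      conv_rhs => rw [Induced.eq_sum_support y, map_sum]
      exact Finset.sum_congr rfl fun g _ => (Induced.total_single g _).symm
    rw [this, Induced.single_zero]
  simp only [Finset.smul_sum]
  rw [Finset.sum_comm]
  simp only [← hu]
  rw [Finset.sum_sub_distrib, h1, sub_zero]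
  simp only [Induced.grp_smul_single (A := A), mul_one]
  exact Induced.eq_sum_support y

end AugmentationIdeal

namespace FoxModule

variable {A : Type u} [Ring A] {μ : ℕ}

/-- Lift `m` to `y`, so that `∑ (1 - z_i) y_i = pres v`. As `pres` preserves the augmentation, `v`
has augmentation zero and equals some `∑ (1 - z_i) u_i`; freeness of the augmentation ideal forces
`y_i = pres u_i`. -/
lemma Cov.eq_zero_of_sum_smul_eq_zero {D : FoxModule A μ} (m : Fin μ → D.Cov)
    (hm : ∑ i, (1 - grp A (FreeGroup.of i)) • m i = 0) (i : Fin μ) : m i = 0 := by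
  choose y hy using fun i => Submodule.mkQ_surjective (LinearMap.range D.pres) (m i)
  have h1 : (LinearMap.range D.pres).mkQ (∑ i, (1 - grp A (FreeGroup.of i)) • y i) = 0 := by
    rw [map_sum]
    simp only [map_smul, hy, hm]
  obtain ⟨v, hv⟩ := (Submodule.Quotient.mk_eq_zero _).1 h1
  have hv0 : Induced.total v = 0 := by
    rw [← total_pres, hv, map_sum]
    refine Finset.sum_eq_zero fun i _ => ?_
    rw [Induced.total_smul, map_sub, map_one, augmentation_single, sub_self, zero_smul]
  obtain ⟨u, hu⟩ := Induced.exists_eq_sum_smul (A := A) v hv0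
  have h2 := Induced.eq_zero_of_sum_smul_eq_zero (A := A) (fun i => y i - D.pres (u i)) (by
    simp only [smul_sub, Finset.sum_sub_distrib]
    rw [← hv, hu, map_sum]
    simp only [map_smul, sub_self]) i
  rw [← hy, sub_eq_zero.1 h2]
  exact (Submodule.Quotient.mk_eq_zero _).2 ⟨_, rfl⟩

/-- Every morphism of coverings is a fraction. -/
lemma exists_fraction {D E : FoxModule A μ} (hD : D.IsFGProj) (hE : E.IsFGProj)
    (φ : D.Cov →ₗ[GroupRing A μ] E.Cov) :
    ∃ (G : FoxModule A μ) (f : Hom D G) (t : Hom E G), G.IsFGProj ∧ t.IsCovEquiv ∧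
      covMap t ∘ₗ φ = covMap f := by
  have := hD.1
  have := hD.2
  obtain ⟨G, t, a, hG, ht, ha⟩ := exists_isCovEquiv_lift hE (φ ∘ₗ (LinearMap.range D.pres).mkQ)
  have ha : ∀ x, covMap t (φ (D.cls x)) = G.cls (a x) := ha
  -- Both sides are the `i`-th coordinate, relative to the `1 - z_i`, of the class of `a x`; such
  -- coordinates are unique.
  have hcls : ∀ i x, G.cls (a (D.δ i x)) = G.cls (G.δ i (a x)) := fun i x => by
    rw [← sub_eq_zero]
    refine Cov.eq_zero_of_sum_smul_eq_zero
      (fun i => G.cls (a (D.δ i x)) - G.cls (G.δ i (a x))) ?_ i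
    simp only [smul_sub, Finset.sum_sub_distrib]
    rw [← cls_eq, ← ha, sub_eq_zero]
    conv_rhs => rw [D.cls_eq x, map_sum, map_sum]
    simp only [map_smul, ha]
  -- All the defects `a δ_i - δ_i a` are assembled in one linear map, so that one further
  -- equivalence kills them together and makes `a` a morphism.
  let x : (Fin μ → D.N) →ₗ[A] G.N :=
    ∑ i, (a ∘ₗ D.δ i - G.δ i ∘ₗ a) ∘ₗ LinearMap.proj i
  have hfin : Module.Projective A (Fin μ → D.N) := (hD.shift none).2
  obtain ⟨G', t', hG', ht', hx⟩ := exists_isCovEquiv_comp_eq_zero hG x fun c => by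
    simp only [x, LinearMap.sum_apply, map_sum]
    refine Finset.sum_eq_zero fun i _ => ?_
    simp only [LinearMap.comp_apply, LinearMap.sub_apply, map_sub, LinearMap.proj_apply, hcls,
      sub_self]
  have hcomm : ∀ i c, t'.hom (a (D.δ i c)) = t'.hom (G.δ i (a c)) := fun i c => by
    have := LinearMap.congr_fun hx (Pi.single i c)
    simp only [x, LinearMap.comp_apply, LinearMap.sum_apply, map_sum, LinearMap.zero_apply] at this
    rw [Finset.sum_eq_single i] at this
    · simpa [sub_eq_zero] using this
    · intro j _ hj
      simp [Pi.single_eq_of_ne hj]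
    · simp
  refine ⟨G', ⟨t'.hom ∘ₗ a, fun i c => ?_⟩, t'.comp t, hG', ht'.comp ht, D.cov_hom_ext fun c => ?_⟩
  · rw [LinearMap.comp_apply, hcomm, t'.comm]; rfl
  · rw [covMap_comp, LinearMap.comp_apply, LinearMap.comp_apply, ha, covMap_cls, covMap_cls]; rfl

end FoxModule

/-! ### Seifert modules and modules with endomorphisms -/

namespace FoxModule

variable {A : Type u} [Ring A] {μ : ℕ}

lemma Hom.isCovEquiv_of_inverse {D E : FoxModule A μ} (s : Hom D E) (t : Hom E D)
    (h1 : ∀ x, t.hom (s.hom x) = x) (h2 : ∀ x, s.hom (t.hom x) = x) : s.IsCovEquiv := by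
  refine Function.bijective_iff_has_inverse.2 ⟨covMap t, ?_, ?_⟩
  · have h : covMap t ∘ₗ covMap s = LinearMap.id := D.cov_hom_ext fun x => by
      rw [LinearMap.comp_apply, covMap_cls, covMap_cls, h1]; rfl
    exact LinearMap.congr_fun h
  · have h : covMap s ∘ₗ covMap t = LinearMap.id := E.cov_hom_ext fun x => by
      rw [LinearMap.comp_apply, covMap_cls, covMap_cls, h2]; rfl
    exact LinearMap.congr_fun h

variable (D : FoxModule A μ)

/-- The Seifert module `⨁_j (1 - z_j) N` of a module with `μ` endomorphisms. -/
abbrev toSeifert : SeifertModule A μ where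
  P := (D.shift none).N
  e := ∑ i, (D.shift none).δ i
  π i := D.incl none i ∘ₗ D.entry none i
  complete :=
    { idem := fun i => LinearMap.ext fun n => by
        change D.incl none i (D.entry none i (D.incl none i (D.entry none i n))) = _
        rw [entry_incl, if_pos rfl]; rfl
      ortho := fun i j hij => LinearMap.ext fun n => by
        change D.incl none i (D.entry none i (D.incl none j (D.entry none j n))) = 0
        rw [entry_incl, if_neg hij, map_zero]
      complete := LinearMap.ext fun n => shift_ext fun j => by
        rw [LinearMap.sum_apply, map_sum, Finset.sum_eq_single j]
        · change D.entry none j (D.incl none j (D.entry none j n)) = _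
          rw [entry_incl, if_pos rfl]; rfl
        · intro i _ hi
          change D.entry none j (D.incl none i (D.entry none i n)) = _
          rw [entry_incl, if_neg hi.symm]
        · simp }

end FoxModule

namespace SeifertModule

variable {A : Type u} [Ring A] {μ : ℕ}

/-- The module with the endomorphisms `e π_i`. -/
abbrev fox (V : SeifertModule A μ) : FoxModule A μ := ⟨V.P, fun i => V.e ∘ₗ V.π i⟩

lemma fox_δ_apply (V : SeifertModule A μ) (i : Fin μ) (x : V.P) : V.fox.δ i x = V.e (V.π i x) :=
  rfl

lemma sum_π (V : SeifertModule A μ) (x : V.P) : ∑ i, V.π i x = x := by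
  rw [← LinearMap.sum_apply, V.complete.complete]; rfl

lemma sum_fox_δ (V : SeifertModule A μ) (x : V.P) : ∑ i, V.fox.δ i x = V.e x := by
  conv_rhs => rw [← V.sum_π x, map_sum]
  rfl

lemma π_π (V : SeifertModule A μ) (i j : Fin μ) (x : V.P) :
    V.π i (V.π j x) = if i = j then V.π j x else 0 := by
  split_ifs with h
  · subst h
    exact LinearMap.congr_fun (V.complete.idem i) x
  · exact LinearMap.congr_fun (V.complete.ortho h) x

/-- Since `∑ π_i = 1`, the endomorphism `e` is `∑ e π_i`, and `1 - e + e z` becomes `1 - ∑ e π_i (1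
- z_i)`. -/
lemma presentation_eq (V : SeifertModule A μ) : V.presentation = V.fox.pres := by
  refine Induced.linearMap_ext fun g x => ?_
  refine Eq.trans ?_ (V.fox.pres_single g x).symm
  rw [Finset.sum_sub_distrib, ← Induced.single_sum, sum_fox_δ]
  simp only [presentation, z, LinearMap.add_apply, LinearMap.sub_apply, Module.End.mul_apply,
    LinearMap.sum_apply, map_sum, Induced.twist_single, Induced.map_single, Module.End.one_apply]
  rw [← sub_add]
  rfl

/-- The covering of a Seifert module is the covering of the associated module with
endomorphisms. -/
def covEquiv (V : SeifertModule A μ) :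
    (covering A μ).obj V ≃ₗ[GroupRing A μ] V.fox.Cov :=
  Submodule.quotEquivOfEq _ _ (by rw [V.presentation_eq])

/-- The morphism of modules with endomorphisms given by a morphism of Seifert modules. -/
def foxHom {V W : SeifertModule A μ} (f : V ⟶ W) : FoxModule.Hom V.fox W.fox where
  hom := Hom.hom f
  comm i x := by
    change (Hom.hom f) (V.e (V.π i x)) = W.e (W.π i (Hom.hom f x))
    exact (LinearMap.congr_fun (Hom.comm_e f) (V.π i x)).trans
      (congrArg W.e (LinearMap.congr_fun (Hom.comm_π f i) x))

lemma covEquiv_naturality {V W : SeifertModule A μ} (f : V ⟶ W) (m : (covering A μ).obj V) :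
    W.covEquiv (((covering A μ).map f).hom m) = FoxModule.covMap (foxHom f) (V.covEquiv m) := by
  obtain ⟨y, rfl⟩ := Submodule.mkQ_surjective _ m
  have h : (LinearMap.range W.fox.pres).mkQ ∘ₗ Induced.map (Hom.hom f)
      = FoxModule.covMap (foxHom f) ∘ₗ (LinearMap.range V.fox.pres).mkQ :=
    Induced.linearMap_ext_one fun x => by
      rw [LinearMap.comp_apply, LinearMap.comp_apply, Induced.map_single_one]
      exact (FoxModule.covMap_cls (foxHom f) x).symm
  exact LinearMap.congr_fun h y

lemma isIso_covering_map_iff {V W : SeifertModule A μ} (f : V ⟶ W) :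
    IsIso ((covering A μ).map f) ↔ (foxHom f).IsCovEquiv := by
  rw [ConcreteCategory.isIso_iff_bijective]
  have h : ⇑(FoxModule.covMap (foxHom f))
      = W.covEquiv ∘ ((covering A μ).map f).hom ∘ V.covEquiv.symm := by
    funext m
    rw [Function.comp_apply, Function.comp_apply, covEquiv_naturality, LinearEquiv.apply_symm_apply]
  rw [FoxModule.Hom.IsCovEquiv, h, Function.Bijective.of_comp_iff' W.covEquiv.bijective,
    Function.Bijective.of_comp_iff _ V.covEquiv.symm.bijective]

/-- The Seifert morphism to the Seifert module of `D` given by a morphism to `D`. -/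
def homToSeifert {V : SeifertModule A μ} {D : FoxModule A μ} (t : FoxModule.Hom V.fox D) :
    V ⟶ D.toSeifert :=
  show Hom V D.toSeifert from
  { hom := ((D.toShift none).comp t).hom
    comm_e := LinearMap.ext fun x => by
      change ((D.toShift none).comp t).hom (V.e x)
        = (∑ i, (D.shift none).δ i : Module.End A (D.shift none).N) (((D.toShift none).comp t).hom x)
      rw [← V.sum_fox_δ, map_sum, LinearMap.sum_apply]
      exact Finset.sum_congr rfl fun i _ => ((D.toShift none).comp t).comm i x
    -- In a Seifert module `δ_j π_i = e π_j π_i` vanishes for `j ≠ i`, so the map `x ↦ (δ_j x)_j`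
    -- carries `π_i` to the projection on the `i`-th summand.
    comm_π := fun i => LinearMap.ext fun x => FoxModule.shift_ext fun j => by
      change D.entry none j ((D.toShift none).hom (t.hom (V.π i x)))
        = D.entry none j (D.incl none i (D.entry none i ((D.toShift none).hom (t.hom x))))
      rw [FoxModule.entry_incl, FoxModule.entry_toShift, FoxModule.entry_toShift, ← t.comm,
        ← t.comm, fox_δ_apply, π_π]
      by_cases h : j = i
      · subst h
        simp
      · simp [h] }

/-- The comparison of the two shifts. -/
def shiftToFox (D : FoxModule A μ) : FoxModule.Hom (D.shift none) D.toSeifert.fox where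
  hom := LinearMap.id
  -- In the shift with `k = none`, `δ_i n` depends only on the `i`-th entry of `n`; hence `∑ δ_k`
  -- composed with the `i`-th projection is `δ_i`.
  comm i n := by
    rw [fox_δ_apply]
    change _ = (∑ k, (D.shift none).δ k : Module.End A (D.shift none).N)
      (D.incl none i (D.entry none i n))
    refine FoxModule.shift_ext fun j => ?_
    rw [LinearMap.sum_apply, map_sum]
    simp only [FoxModule.entry_δ, FoxModule.entry_incl]
    change D.entry none j ((D.shift none).δ i n) = _
    rw [FoxModule.entry_δ, Finset.sum_eq_single i]
    · simp
    · intro k _ hk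
      simp [hk]
    · simp

lemma shiftToFox_isCovEquiv (D : FoxModule A μ) : (shiftToFox D).IsCovEquiv :=
  FoxModule.Hom.isCovEquiv_of_inverse (shiftToFox D)
    ⟨LinearMap.id, fun i x => ((shiftToFox D).comm i x).symm⟩ (fun _ => rfl) (fun _ => rfl)

/-- The comparison of `D` with the Seifert module of `D`. -/
def toFox (D : FoxModule A μ) : FoxModule.Hom D D.toSeifert.fox :=
  (shiftToFox D).comp (D.toShift none)

lemma toFox_isCovEquiv (D : FoxModule A μ) : (toFox D).IsCovEquiv :=
  (shiftToFox_isCovEquiv D).comp (D.toShift_isCovEquiv none)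

lemma foxHom_homToSeifert {V : SeifertModule A μ} {D : FoxModule A μ}
    (t : FoxModule.Hom V.fox D) : foxHom (homToSeifert t) = (toFox D).comp t := rfl

end SeifertModule

/-! ### The calculus of left fractions for `Ξ` -/

section Fractions

variable {A : Type u} [Ring A] {μ : ℕ}

lemma Xi_iff {V W : Sei A μ} (f : V ⟶ W) :
    Xi A μ f ↔ (SeifertModule.foxHom f.hom).IsCovEquiv :=
  SeifertModule.isIso_covering_map_iff f.hom

lemma isFGProj_fox (V : Sei A μ) : V.obj.fox.IsFGProj := V.property

/-- The f.g. projective Seifert module of a f.g. projective module with endomorphisms. -/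
def toSei {D : FoxModule A μ} (hD : D.IsFGProj) : Sei A μ := ⟨D.toSeifert, hD.shift none⟩

/-- The morphism to the f.g. projective Seifert module of `D` given by a morphism to `D`. -/
def homToSei {V : Sei A μ} {D : FoxModule A μ} (hD : D.IsFGProj)
    (t : FoxModule.Hom V.obj.fox D) : V ⟶ toSei hD := ⟨SeifertModule.homToSeifert t⟩

lemma Xi_homToSei {V : Sei A μ} {D : FoxModule A μ} (hD : D.IsFGProj)
    (t : FoxModule.Hom V.obj.fox D) (ht : t.IsCovEquiv) : Xi A μ (homToSei hD t) := by
  rw [Xi_iff]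
  exact (SeifertModule.toFox_isCovEquiv D).comp ht

/-- Every morphism of coverings is a left fraction. -/
lemma exists_leftFraction_covering {V W : Sei A μ}
    (φ : (seiCovering A μ).obj V ⟶ (seiCovering A μ).obj W) :
    ∃ (W' : Sei A μ) (f : V ⟶ W') (s : W ⟶ W'), Xi A μ s ∧
      φ ≫ (seiCovering A μ).map s = (seiCovering A μ).map f := by
  obtain ⟨G, f, t, hG, ht, h⟩ := FoxModule.exists_fraction (isFGProj_fox V) (isFGProj_fox W)
    (W.obj.covEquiv.toLinearMap ∘ₗ φ.hom ∘ₗ V.obj.covEquiv.symm.toLinearMap)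
  refine ⟨toSei hG, homToSei hG f, homToSei hG t, Xi_homToSei hG t ht, ?_⟩
  refine ModuleCat.hom_ext (LinearMap.ext fun m => ?_)
  refine (toSei hG).obj.covEquiv.injective ?_
  refine (SeifertModule.covEquiv_naturality (SeifertModule.homToSeifert t) (φ.hom m)).trans ?_
  refine Eq.trans ?_ (SeifertModule.covEquiv_naturality (SeifertModule.homToSeifert f) m).symm
  rw [SeifertModule.foxHom_homToSeifert, SeifertModule.foxHom_homToSeifert,
    FoxModule.covMap_comp, FoxModule.covMap_comp, LinearMap.comp_apply, LinearMap.comp_apply, ← h]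
  simp

/-- A morphism with trivial covering is killed by a morphism of `Ξ`. -/
lemma exists_Xi_comp_eq_zero {V W : Sei A μ} (f : V ⟶ W) (hf : (seiCovering A μ).map f = 0) :
    ∃ (W' : Sei A μ) (s : W ⟶ W'), Xi A μ s ∧ f ≫ s = 0 := by
  have := (isFGProj_fox V).1
  have := (isFGProj_fox V).2
  obtain ⟨E, t, hE, ht, h⟩ := FoxModule.exists_isCovEquiv_comp_eq_zero (isFGProj_fox W)
    (SeifertModule.foxHom f.hom).hom fun c => by
      rw [← FoxModule.covMap_cls, ← LinearEquiv.apply_symm_apply V.obj.covEquiv (V.obj.fox.cls c),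
        ← SeifertModule.covEquiv_naturality]
      have h0 : ((SeifertModule.covering A μ).map f.hom).hom = 0 :=
        congrArg ModuleCat.Hom.hom hf
      rw [h0, LinearMap.zero_apply, map_zero]
  refine ⟨toSei hE, homToSei hE t, Xi_homToSei hE t ht, ?_⟩
  refine InducedCategory.Hom.ext (SeifertModule.hom_ext (LinearMap.ext fun x => ?_))
  change (E.toShift none).hom (t.hom (SeifertModule.Hom.hom f.hom x)) = 0
  have : t.hom (SeifertModule.Hom.hom f.hom x) = 0 := LinearMap.congr_fun h x
  rw [this, map_zero]

instance : (seiCovering A μ).Additive where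
  map_add {V W f g} := ModuleCat.hom_ext (Submodule.linearMap_qext _
    (Induced.linearMap_ext fun k x => congrArg Submodule.Quotient.mk (by
      change Induced.map (SeifertModule.Hom.hom f.hom + SeifertModule.Hom.hom g.hom) _
        = Induced.map (SeifertModule.Hom.hom f.hom) _ + Induced.map (SeifertModule.Hom.hom g.hom) _
      rw [Induced.map_single, Induced.map_single, Induced.map_single, LinearMap.add_apply,
        Induced.single_add])))

variable (A μ) in
/-- The class `Ξ` admits a left calculus of fractions. -/
lemma hasLeftCalculusOfFractions : (Xi A μ).HasLeftCalculusOfFractions := by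
  have : (Xi A μ).IsMultiplicative := by
    unfold Xi
    infer_instance
  refine { exists_leftFraction := fun X Y φ => ?_, ext := fun X' X Y f₁ f₂ s hs h => ?_ }
  · obtain ⟨X', s, hs, f, rfl⟩ := φ.cases
    have : IsIso ((seiCovering A μ).map s) := hs
    -- The morphism `B(s)⁻¹ B(f)` of coverings is a left fraction. The resulting square commutes
    -- only after `B`; a further morphism of `Ξ` kills the difference and makes it commute.
    obtain ⟨Y', g, t, ht, h⟩ := exists_leftFraction_covering
      (inv ((seiCovering A μ).map s) ≫ (seiCovering A μ).map f)
    obtain ⟨Y'', t', ht', h'⟩ := exists_Xi_comp_eq_zero (f ≫ t - s ≫ g) (by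
      rw [Functor.map_sub, Functor.map_comp, Functor.map_comp, ← h]
      simp)
    refine ⟨MorphismProperty.LeftFraction.mk (g ≫ t') (t ≫ t') ((Xi A μ).comp_mem _ _ ht ht'), ?_⟩
    rw [Preadditive.sub_comp, sub_eq_zero] at h'
    simpa using h'
  · have : IsIso ((seiCovering A μ).map s) := hs
    obtain ⟨Y', t, ht, h'⟩ := exists_Xi_comp_eq_zero (f₁ - f₂) (by
      rw [Functor.map_sub, ← cancel_epi ((seiCovering A μ).map s), Preadditive.comp_sub,
        ← Functor.map_comp, ← Functor.map_comp, h, sub_self, comp_zero])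
    rw [Preadditive.sub_comp, sub_eq_zero] at h'
    exact ⟨Y', t, ht, h'⟩

end Fractions

/-! ### Derived functors of an object with a resolution of length one -/

section LengthOne

variable {C : Type v} [Category.{w} C] [Abelian C]

/-- The complex with one differential `d`, in degree one. -/
abbrev lengthOneComplex {K L : C} (d : K ⟶ L) : ChainComplex C ℕ :=
  HomologicalComplex.double d (show (ComplexShape.down ℕ).Rel 1 0 from rfl)

lemma lengthOneComplex_d {K L : C} (d : K ⟶ L) :
    (lengthOneComplex d).d 1 0 = (HomologicalComplex.doubleXIso₀ d _).hom ≫ d ≫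
      (HomologicalComplex.doubleXIso₁ d _ one_ne_zero).inv :=
  HomologicalComplex.double_d d _ one_ne_zero

lemma isZero_lengthOneComplex_X {K L : C} (d : K ⟶ L) (n : ℕ) :
    IsZero ((lengthOneComplex d).X (n + 2)) :=
  HomologicalComplex.isZero_double_X d (show (ComplexShape.down ℕ).Rel 1 0 from rfl) _ (by omega)
    (by omega)

lemma exactAt_lengthOneComplex {D : Type*} [Category* D] [Abelian D] (F : C ⥤ D) [F.Additive]
    {K L : C} (d : K ⟶ L) (n : ℕ) :
    ((F.mapHomologicalComplex _).obj (lengthOneComplex d)).ExactAt (n + 2) :=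
  HomologicalComplex.exactAt_iff _ _ |>.2 <| ShortComplex.exact_of_isZero_X₂ _
    (F.map_isZero (isZero_lengthOneComplex_X d n))

lemma exactAt_one_lengthOneComplex_iff {D : Type*} [Category* D] [Abelian D] (F : C ⥤ D)
    [F.Additive] {K L : C} (d : K ⟶ L) :
    ((F.mapHomologicalComplex _).obj (lengthOneComplex d)).ExactAt 1 ↔ Mono (F.map d) := by
  rw [HomologicalComplex.exactAt_iff' _ 2 1 0 (by simp) (by simp), ShortComplex.exact_iff_mono _ (by
    exact (F.map_isZero (isZero_lengthOneComplex_X d 0)).eq_of_src _ _)]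
  change Mono (F.map ((lengthOneComplex d).d 1 0)) ↔ _
  exact (MorphismProperty.monomorphisms D).arrow_mk_iso_iff
    (Arrow.isoMk (F.mapIso (HomologicalComplex.doubleXIso₀ d _))
      (F.mapIso (HomologicalComplex.doubleXIso₁ d _ one_ne_zero)) (by
        simp [lengthOneComplex_d, ← Functor.map_comp]))

lemma exactAt_zero_lengthOneComplex_iff {D : Type*} [Category* D] [Abelian D] (F : C ⥤ D)
    [F.Additive] {K L : C} (d : K ⟶ L) :
    ((F.mapHomologicalComplex _).obj (lengthOneComplex d)).ExactAt 0 ↔ Epi (F.map d) := by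
  rw [HomologicalComplex.exactAt_iff' _ 1 0 0 (by simp) (by simp), ShortComplex.exact_iff_epi _ (by
    exact ((F.mapHomologicalComplex _).obj (lengthOneComplex d)).shape 0 0 (by simp))]
  change Epi (F.map ((lengthOneComplex d).d 1 0)) ↔ _
  exact (MorphismProperty.epimorphisms D).arrow_mk_iso_iff
    (Arrow.isoMk (F.mapIso (HomologicalComplex.doubleXIso₀ d _))
      (F.mapIso (HomologicalComplex.doubleXIso₁ d _ one_ne_zero)) (by
        simp [lengthOneComplex_d, ← Functor.map_comp]))

lemma lengthOneComplex_d_comp {K L M : C} (d : K ⟶ L) (q : L ⟶ M) (w : d ≫ q = 0) :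
    (lengthOneComplex d).d 1 0 ≫ (HomologicalComplex.doubleXIso₁ d _ one_ne_zero).hom ≫ q = 0 := by
  rw [lengthOneComplex_d]
  simp [w]

/-- The projective resolution given by a short exact sequence `0 → K → L → M → 0`. -/
abbrev lengthOneResolution {K L M : C} (d : K ⟶ L) (q : L ⟶ M) (w : d ≫ q = 0) [Mono d] [Epi q]
    (hex : (ShortComplex.mk d q w).Exact) [Projective K] [Projective L] :
    ProjectiveResolution M where
  complex := lengthOneComplex d
  projective n := by
    obtain (_ | _ | n) := n
    · exact Projective.of_iso (HomologicalComplex.doubleXIso₁ d _ one_ne_zero).symm inferInstance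
    · exact Projective.of_iso (HomologicalComplex.doubleXIso₀ d _).symm inferInstance
    · exact Projective.of_iso (isZero_lengthOneComplex_X d n).isoZero.symm inferInstance
  π := (ChainComplex.toSingle₀Equiv _ _).symm
    ⟨(HomologicalComplex.doubleXIso₁ d _ one_ne_zero).hom ≫ q, lengthOneComplex_d_comp d q w⟩
  quasiIso := ⟨fun n => by
    obtain (_ | _ | n) := n
    · rw [ChainComplex.quasiIsoAt₀_iff, ShortComplex.quasiIso_iff_of_zeros']
      · refine (ShortComplex.exact_and_epi_g_iff_of_iso ?_).2
          (⟨hex, inferInstance⟩ : (ShortComplex.mk d q w).Exact ∧ Epi q)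
        have hr : (ComplexShape.down ℕ).Rel 1 0 := rfl
        have h₁ : (HomologicalComplex.doubleXIso₀ d hr).hom ≫ d = (lengthOneComplex d).d 1 0 ≫
            (HomologicalComplex.doubleXIso₁ d hr one_ne_zero).hom := by
          rw [lengthOneComplex_d]
          simp
        have h₂ : (HomologicalComplex.doubleXIso₁ d hr one_ne_zero).hom ≫ q =
            (((ChainComplex.toSingle₀Equiv (lengthOneComplex d) M).symm
              ⟨_, lengthOneComplex_d_comp d q w⟩).f 0 : (lengthOneComplex d).X 0 ⟶ M) ≫ 𝟙 M :=
          ((Category.comp_id _).trans (ChainComplex.toSingle₀Equiv_symm_apply_f_zero _ _)).symm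
        exact ShortComplex.isoMk (HomologicalComplex.doubleXIso₀ d hr)
          (HomologicalComplex.doubleXIso₁ d hr one_ne_zero) (Iso.refl M) h₁
          h₂
      · exact (lengthOneComplex d).shape 0 0 (by simp)
      · rfl
      · rfl
    · rw [quasiIsoAt_iff_exactAt' _ _ (ChainComplex.exactAt_succ_single_obj _ _),
        HomologicalComplex.exactAt_iff' _ 2 1 0 (by simp) (by simp), ShortComplex.exact_iff_mono _
          ((isZero_lengthOneComplex_X d 0).eq_of_src _ _)]
      change Mono ((lengthOneComplex d).d 1 0)
      rw [lengthOneComplex_d]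
      infer_instance
    · rw [quasiIsoAt_iff_exactAt' _ _ (ChainComplex.exactAt_succ_single_obj _ _)]
      exact HomologicalComplex.exactAt_iff _ _ |>.2 <| ShortComplex.exact_of_isZero_X₂ _
        (isZero_lengthOneComplex_X d n)⟩

/-- The derived functors of the cokernel of `d` vanish if and only if the functor inverts `d`. -/
lemma isZero_leftDerived_iff [HasProjectiveResolutions C] {D : Type*} [Category* D] [Abelian D]
    (F : C ⥤ D) [F.Additive] {K L M : C} (d : K ⟶ L) (q : L ⟶ M) (w : d ≫ q = 0) [Mono d] [Epi q]
    (hex : (ShortComplex.mk d q w).Exact) [Projective K] [Projective L] :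
    (∀ n, IsZero ((F.leftDerived n).obj M)) ↔ IsIso (F.map d) := by
  -- The derived functors are the homology of the two-term complex `F(K) → F(L)`: exactness in
  -- degree one means that `F(d)` is mono, in degree zero that it is epi.
  have h : ∀ n, IsZero ((F.leftDerived n).obj M) ↔
      ((F.mapHomologicalComplex _).obj (lengthOneComplex d)).ExactAt n := fun n => by
    rw [HomologicalComplex.exactAt_iff_isZero_homology]
    exact ((lengthOneResolution d q w hex).isoLeftDerivedObj F n).isZero_iff
  simp only [h]
  constructor
  · intro H
    have := (exactAt_one_lengthOneComplex_iff F d).1 (H 1)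
    have := (exactAt_zero_lengthOneComplex_iff F d).1 (H 0)
    exact isIso_of_mono_of_epi _
  · intro H n
    obtain (_ | _ | n) := n
    · exact (exactAt_zero_lengthOneComplex_iff F d).2 inferInstance
    · exact (exactAt_one_lengthOneComplex_iff F d).2 inferInstance
    · exact exactAt_lengthOneComplex F d n

end LengthOne

/-! ### The tensor product with the augmentation -/

section AugmentationTensor

variable {R S : Type u} [Ring R] [Ring S] (φ : R →+* S)

/-- The subgroup of a module generated by the multiples of the elements of the kernel of `φ`. -/
def kerSpan (M : Type u) [AddCommGroup M] [Module R M] : AddSubgroup M :=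
  AddSubgroup.closure {m | ∃ (r : R) (n : M), φ r = 0 ∧ m = r • n}

variable {φ} {M N : Type u} [AddCommGroup M] [Module R M] [AddCommGroup N] [Module R N]

lemma smul_mem_kerSpan {r : R} (hr : φ r = 0) (n : M) : r • n ∈ kerSpan φ M :=
  AddSubgroup.subset_closure ⟨r, n, hr, rfl⟩

lemma map_mem_kerSpan (f : M →ₗ[R] N) {m : M} (hm : m ∈ kerSpan φ M) : f m ∈ kerSpan φ N := by
  have h : kerSpan φ M ≤ (kerSpan φ N).comap f.toAddMonoidHom := by
    refine (AddSubgroup.closure_le _).2 ?_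
    rintro _ ⟨r, n, hr, rfl⟩
    change f (r • n) ∈ kerSpan φ N
    rw [map_smul]
    exact smul_mem_kerSpan hr _
  exact h hm

lemma smul_mem_kerSpan_of_mem (r : R) {m : M} (hm : m ∈ kerSpan φ M) : r • m ∈ kerSpan φ M := by
  have h : kerSpan φ M ≤ (kerSpan φ M).comap (DistribSMul.toAddMonoidHom M r) := by
    refine (AddSubgroup.closure_le _).2 ?_
    rintro _ ⟨s, n, hs, rfl⟩
    change r • s • n ∈ kerSpan φ M
    rw [smul_smul]
    exact smul_mem_kerSpan (by rw [map_mul, hs, mul_zero]) _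
  exact h hm

/-- An element is in the kernel of the projection to the tensor product if and only if it is
in the span of the multiples of the elements of the kernel of `φ`. -/
lemma tmul_eq_zero_iff (hφ : Function.Surjective φ) (m : M) :
    (Submodule.Quotient.mk ((1 : S) ⊗ₜ[ℤ] m) : (S ⊗[ℤ] M) ⧸ balancing φ M) = 0 ↔
      m ∈ kerSpan φ M := by
  choose r hr using hφ
  constructor
  · intro h
    have hsmul : ∀ (s t : R), φ s = φ t → ∀ n : M,
        (QuotientAddGroup.mk (s • n) : M ⧸ kerSpan φ M) = QuotientAddGroup.mk (t • n) := by
      intro s t hst n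
      rw [QuotientAddGroup.eq, ← sub_eq_neg_add, ← sub_smul]
      exact smul_mem_kerSpan (by rw [map_sub, hst, sub_self]) n
    -- The inverse of `M / (ker φ) M → S ⊗ M` sends `s ⊗ m` to `r(s) m`, for a set-theoretic section
    -- `r` of `φ`; modulo `kerSpan` the choice of `r` does not matter.
    let b : S →+ M →+ M ⧸ kerSpan φ M :=
      AddMonoidHom.mk' (fun s => (QuotientAddGroup.mk' _).comp (DistribSMul.toAddMonoidHom M (r s)))
        fun s t => AddMonoidHom.ext fun n => by
          change (QuotientAddGroup.mk (r (s + t) • n) : M ⧸ kerSpan φ M)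
            = QuotientAddGroup.mk (r s • n) + QuotientAddGroup.mk (r t • n)
          rw [← QuotientAddGroup.mk_add, ← add_smul]
          exact hsmul _ _ (by rw [map_add, hr, hr, hr]) n
    let g : (S ⊗[ℤ] M) →ₗ[ℤ] M ⧸ kerSpan φ M := (TensorProduct.liftAddHom b (by
      intro z s n
      rw [map_zsmul, map_zsmul]; rfl)).toIntLinearMap
    have hg : ∀ s n, g (s ⊗ₜ[ℤ] n) = QuotientAddGroup.mk (r s • n) := fun _ _ => rfl
    have hle : balancing φ M ≤ LinearMap.ker g := by
      refine Submodule.span_le.2 ?_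
      rintro _ ⟨s, t, n, rfl⟩
      change g _ = 0
      rw [map_sub, hg, hg, sub_eq_zero, smul_smul]
      exact hsmul _ _ (by rw [map_mul, hr, hr]) n
    have h1 := hle ((Submodule.Quotient.mk_eq_zero _).1 h)
    rw [LinearMap.mem_ker, hg, hsmul _ 1 (by rw [hr, map_one]), one_smul] at h1
    exact (QuotientAddGroup.eq_zero_iff m).1 h1
  · intro h
    let τ : M →+ (S ⊗[ℤ] M) ⧸ balancing φ M :=
      (Submodule.mkQ (balancing φ M)).toAddMonoidHom.comp
        (TensorProduct.mk ℤ S M 1).toAddMonoidHom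
    have hle : kerSpan φ M ≤ τ.ker := by
      refine (AddSubgroup.closure_le _).2 ?_
      rintro _ ⟨s, n, hs, rfl⟩
      refine (Submodule.Quotient.mk_eq_zero _).2 ?_
      have : (1 : S) ⊗ₜ[ℤ] (s • n) = -((1 * φ s) ⊗ₜ[ℤ] n - (1 : S) ⊗ₜ[ℤ] (s • n)) := by
        rw [hs, mul_zero, TensorProduct.zero_tmul, zero_sub, neg_neg]
      change (1 : S) ⊗ₜ[ℤ] (s • n) ∈ _
      rw [this]
      exact neg_mem (Submodule.subset_span ⟨1, s, n, rfl⟩)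
    exact hle h

lemma exists_tmul_eq (hφ : Function.Surjective φ) (t : (S ⊗[ℤ] M) ⧸ balancing φ M) :
    ∃ m : M, Submodule.Quotient.mk ((1 : S) ⊗ₜ[ℤ] m) = t := by
  obtain ⟨t, rfl⟩ := Submodule.Quotient.mk_surjective _ t
  induction t with
  | zero => exact ⟨0, by rw [TensorProduct.tmul_zero]⟩
  | add a b ha hb =>
    obtain ⟨m, hm⟩ := ha
    obtain ⟨n, hn⟩ := hb
    exact ⟨m + n, by rw [TensorProduct.tmul_add, Submodule.Quotient.mk_add, hm, hn,
      Submodule.Quotient.mk_add]⟩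
  | tmul s m =>
    obtain ⟨r, rfl⟩ := hφ s
    refine ⟨r • m, ?_⟩
    rw [← sub_eq_zero, ← Submodule.Quotient.mk_sub, Submodule.Quotient.mk_eq_zero, ← neg_sub]
    refine neg_mem (Submodule.subset_span ⟨1, r, m, ?_⟩)
    rw [one_mul]

/-- The tensor functor inverts `f` if and only if `f` is bijective modulo the kernel of `φ`. -/
lemma isIso_tensorFunctor_map_iff (hφ : Function.Surjective φ) {K L : ModuleCat.{u} R}
    (f : K ⟶ L) :
    IsIso ((tensorFunctor φ).map f) ↔ (∀ m : K, f.hom m ∈ kerSpan φ L → m ∈ kerSpan φ K) ∧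
      ∀ n : L, ∃ m : K, n - f.hom m ∈ kerSpan φ L := by
  rw [ConcreteCategory.isIso_iff_bijective]
  have hf : ∀ m : K, (ConcreteCategory.hom ((tensorFunctor φ).map f))
      (Submodule.Quotient.mk ((1 : S) ⊗ₜ[ℤ] m)) = (Submodule.Quotient.mk ((1 : S) ⊗ₜ[ℤ] f.hom m) :
        (S ⊗[ℤ] L) ⧸ balancing φ L) := fun _ => rfl
  refine and_congr ?_ ?_
  · refine (injective_iff_map_eq_zero (ConcreteCategory.hom ((tensorFunctor φ).map f))).trans ?_
    constructor
    · intro h m hm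
      rw [← tmul_eq_zero_iff hφ]
      exact h _ ((hf m).trans ((tmul_eq_zero_iff hφ _).2 hm))
    · intro h t ht
      obtain ⟨m, rfl⟩ := exists_tmul_eq hφ t
      exact (tmul_eq_zero_iff hφ _).2 (h m ((tmul_eq_zero_iff hφ _).1 ((hf m).symm.trans ht)))
  · constructor
    · intro h n
      obtain ⟨t, ht⟩ := h (Submodule.Quotient.mk ((1 : S) ⊗ₜ[ℤ] n))
      obtain ⟨m, rfl⟩ := exists_tmul_eq hφ t
      refine ⟨m, (tmul_eq_zero_iff hφ _).1 ?_⟩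
      rw [TensorProduct.tmul_sub, Submodule.Quotient.mk_sub, sub_eq_zero]
      exact ht.symm.trans (hf m)
    · intro h t
      obtain ⟨n, rfl⟩ := exists_tmul_eq hφ t
      obtain ⟨m, hm⟩ := h n
      refine ⟨_, (hf m).trans ?_⟩
      rw [← tmul_eq_zero_iff hφ, TensorProduct.tmul_sub, Submodule.Quotient.mk_sub,
        sub_eq_zero] at hm
      exact hm.symm

end AugmentationTensor

/-! ### The Blanchfield condition read from the augmentation of a resolution -/

section BlanchfieldCriterion

variable {A : Type u} [Ring A] {μ : ℕ}

lemma augmentation_surjective : Function.Surjective (augmentation A μ) := fun a =>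
  ⟨MonoidAlgebra.single 1 a, augmentation_single 1 a⟩

/-- A module with a resolution of length one by projective modules is a Blanchfield module if and
only if the resolution is bijective modulo the augmentation ideal. -/
lemma isBlanchfield_iff {K L M : ModuleCat.{u} (GroupRing A μ)} (d : K →ₗ[GroupRing A μ] L)
    (q : L →ₗ[GroupRing A μ] M) [Module.Projective (GroupRing A μ) K]
    [Module.Projective (GroupRing A μ) L] (hd : Function.Injective d) (hex : Function.Exact d q)
    (hq : Function.Surjective q) :
    IsBlanchfield A μ M ↔
      (∀ k, d k ∈ kerSpan (augmentation A μ) L → k ∈ kerSpan (augmentation A μ) K) ∧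
        ∀ l, ∃ k, l - d k ∈ kerSpan (augmentation A μ) L := by
  have : Mono (ModuleCat.ofHom d) := (ModuleCat.mono_iff_injective _).2 hd
  have : Epi (ModuleCat.ofHom q) := (ModuleCat.epi_iff_surjective _).2 hq
  have w : ModuleCat.ofHom d ≫ ModuleCat.ofHom q = 0 :=
    ModuleCat.hom_ext (LinearMap.ext fun k => hex.apply_apply_eq_zero k)
  have : Projective K := (IsProjective.iff_projective K).1 inferInstance
  have : Projective L := (IsProjective.iff_projective L).1 inferInstance
  refine (isZero_leftDerived_iff (tensorFunctor (augmentation A μ)) (ModuleCat.ofHom d)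
    (ModuleCat.ofHom q) w ?_).trans
      (isIso_tensorFunctor_map_iff augmentation_surjective (ModuleCat.ofHom d))
  exact (ShortComplex.ShortExact.moduleCat_exact_iff_function_exact _).2 hex

/-- Elements of augmentation zero are combinations of the `1 - z_i`, which lie in the kernel of the
augmentation. -/
lemma Induced.mem_kerSpan_iff {P : Type u} [AddCommGroup P] [Module A P] (y : Induced μ P) :
    y ∈ kerSpan (augmentation A μ) (Induced μ P) ↔ Induced.total y = 0 := by
  constructor
  · intro h
    have hle : kerSpan (augmentation A μ) (Induced μ P) ≤ (Induced.total (μ := μ) (P := P)).ker := by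
      refine (AddSubgroup.closure_le _).2 ?_
      rintro _ ⟨r, n, hr, rfl⟩
      change Induced.total (r • n) = 0
      rw [Induced.total_smul, hr, zero_smul]
    exact hle h
  · intro h
    obtain ⟨u, hu⟩ := Induced.exists_eq_sum_smul (A := A) y h
    rw [hu]
    refine sum_mem fun i _ => smul_mem_kerSpan ?_ _
    rw [map_sub, map_one, grp, augmentation_single, sub_self]

end BlanchfieldCriterion

/-! ### Coverings are link modules -/

section CoveringLink

variable {A : Type u} [Ring A] {μ : ℕ}

namespace FoxModule

/-- The covering of a f.g. projective module with endomorphisms is a link module. -/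
lemma isFlk_of_cov {D : FoxModule A μ} (hD : D.IsFGProj) {M : ModuleCat.{u} (GroupRing A μ)}
    (e : D.Cov ≃ₗ[GroupRing A μ] M) : isFlk A μ M := by
  have := hD.1
  have := hD.2
  have hex : Function.Exact D.pres (e.toLinearMap ∘ₗ (LinearMap.range D.pres).mkQ) := by
    rw [LinearMap.exact_iff, LinearEquiv.ker_comp, Submodule.ker_mkQ]
  have hs : Function.Surjective (e.toLinearMap ∘ₗ (LinearMap.range D.pres).mkQ) :=
    e.surjective.comp (Submodule.mkQ_surjective _)
  refine ⟨⟨?_, ModuleCat.of _ (Induced μ D.N), ModuleCat.of _ (Induced μ D.N), D.pres, _,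
      Induced.finite, Induced.projective, Induced.finite, Induced.projective,
      D.pres_injective, hex, hs⟩,
    D.N, D.N, D.pres, _, hD.1, hD.2, hD.1, hD.2, D.pres_injective, hex, hs⟩
  have h1 : Module.Projective (GroupRing A μ) (ModuleCat.of (GroupRing A μ) (Induced μ D.N)) :=
    Induced.projective
  refine (isBlanchfield_iff (K := ModuleCat.of _ (Induced μ D.N))
    (L := ModuleCat.of _ (Induced μ D.N)) D.pres _ D.pres_injective hex hs).2 ⟨fun k hk => ?_,
      fun l => ⟨l, ?_⟩⟩
  · refine (Induced.mem_kerSpan_iff _).2 ?_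
    rw [← D.total_pres]
    exact (Induced.mem_kerSpan_iff _).1 hk
  · refine (Induced.mem_kerSpan_iff _).2 ?_
    rw [map_sub, D.total_pres, sub_self]

end FoxModule

/-- The covering functor takes values in the link modules. -/
lemma isFlk_seiCovering (V : Sei A μ) : isFlk A μ ((seiCovering A μ).obj V) :=
  FoxModule.isFlk_of_cov (isFGProj_fox V) V.obj.covEquiv.symm

end CoveringLink

/-! ### Link modules are coverings -/

section Linearization

variable {A : Type u} [Ring A] {μ : ℕ}

lemma finite_projective_pi (ι : Type) [Finite ι] (N : Type u) [AddCommGroup N] [Module A N]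
    [Module.Finite A N] [Module.Projective A N] :
    Module.Finite A (ι → N) ∧ Module.Projective A (ι → N) := by
  classical
  have := Fintype.ofFinite ι
  have : Module.Projective A (Π₀ _ : ι, N) := inferInstance
  exact ⟨inferInstance, Module.Projective.of_equiv
    (DFinsupp.linearEquivFunOnFintype (R := A) (M := fun _ : ι => N))⟩

/-- The words of length at most `n` in the letters `z_i`, `z_i⁻¹`. -/
abbrev BoundedWord (μ n : ℕ) : Type := {l : List (Fin μ × Bool) // l.length ≤ n}

instance (μ n : ℕ) : Finite (BoundedWord μ n) := List.finite_length_le (Fin μ × Bool) n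

instance (μ n : ℕ) : Fintype (BoundedWord μ n) := Fintype.ofFinite _

variable {N : ModuleCat.{u} A} {n : ℕ}

/-- The inclusion of the summand given by a word. -/
def wordIncl (A : Type u) [Ring A] (μ : ℕ) (N : ModuleCat.{u} A) (n : ℕ)
    (l : List (Fin μ × Bool)) : N →ₗ[A] (BoundedWord μ n → N) :=
  open scoped Classical in
  if h : l.length ≤ n then LinearMap.single A (fun _ : BoundedWord μ n => N) ⟨l, h⟩ else 0

/-- The Fox derivatives `∂_i` of words, with `l - 1 = ∑ (1 - z_i) ∂_i l`. -/
def wordFox (A : Type u) [Ring A] (μ : ℕ) (N : ModuleCat.{u} A) (n : ℕ) (i : Fin μ) :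
    List (Fin μ × Bool) → (N →ₗ[A] (BoundedWord μ n → N))
  | [] => 0
  | (j, true) :: l => wordFox A μ N n i l - if i = j then wordIncl A μ N n l else 0
  | (j, false) :: l =>
    wordFox A μ N n i l + if i = j then wordIncl A μ N n ((j, false) :: l) else 0

/-- The linearization of the endomorphism `∑ d_k k`. -/
def linearization (n : ℕ) (s : Finset (FreeGroup (Fin μ)))
    (d : FreeGroup (Fin μ) → Module.End A N) : FoxModule A μ where
  N := ModuleCat.of A (BoundedWord μ n → N)
  -- Write `l x = (l - 1) x + x`. In the cokernel `∑ k (d_k x) = 0`, and with `∑ d_k = 1` this gives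
  -- `x = -∑ (k - 1) d_k x`. Expanding both parts by `l - 1 = ∑ (1 - z_i) ∂_i l` yields these
  -- coordinates.
  δ i := ∑ l : BoundedWord μ n, (wordFox A μ N n i l.1
    - ∑ k ∈ s, wordFox A μ N n i k.toWord ∘ₗ d k) ∘ₗ LinearMap.proj l

variable {s : Finset (FreeGroup (Fin μ))} {d : FreeGroup (Fin μ) → Module.End A N}

lemma linearization_δ (i : Fin μ) {l : List (Fin μ × Bool)} (hl : l.length ≤ n) (x : N) :
    (linearization n s d).δ i (wordIncl A μ N n l x) = wordFox A μ N n i l x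
      - ∑ k ∈ s, wordFox A μ N n i k.toWord (d k x) := by
  classical
  change (∑ l : BoundedWord μ n, (wordFox A μ N n i l.1
    - ∑ k ∈ s, wordFox A μ N n i k.toWord ∘ₗ d k) ∘ₗ LinearMap.proj l :
      (BoundedWord μ n → N) →ₗ[A] _) (wordIncl A μ N n l x) = _
  rw [LinearMap.sum_apply, Finset.sum_eq_single ⟨l, hl⟩]
  · rw [LinearMap.comp_apply, wordIncl, dif_pos hl, LinearMap.proj_apply, LinearMap.single_apply,
      Pi.single_eq_same, LinearMap.sub_apply, LinearMap.sum_apply]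
    rfl
  · intro b _ hb
    rw [LinearMap.comp_apply, wordIncl, dif_pos hl, LinearMap.proj_apply, LinearMap.single_apply,
      Pi.single_eq_of_ne hb, map_zero]
  · simp

/-- The class in the covering of the linearization of the element given by a word. -/
def wordCls (n : ℕ) (s : Finset (FreeGroup (Fin μ))) (d : FreeGroup (Fin μ) → Module.End A N)
    (l : List (Fin μ × Bool)) : N →+ (linearization n s d).Cov :=
  (linearization n s d).cls.comp (wordIncl A μ N n l).toAddMonoidHom

/-- The common part of the relations in the covering of the linearization. -/
def wordRel (n : ℕ) (s : Finset (FreeGroup (Fin μ))) (d : FreeGroup (Fin μ) → Module.End A N)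
    (x : N) : (linearization n s d).Cov :=
  ∑ i, (1 - grp A (FreeGroup.of i)) • (linearization n s d).cls
    (∑ k ∈ s, wordFox A μ N n i k.toWord (d k x) : BoundedWord μ n → N)

/-- The term `wordRel` does not depend on `l`, so it cancels when two words are compared. -/
lemma wordCls_eq {l : List (Fin μ × Bool)} (hl : l.length ≤ n) (x : N) :
    wordCls n s d l x = ∑ i, (1 - grp A (FreeGroup.of i)) •
      (linearization n s d).cls (wordFox A μ N n i l x : BoundedWord μ n → N)
        - wordRel n s d x := by
  refine ((linearization n s d).cls_eq _).trans ?_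
  rw [wordRel, ← Finset.sum_sub_distrib]
  refine Finset.sum_congr rfl fun i _ => ?_
  rw [← smul_sub]
  refine congrArg _ (Eq.trans (congrArg _ (linearization_δ i hl x)) ?_)
  exact (linearization n s d).cls.map_sub _ _

lemma sum_smul_ite {M : Type v} [AddCommGroup M] [Module (GroupRing A μ) M] (j : Fin μ) (m : M) :
    ∑ i, (1 - grp A (FreeGroup.of i)) • (if i = j then m else 0)
      = m - grp A (FreeGroup.of j) • m := by
  simp [sub_smul]

/-- The relations for `a :: l` and `l` differ by one Fox term. Their difference says that prepending
a letter to the word multiplies its class by that letter. -/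
lemma wordCls_eq_smul {l : List (Fin μ × Bool)} (hl : l.length ≤ n) (x : N) :
    wordCls n s d l x = grp A (FreeGroup.mk l) • wordCls n s d [] x := by
  induction l with
  | nil => exact (one_smul _ _).symm
  | cons a l ih =>
    have hl' : l.length ≤ n := by
      rw [List.length_cons] at hl
      omega
    have h1 := wordCls_eq (s := s) (d := d) hl x
    have h2 := wordCls_eq (s := s) (d := d) hl' x
    have hmk : FreeGroup.mk (a :: l) = FreeGroup.mk [a] * FreeGroup.mk l := by
      rw [FreeGroup.mul_mk]; rfl
    rw [hmk, grp_mul_smul, ← ih hl']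
    obtain ⟨j, _ | _⟩ := a
    · have h3 : ∀ i, (linearization n s d).cls
          (wordFox A μ N n i ((j, false) :: l) x : BoundedWord μ n → N)
          = (linearization n s d).cls (wordFox A μ N n i l x : BoundedWord μ n → N)
            + if i = j then wordCls n s d ((j, false) :: l) x else 0 := fun i => by
        rw [wordFox, LinearMap.add_apply]
        refine ((linearization n s d).cls.map_add _ _).trans ?_
        congr 1
        split_ifs
        · rfl
        · exact map_zero _
      simp only [h3, smul_add, Finset.sum_add_distrib, sum_smul_ite] at h1
      rw [mk_letter_false, h2, eq_comm]
      rw [add_sub_right_comm, ← h2, add_sub_assoc', eq_sub_iff_add_eq, add_comm] at h1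
      rw [← h2, ← add_right_cancel h1, grp_inv_smul_smul]
    · have h3 : ∀ i, (linearization n s d).cls
          (wordFox A μ N n i ((j, true) :: l) x : BoundedWord μ n → N)
          = (linearization n s d).cls (wordFox A μ N n i l x : BoundedWord μ n → N)
            - if i = j then wordCls n s d l x else 0 := fun i => by
        rw [wordFox, LinearMap.sub_apply]
        refine ((linearization n s d).cls.map_sub _ _).trans ?_
        congr 1
        split_ifs
        · rfl
        · exact map_zero _
      simp only [h3, smul_sub, Finset.sum_sub_distrib, sum_smul_ite] at h1
      rw [mk_letter_true]
      rw [sub_right_comm, ← h2, sub_sub_cancel] at h1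
      exact h1

/-- The fundamental formula `l - 1 = ∑ (1 - z_i) ∂_i l` of Fox calculus, evaluated in a module where
the copy of `x` at the word `l` is sent to `l · f x`. -/
lemma wordFox_sum {M : Type u} [AddCommGroup M] [Module (GroupRing A μ) M] (f : N →+ M)
    (g : (BoundedWord μ n → N) →+ M) (hg : ∀ (l : List (Fin μ × Bool)), l.length ≤ n → ∀ x : N,
      g (wordIncl A μ N n l x) = grp A (FreeGroup.mk l) • f x)
    {l : List (Fin μ × Bool)} (hl : l.length ≤ n) (x : N) :
    ∑ i, (1 - grp A (FreeGroup.of i)) • g (wordFox A μ N n i l x)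
      = grp A (FreeGroup.mk l) • f x - f x := by
  induction l with
  | nil =>
    have : grp A (FreeGroup.mk ([] : List (Fin μ × Bool))) = 1 := rfl
    rw [this, one_smul, sub_self]
    exact Finset.sum_eq_zero fun i _ => by rw [wordFox, LinearMap.zero_apply, map_zero, smul_zero]
  | cons a l ih =>
    have hl' : l.length ≤ n := by
      rw [List.length_cons] at hl
      omega
    have hmk : FreeGroup.mk (a :: l) = FreeGroup.mk [a] * FreeGroup.mk l := by
      rw [FreeGroup.mul_mk]; rfl
    obtain ⟨j, _ | _⟩ := a
    · have h3 : ∀ i, g (wordFox A μ N n i ((j, false) :: l) x) = g (wordFox A μ N n i l x)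
            + if i = j then grp A (FreeGroup.mk ((j, false) :: l)) • f x else 0 := fun i => by
        rw [wordFox, LinearMap.add_apply, map_add]
        congr 1
        split_ifs
        · exact hg _ hl x
        · exact map_zero _
      simp only [h3, smul_add, Finset.sum_add_distrib, sum_smul_ite]
      rw [ih hl', hmk, mk_letter_false, grp_mul_smul, grp_smul_inv_smul]
      abel
    · have h3 : ∀ i, g (wordFox A μ N n i ((j, true) :: l) x) = g (wordFox A μ N n i l x)
            - if i = j then grp A (FreeGroup.mk l) • f x else 0 := fun i => by
        rw [wordFox, LinearMap.sub_apply, map_sub]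
        congr 1
        split_ifs
        · exact hg _ hl' x
        · exact map_zero _
      simp only [h3, smul_sub, Finset.sum_sub_distrib, sum_smul_ite]
      rw [ih hl', hmk, mk_letter_true, grp_mul_smul]
      abel

lemma eq_sum_wordIncl (w : BoundedWord μ n → N) :
    w = ∑ l : BoundedWord μ n, wordIncl A μ N n l.1 (w l) := by
  classical
  conv_lhs => rw [← Finset.univ_sum_single w]
  exact Finset.sum_congr rfl fun l _ => by rw [wordIncl, dif_pos l.2]; rfl

/-- The covering of the linearization is the cokernel. -/
lemma nonempty_linearization_equiv (f : Induced μ N →ₗ[GroupRing A μ] Induced μ N)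
    (hf : f = ∑ k ∈ s, Induced.twist k (d k)) (hd : ∀ x, ∑ k ∈ s, d k x = x)
    (hn : ∀ k ∈ s, k.toWord.length ≤ n) :
    Nonempty ((linearization n s d).Cov ≃ₗ[GroupRing A μ] (Induced μ N ⧸ LinearMap.range f)) := by
  set D := linearization n s d with hD
  let ι : N →+ Induced μ N ⧸ LinearMap.range f :=
    (LinearMap.range f).mkQ.toAddMonoidHom.comp (Induced.singleHom 1)
  have hι : ∀ (a : A) x, ι (a • x) = (MonoidAlgebra.single 1 a : GroupRing A μ) • ι x :=
    fun a x => by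
      change (LinearMap.range f).mkQ (Induced.single 1 (a • x)) = _
      rw [← Induced.const_smul_single, map_smul]; rfl
  have hf1 : ∀ x, f (Induced.single 1 x) = ∑ k ∈ s, grp A k • Induced.single 1 (d k x) :=
    fun x => by
      rw [hf, LinearMap.sum_apply]
      refine Finset.sum_congr rfl fun k _ => ?_
      rw [Induced.twist_single, Induced.grp_smul_single, one_mul, mul_one]
  have hιrel : ∀ x, ∑ k ∈ s, grp A k • ι (d k x) = 0 := fun x => by
    have : (LinearMap.range f).mkQ (f (Induced.single 1 x)) = 0 :=
      (Submodule.Quotient.mk_eq_zero _).2 ⟨_, rfl⟩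
    rw [hf1, map_sum] at this
    rw [← this]
    exact Finset.sum_congr rfl fun k _ => (map_smul (LinearMap.range f).mkQ _ _).symm
  let g : (BoundedWord μ n → N) →+ Induced μ N ⧸ LinearMap.range f :=
    ∑ l : BoundedWord μ n, (DistribSMul.toAddMonoidHom _ (grp A (FreeGroup.mk l.1))).comp
      (ι.comp (Pi.evalAddMonoidHom _ l))
  have hgapply : ∀ w, g w = ∑ l : BoundedWord μ n, grp A (FreeGroup.mk l.1) • ι (w l) :=
    fun w => by
      change (∑ l : BoundedWord μ n, _ : _ →+ _) w = _
      rw [AddMonoidHom.finsetSum_apply]; rfl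
  have hg : ∀ l : List (Fin μ × Bool), l.length ≤ n → ∀ x : N,
      g (wordIncl A μ N n l x) = grp A (FreeGroup.mk l) • ι x := fun l hl x => by
    classical
    rw [hgapply, Finset.sum_eq_single ⟨l, hl⟩]
    · rw [wordIncl, dif_pos hl, LinearMap.single_apply, Pi.single_eq_same]
    · intro b _ hb
      rw [wordIncl, dif_pos hl, LinearMap.single_apply, Pi.single_eq_of_ne hb, map_zero, smul_zero]
    · simp
  have hgs : ∀ (a : A) w, g (a • w) = (MonoidAlgebra.single 1 a : GroupRing A μ) • g w :=
    fun a w => by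
      rw [hgapply, hgapply, Finset.smul_sum]
      refine Finset.sum_congr rfl fun l _ => ?_
      rw [Pi.smul_apply, hι, smul_smul, smul_smul, MonoidAlgebra.single_mul_single,
        MonoidAlgebra.single_mul_single, one_mul, mul_one, one_mul, mul_one]
  have hgrel : ∀ l : List (Fin μ × Bool), l.length ≤ n → ∀ x : N, g (wordIncl A μ N n l x)
      = ∑ i, (1 - grp A (FreeGroup.of i)) • g (D.δ i (wordIncl A μ N n l x)) := fun l hl x => by
    have h1 : ∀ i, g (D.δ i (wordIncl A μ N n l x)) = g (wordFox A μ N n i l x)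
        - ∑ k ∈ s, g (wordFox A μ N n i k.toWord (d k x)) := fun i => by
      refine (congrArg g (linearization_δ i hl x)).trans ?_
      rw [map_sub, map_sum]
    simp only [h1, smul_sub, Finset.sum_sub_distrib, Finset.smul_sum]
    rw [wordFox_sum ι g hg hl, Finset.sum_comm, hg l hl]
    have h2 : ∀ k ∈ s, ∑ i, (1 - grp A (FreeGroup.of i)) • g (wordFox A μ N n i k.toWord (d k x))
        = grp A k • ι (d k x) - ι (d k x) := fun k hk => by
      rw [wordFox_sum ι g hg (hn k hk), FreeGroup.mk_toWord]
    rw [Finset.sum_congr rfl h2, Finset.sum_sub_distrib, hιrel, ← map_sum, hd]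
    abel
  let F : D.Cov →ₗ[GroupRing A μ] (Induced μ N ⧸ LinearMap.range f) := D.covLift g hgs fun w => by
    let R : (BoundedWord μ n → N) →+ Induced μ N ⧸ LinearMap.range f :=
      ∑ i, (DistribSMul.toAddMonoidHom _ (1 - grp A (FreeGroup.of i))).comp
        (g.comp (D.δ i).toAddMonoidHom)
    have hR : ∀ w, R w = ∑ i, (1 - grp A (FreeGroup.of i)) • g (D.δ i w) := fun w => by
      change (∑ i, _ : _ →+ _) w = _
      rw [AddMonoidHom.finsetSum_apply]; rfl
    refine Eq.trans ?_ (hR w)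
    change g w = R w
    rw [eq_sum_wordIncl w, map_sum, map_sum]
    exact Finset.sum_congr rfl fun l _ => (hgrel l.1 l.2 _).trans (hR _).symm
  have hw : ∀ (a : A) x, wordCls n s d [] (a • x)
      = (MonoidAlgebra.single 1 a : GroupRing A μ) • wordCls n s d [] x := fun a x => by
    change D.cls (wordIncl A μ N n [] (a • x)) = _
    rw [map_smul]
    exact D.cls_const_smul a _
  let G₀ : Induced μ N →ₗ[GroupRing A μ] D.Cov := Induced.desc (wordCls n s d []) hw
  have hG₀ : LinearMap.range f ≤ LinearMap.ker G₀ := by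
    have h : G₀ ∘ₗ f = 0 := Induced.linearMap_ext_one fun x => by
      rw [LinearMap.comp_apply, hf1, map_sum, LinearMap.zero_apply]
      have h1 : ∀ k ∈ s, G₀ (grp A k • Induced.single 1 (d k x))
          = ∑ i, (1 - grp A (FreeGroup.of i)) •
            D.cls (wordFox A μ N n i k.toWord (d k x) : BoundedWord μ n → N)
              - wordRel n s d (d k x) := fun k hk => by
        rw [map_smul, Induced.desc_single_one, ← wordCls_eq (hn k hk), wordCls_eq_smul (hn k hk),
          FreeGroup.mk_toWord]
      rw [Finset.sum_congr rfl h1, Finset.sum_sub_distrib]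
      -- Here `∑ d_k = 1` enters: the common terms for the `d_k x` add up to the one for `x`, which
      -- then cancels against the Fox terms.
      have h2 : ∑ k ∈ s, wordRel n s d (d k x) = wordRel n s d x := by
        let R : N →+ D.Cov := ∑ i, (DistribSMul.toAddMonoidHom _ (1 - grp A (FreeGroup.of i))).comp
          (D.cls.comp (∑ k ∈ s, wordFox A μ N n i k.toWord ∘ₗ d k :
            N →ₗ[A] (BoundedWord μ n → N)).toAddMonoidHom)
        have hR : ∀ x, wordRel n s d x = R x := fun x => by
          change _ = (∑ i, _ : _ →+ _) x
          rw [AddMonoidHom.finsetSum_apply, wordRel]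
          refine Finset.sum_congr rfl fun i _ => ?_
          change _ = (1 - grp A (FreeGroup.of i)) • D.cls ((∑ k ∈ s, wordFox A μ N n i k.toWord ∘ₗ d k :
            N →ₗ[A] (BoundedWord μ n → N)) x)
          rw [LinearMap.sum_apply]; rfl
        simp only [hR]
        rw [← map_sum, hd]
      rw [h2, Finset.sum_comm, wordRel, ← Finset.sum_sub_distrib]
      refine Finset.sum_eq_zero fun i _ => ?_
      rw [← Finset.smul_sum, ← smul_sub]
      have h3 := map_sum (D.cls : (BoundedWord μ n → N) →+ D.Cov)
        (fun k => wordFox A μ N n i k.toWord (d k x)) s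
      exact (congrArg _ (sub_eq_zero.2 h3.symm)).trans (smul_zero _)
    rintro _ ⟨y, rfl⟩
    exact LinearMap.congr_fun h y
  let G : (Induced μ N ⧸ LinearMap.range f) →ₗ[GroupRing A μ] D.Cov :=
    (LinearMap.range f).liftQ G₀ hG₀
  have hGι : ∀ x, G (ι x) = wordCls n s d [] x := fun x => Induced.desc_single_one _ hw x
  have hF : ∀ l : List (Fin μ × Bool), l.length ≤ n → ∀ x : N,
      F (D.cls (wordIncl A μ N n l x)) = grp A (FreeGroup.mk l) • ι x := fun l hl x =>
    (D.covLift_cls _ _ _ _).trans (hg l hl x)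
  refine ⟨LinearEquiv.ofLinearMap F G ?_ ?_⟩
  · refine Submodule.linearMap_qext _ (Induced.linearMap_ext_one fun x => ?_)
    change F (G (ι x)) = ι x
    rw [hGι]
    exact (hF [] (Nat.zero_le _) x).trans (one_smul _ _)
  · refine D.cov_hom_ext fun w => ?_
    rw [LinearMap.comp_apply, LinearMap.id_apply]
    change G (F (D.cls w)) = D.cls w
    have h1 : ∀ l : BoundedWord μ n, G (F (D.cls (wordIncl A μ N n l.1 (w l))))
        = D.cls (wordIncl A μ N n l.1 (w l)) := fun l => by
      rw [hF l.1 l.2, map_smul, hGι, ← wordCls_eq_smul l.2]; rfl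
    let L : (BoundedWord μ n → N) →+ D.Cov := ((G ∘ₗ F).toAddMonoidHom.comp D.cls)
    have h2 : L w = (D.cls : (BoundedWord μ n → N) →+ D.Cov) w := by
      have h3 := eq_sum_wordIncl w
      refine (congrArg L h3).trans (Eq.trans ?_ (congrArg _ h3.symm))
      rw [map_sum]
      refine Eq.trans ?_ (map_sum (D.cls : (BoundedWord μ n → N) →+ D.Cov) _ _).symm
      exact Finset.sum_congr rfl fun l _ => h1 l
    exact h2

/-- Every link module is isomorphic to the covering of a f.g. projective module with
endomorphisms. -/
lemma exists_cov_equiv {M : ModuleCat.{u} (GroupRing A μ)} (hM : isFlk A μ M) :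
    ∃ D : FoxModule A μ, D.IsFGProj ∧ Nonempty (D.Cov ≃ₗ[GroupRing A μ] M) := by
  obtain ⟨⟨hB, -⟩, P, Q, d, q, _, _, _, _, hd, hex, hq⟩ := hM
  have h1 : Module.Projective (GroupRing A μ) (ModuleCat.of (GroupRing A μ) (Induced μ P)) :=
    Induced.projective
  have h2 : Module.Projective (GroupRing A μ) (ModuleCat.of (GroupRing A μ) (Induced μ Q)) :=
    Induced.projective
  obtain ⟨hB1, hB2⟩ := (isBlanchfield_iff (K := ModuleCat.of _ (Induced μ P))
    (L := ModuleCat.of _ (Induced μ Q)) d q hd hex hq).1 hB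
  let φ : P →ₗ[A] Q :=
    { toFun := fun x => Induced.total (d (Induced.single 1 x))
      map_add' := fun x y => by rw [Induced.single_add, map_add, map_add]
      map_smul' := fun a x => by
        rw [← Induced.const_smul_single, map_smul, Induced.total_smul, augmentation_single]; rfl }
  have hφ : ∀ y, Induced.total (d y) = φ (Induced.total y) := fun y => by
    have h : y - Induced.single 1 (Induced.total y)
        ∈ kerSpan (augmentation A μ) (Induced μ P) :=
      (Induced.mem_kerSpan_iff _).2 (by rw [map_sub, Induced.total_single, sub_self])
    have := (Induced.mem_kerSpan_iff _).1 (map_mem_kerSpan d h)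
    rwa [map_sub, map_sub, sub_eq_zero] at this
  -- The Blanchfield condition: `φ` is the augmentation of the presentation `d`.
  have hφb : Function.Bijective φ := by
    refine ⟨(injective_iff_map_eq_zero φ).2 fun x hx => ?_, fun x => ?_⟩
    · have := (Induced.mem_kerSpan_iff _).1 (hB1 (Induced.single 1 x)
        ((Induced.mem_kerSpan_iff _).2 hx))
      rwa [Induced.total_single] at this
    · obtain ⟨k, hk⟩ := hB2 (Induced.single 1 x)
      have := (Induced.mem_kerSpan_iff _).1 hk
      rw [map_sub, Induced.total_single, sub_eq_zero, hφ] at this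
      exact ⟨_, this.symm⟩
  let φe := LinearEquiv.ofBijective φ hφb
  -- Precomposition with the inverse of the augmentation makes the augmentation the identity and
  -- keeps the image of `d`.
  let f : Induced μ Q →ₗ[GroupRing A μ] Induced μ Q := d ∘ₗ Induced.map φe.symm.toLinearMap
  have hf1 : ∀ x, Induced.total (f (Induced.single 1 x)) = x := fun x => by
    rw [LinearMap.comp_apply, Induced.map_single_one, hφ, Induced.total_single]
    exact φe.apply_symm_apply x
  have hrange : LinearMap.range f = LinearMap.ker q := by
    rw [LinearMap.range_comp_of_range_eq_top _ (LinearMap.range_eq_top.2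
      (Induced.map_surjective φe.symm.surjective))]
    exact (LinearMap.exact_iff.1 hex).symm
  obtain ⟨s, hs⟩ := Induced.exists_eq_sum_twist f
  -- The bound `n` is the largest length of a word occurring in `f`.
  obtain ⟨e⟩ := nonempty_linearization_equiv (n := s.sup fun k => k.toWord.length) f hs
    (fun x => (Induced.total_eq_sum_coeffMap hs x).symm.trans (hf1 x))
    (fun k hk => Finset.le_sup (f := fun k : FreeGroup (Fin μ) => k.toWord.length) hk)
  exact ⟨linearization _ s (Induced.coeffMap f), finite_projective_pi (BoundedWord μ _) Q, ⟨e.trans ((Submodule.quotEquivOfEq _ _ hrange).trans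
    (q.quotKerEquivOfSurjective hq))⟩⟩

/-- The isomorphism of coverings given by an equivalence. -/
def FoxModule.Hom.IsCovEquiv.equiv {D E : FoxModule A μ} {t : FoxModule.Hom D E}
    (ht : t.IsCovEquiv) : D.Cov ≃ₗ[GroupRing A μ] E.Cov :=
  LinearEquiv.ofBijective (FoxModule.covMap t) ht

/-- Every link module is isomorphic to the covering of a f.g. projective Seifert module. -/
lemma exists_seiCovering_equiv {M : ModuleCat.{u} (GroupRing A μ)} (hM : isFlk A μ M) :
    ∃ V : Sei A μ, Nonempty ((seiCovering A μ).obj V ≃ₗ[GroupRing A μ] M) := by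
  obtain ⟨D, hD, ⟨e⟩⟩ := exists_cov_equiv hM
  exact ⟨toSei hD, ⟨(toSei hD).obj.covEquiv.trans
    ((SeifertModule.toFox_isCovEquiv D).equiv.symm.trans e)⟩⟩

end Linearization

/-! ### Short exact sequences of coverings -/

section ShortExactCoverings

variable {A : Type u} [Ring A] {μ : ℕ}

namespace Induced

variable {P Q R : Type u} [AddCommGroup P] [Module A P] [AddCommGroup Q] [Module A Q]
  [AddCommGroup R] [Module A R]

lemma coeff_map (f : P →ₗ[A] Q) (g : FreeGroup (Fin μ)) (y : Induced μ P) :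
    coeff g (map f y) = f (coeff g y) := by
  classical
  conv_lhs => rw [eq_sum_support y, map_sum, map_sum]
  conv_rhs => rw [eq_sum_support y, map_sum, map_sum]
  refine Finset.sum_congr rfl fun h _ => ?_
  rw [map_single, coeff_single, coeff_single, apply_ite f, map_zero]

lemma map_injective {f : P →ₗ[A] Q} (hf : Function.Injective f) :
    Function.Injective (map (μ := μ) f) := fun x y h => ext_coeff fun g => hf (by
  rw [← coeff_map, ← coeff_map, h])

lemma map_exact {f : P →ₗ[A] Q} {g : Q →ₗ[A] R} (h : Function.Exact f g) :
    Function.Exact (map (μ := μ) f) (map (μ := μ) g) := by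
  intro y
  constructor
  · intro hy
    choose x hx using fun k => (h (coeff k y)).1 (by rw [← coeff_map, hy, map_zero])
    refine ⟨∑ k ∈ support y, single k (x k), ?_⟩
    conv_rhs => rw [eq_sum_support y]
    rw [map_sum]
    exact Finset.sum_congr rfl fun k _ => by rw [map_single, hx]
  · rintro ⟨x, rfl⟩
    refine ext_coeff fun k => ?_
    rw [coeff_map, coeff_map, h.apply_apply_eq_zero, map_zero]

end Induced

namespace FoxModule

variable {D E G : FoxModule A μ}

lemma covMap_mkQ (s : Hom D E) (y : Induced μ D.N) :
    covMap s ((LinearMap.range D.pres).mkQ y)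
      = (LinearMap.range E.pres).mkQ (Induced.map s.hom y) := by
  have h : covMap s ∘ₗ (LinearMap.range D.pres).mkQ
      = (LinearMap.range E.pres).mkQ ∘ₗ Induced.map s.hom := Induced.linearMap_ext_one fun x => by
    rw [LinearMap.comp_apply, LinearMap.comp_apply, Induced.map_single_one]
    exact covMap_cls s x
  exact LinearMap.congr_fun h y

lemma map_pres (s : Hom D E) (y : Induced μ D.N) :
    Induced.map s.hom (D.pres y) = E.pres (Induced.map s.hom y) := by
  have h : Induced.map s.hom ∘ₗ D.pres = E.pres ∘ₗ Induced.map s.hom :=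
    Induced.linearMap_ext_one fun x => by
      simp [pres_single, Induced.map_single, s.comm]
  exact LinearMap.congr_fun h y

lemma covMap_surjective {s : Hom D E} (h : Function.Surjective s.hom) :
    Function.Surjective (covMap s) := fun m => by
  obtain ⟨y, rfl⟩ := Submodule.mkQ_surjective _ m
  obtain ⟨x, rfl⟩ := Induced.map_surjective h y
  exact ⟨_, covMap_mkQ s x⟩

/-- The coverings of a short exact sequence are a short exact sequence. -/
lemma covMap_shortExact {s : Hom D E} {t : Hom E G} (hs : Function.Injective s.hom)
    (hst : Function.Exact s.hom t.hom) (ht : Function.Surjective t.hom) :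
    Function.Injective (covMap s) ∧ Function.Exact (covMap s) (covMap t) ∧
      Function.Surjective (covMap t) := by
  refine ⟨?_, fun m => ⟨fun hm => ?_, ?_⟩, covMap_surjective ht⟩
  · rw [injective_iff_map_eq_zero]
    intro m hm
    obtain ⟨x, rfl⟩ := Submodule.mkQ_surjective _ m
    rw [covMap_mkQ] at hm
    obtain ⟨b, hb⟩ := (Submodule.Quotient.mk_eq_zero _).1 hm
    -- As in the snake lemma: injectivity of `G.pres` removes the connecting map, so the coverings
    -- stay exact on the left.
    have h1 : Induced.map t.hom b = 0 := G.pres_injective (by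
      rw [← map_pres, hb, (Induced.map_exact hst).apply_apply_eq_zero, map_zero])
    obtain ⟨a, rfl⟩ := (Induced.map_exact hst b).1 h1
    rw [← map_pres] at hb
    exact (Submodule.Quotient.mk_eq_zero _).2 ⟨a, Induced.map_injective hs hb⟩
  · obtain ⟨y, rfl⟩ := Submodule.mkQ_surjective _ m
    rw [covMap_mkQ] at hm
    obtain ⟨c, hc⟩ := (Submodule.Quotient.mk_eq_zero _).1 hm
    obtain ⟨b, rfl⟩ := Induced.map_surjective ht c
    rw [← map_pres] at hc
    obtain ⟨x, hx⟩ := (Induced.map_exact hst (y - E.pres b)).1 (by rw [map_sub, hc, sub_self])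
    refine ⟨(LinearMap.range D.pres).mkQ x, ?_⟩
    rw [covMap_mkQ, hx, map_sub, sub_eq_self]
    exact (Submodule.Quotient.mk_eq_zero _).2 ⟨b, rfl⟩
  · rintro ⟨m, rfl⟩
    obtain ⟨x, rfl⟩ := Submodule.mkQ_surjective _ m
    rw [covMap_mkQ, covMap_mkQ, (Induced.map_exact hst).apply_apply_eq_zero, map_zero]

/-- The Seifert morphism given by a morphism of modules with endomorphisms. -/
def toSeifertMap (s : Hom D E) : D.toSeifert ⟶ E.toSeifert :=
  show SeifertModule.Hom D.toSeifert E.toSeifert from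
  { hom := (LinearMap.pi fun j => s.hom ∘ₗ D.entry none j : (D.shift none).N →ₗ[A] (Fin μ → E.N))
    comm_e := LinearMap.ext fun n => shift_ext fun j => by
      change s.hom (D.entry none j ((∑ i, (D.shift none).δ i : Module.End A (D.shift none).N) n))
        = E.entry none j ((∑ i, (E.shift none).δ i : Module.End A (E.shift none).N) _)
      rw [LinearMap.sum_apply, LinearMap.sum_apply, map_sum, map_sum, map_sum]
      refine Finset.sum_congr rfl fun i _ => ?_
      rw [entry_δ, entry_δ]
      simp only [reduceCtorEq, if_false, zero_add, sub_zero]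
      exact s.comm j _
    comm_π := fun i => LinearMap.ext fun n => shift_ext fun j => by
      change s.hom (D.entry none j (D.incl none i (D.entry none i n)))
        = E.entry none j (E.incl none i (s.hom (D.entry none i n)))
      rw [entry_incl, entry_incl, apply_ite s.hom, map_zero] }

lemma toSeifertMap_toFox (s : Hom D E) (m : D.Cov) :
    covMap (SeifertModule.foxHom (toSeifertMap s)) (covMap (SeifertModule.toFox D) m)
      = covMap (SeifertModule.toFox E) (covMap s m) := by
  rw [← LinearMap.comp_apply, ← LinearMap.comp_apply (covMap (SeifertModule.toFox E)),
    ← covMap_comp, ← covMap_comp]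
  have h : (SeifertModule.foxHom (toSeifertMap s)).comp (SeifertModule.toFox D)
      = (SeifertModule.toFox E).comp s := by
    have : ((SeifertModule.foxHom (toSeifertMap s)).comp (SeifertModule.toFox D)).hom
        = ((SeifertModule.toFox E).comp s).hom := LinearMap.ext fun x => shift_ext fun j => by
      change s.hom (D.entry none j ((D.toShift none).hom x))
        = E.entry none j ((E.toShift none).hom (s.hom x))
      rw [entry_toShift, entry_toShift]
      simp only [reduceCtorEq, if_false, sub_zero]
      exact s.comm j x
    cases h1 : (SeifertModule.foxHom (toSeifertMap s)).comp (SeifertModule.toFox D)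
    cases h2 : (SeifertModule.toFox E).comp s
    rw [h1, h2] at this
    congr
  rw [h]

/-- Every extension of coverings is the covering of an extension. -/
lemma exists_extension {D' D'' : FoxModule A μ} (hD' : D'.IsFGProj) (hD'' : D''.IsFGProj)
    {M : Type u} [AddCommGroup M] [Module (GroupRing A μ) M] (i : D'.Cov →ₗ[GroupRing A μ] M)
    (p : M →ₗ[GroupRing A μ] D''.Cov) (hi : Function.Injective i) (hip : Function.Exact i p)
    (hp : Function.Surjective p) :
    ∃ (E D : FoxModule A μ) (t : Hom D' E) (j : Hom E D) (q : Hom D D'')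
      (b : D.Cov ≃ₗ[GroupRing A μ] M), E.IsFGProj ∧ D.IsFGProj ∧ t.IsCovEquiv ∧
        Function.Injective j.hom ∧ Function.Exact j.hom q.hom ∧ Function.Surjective q.hom ∧
        (∀ x, b (covMap j (covMap t x)) = i x) ∧ ∀ y, covMap q y = p (b y) := by
  have := hD''.1
  have := hD''.2
  obtain ⟨Λ, hΛ⟩ := Induced.exists_lift p hp (LinearMap.range D''.pres).mkQ
  have hker : ∀ y, Λ (D''.pres y) ∈ LinearMap.range i := fun y => by
    refine (hip _).1 ?_
    rw [← LinearMap.comp_apply, hΛ]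
    exact (Submodule.Quotient.mk_eq_zero _).2 ⟨y, rfl⟩
  let ie := LinearEquiv.ofInjective i hi
  -- The obstruction to splitting the extension by `Λ`: it measures the failure of `Λ` to satisfy
  -- the relations of `D''.Cov`, and takes its values in `D'.Cov`.
  let Θ : Induced μ D''.N →ₗ[GroupRing A μ] D'.Cov :=
    ie.symm.toLinearMap ∘ₗ (Λ ∘ₗ D''.pres).codRestrict (LinearMap.range i) hker
  have hΘ : ∀ y, i (Θ y) = Λ (D''.pres y) := fun y =>
    congrArg Subtype.val (ie.apply_symm_apply ⟨_, hker y⟩)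
  obtain ⟨E, t, a, hE, ht, hta⟩ := exists_isCovEquiv_lift hD' Θ
  have := hE.1
  have := hE.2
  let i' : E.Cov →ₗ[GroupRing A μ] M := i ∘ₗ ht.equiv.symm.toLinearMap
  have hi't : ∀ x, i' (covMap t x) = i x := fun x => congrArg i (ht.equiv.symm_apply_apply x)
  have hi'a : ∀ x, i' (E.cls (a x)) = Λ (Induced.single 1 x)
      - ∑ k, (1 - grp A (FreeGroup.of k)) • Λ (Induced.single 1 (D''.δ k x)) := fun x => by
    rw [← hta, hi't, hΘ, pres_single, map_sub, map_sum]
    refine congrArg _ (Finset.sum_congr rfl fun k _ => ?_)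
    rw [sub_smul, one_smul, map_sub, ← map_smul, Induced.grp_smul_single, mul_one, one_mul]
  -- Once the obstruction is represented by `a`, in `M` one has `Λ y = ∑ (1 - z_k) (δ_k (a y) + Λ
  -- (δ_k y))`; this dictates the off-diagonal entry `δ_k a`.
  let D : FoxModule A μ := ⟨ModuleCat.of A (E.N × D''.N), fun k =>
    ((E.δ k ∘ₗ LinearMap.fst A E.N D''.N + E.δ k ∘ₗ a ∘ₗ LinearMap.snd A E.N D''.N).prod
      (D''.δ k ∘ₗ LinearMap.snd A E.N D''.N) : E.N × D''.N →ₗ[A] E.N × D''.N)⟩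
  let j : Hom E D := ⟨LinearMap.inl A E.N D''.N, fun k x => by
    change ((E.δ k x, 0) : E.N × D''.N) = (E.δ k x + E.δ k (a 0), D''.δ k 0)
    rw [map_zero, map_zero, map_zero, add_zero]⟩
  let q : Hom D D'' := ⟨LinearMap.snd A E.N D''.N, fun k x => rfl⟩
  have hjq := covMap_shortExact (s := j) (t := q) LinearMap.inl_injective
    (Function.Exact.inl_snd : Function.Exact (LinearMap.inl A E.N D''.N) (LinearMap.snd A E.N D''.N))
    LinearMap.snd_surjective
  let ψ₀ : D.N →+ M := ((i'.toAddMonoidHom.comp E.cls).comp (AddMonoidHom.fst E.N D''.N)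
    + (Λ.toAddMonoidHom.comp (Induced.singleHom 1)).comp (AddMonoidHom.snd E.N D''.N))
  have hψ₀ : ∀ (x : E.N) (y : D''.N), ψ₀ ((x, y) : E.N × D''.N)
      = i' (E.cls x) + Λ (Induced.single 1 y) := fun _ _ => rfl
  let ψ : D.Cov →ₗ[GroupRing A μ] M := D.covLift ψ₀
    (fun c ⟨x, y⟩ => by
      change i' (E.cls (c • x)) + Λ (Induced.single 1 (c • y)) = _ • (i' (E.cls x) + Λ _)
      rw [cls_const_smul, map_smul, ← Induced.const_smul_single, map_smul, smul_add]; rfl)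
    (fun ⟨x, y⟩ => by
      change i' (E.cls x) + Λ (Induced.single 1 y) = ∑ k, _ •
        (i' (E.cls (E.δ k x + E.δ k (a y))) + Λ (Induced.single 1 (D''.δ k y)))
      simp only [map_add, smul_add, Finset.sum_add_distrib, ← map_smul i', ← map_sum i']
      rw [← E.cls_eq, ← E.cls_eq, hi'a, add_assoc, sub_add_cancel])
  have hψj : ∀ x, ψ (covMap j x) = i' x := by
    have h : ψ ∘ₗ covMap j = i' := E.cov_hom_ext fun x => by
      rw [LinearMap.comp_apply, covMap_cls]
      refine (D.covLift_cls _ _ _ _).trans ?_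
      change i' (E.cls x) + Λ (Induced.single 1 0) = _
      rw [Induced.single_zero, map_zero, add_zero]
    exact LinearMap.congr_fun h
  have hpi' : ∀ x, p (i' x) = 0 := fun x => hip.apply_apply_eq_zero _
  have hqψ : ∀ y, covMap q y = p (ψ y) := by
    have h : covMap q = p ∘ₗ ψ := D.cov_hom_ext fun ⟨x, y⟩ => by
      rw [LinearMap.comp_apply, covMap_cls]
      refine Eq.trans ?_ (congrArg p (D.covLift_cls ψ₀ _ _ _)).symm
      rw [hψ₀, map_add, hpi', zero_add, ← LinearMap.comp_apply, hΛ]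
      rfl
    exact LinearMap.congr_fun h
  have hi' : Function.Injective i' := hi.comp ht.equiv.symm.injective
  have hψ : Function.Bijective ψ := by
    constructor
    · rw [injective_iff_map_eq_zero]
      intro y hy
      obtain ⟨x, rfl⟩ := (hjq.2.1 y).1 (by rw [hqψ, hy, map_zero])
      rw [hψj] at hy
      rw [(injective_iff_map_eq_zero i').1 hi' x hy, map_zero]
    · intro m
      obtain ⟨y, hy⟩ := hjq.2.2 (p m)
      obtain ⟨x, hx⟩ := (hip (m - ψ y)).1 (by rw [map_sub, ← hqψ, hy, sub_self])
      refine ⟨covMap j (covMap t x) + y, ?_⟩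
      rw [map_add, hψj, hi't, hx, sub_add_cancel]
  refine ⟨E, D, t, j, q, LinearEquiv.ofBijective ψ hψ, hE, ?_, ht, LinearMap.inl_injective,
    Function.Exact.inl_snd, LinearMap.snd_surjective, fun x => (hψj _).trans (hi't x), hqψ⟩
  exact ⟨inferInstanceAs (Module.Finite A (E.N × D''.N)),
    inferInstanceAs (Module.Projective A (E.N × D''.N))⟩

end FoxModule

/-- The covering functor preserves short exact sequences. -/
lemma seiCovering_shortExact {U V W : Sei A μ} {j : U ⟶ V} {q : V ⟶ W}
    (h : seiShortExact A μ j q) :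
    Function.Injective ((seiCovering A μ).map j).hom ∧
      Function.Exact ((seiCovering A μ).map j).hom ((seiCovering A μ).map q).hom ∧
        Function.Surjective ((seiCovering A μ).map q).hom := by
  obtain ⟨h1, h2, h3⟩ := FoxModule.covMap_shortExact (s := SeifertModule.foxHom j.hom)
    (t := SeifertModule.foxHom q.hom) h.1 h.2.1 h.2.2
  have hj : ∀ m, V.obj.covEquiv (((seiCovering A μ).map j).hom m)
      = FoxModule.covMap (SeifertModule.foxHom j.hom) (U.obj.covEquiv m) :=
    SeifertModule.covEquiv_naturality j.hom
  have hq : ∀ m, W.obj.covEquiv (((seiCovering A μ).map q).hom m)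
      = FoxModule.covMap (SeifertModule.foxHom q.hom) (V.obj.covEquiv m) :=
    SeifertModule.covEquiv_naturality q.hom
  refine ⟨fun x y hxy => ?_, fun m => ?_, fun m => ?_⟩
  · exact U.obj.covEquiv.injective (h1 (by rw [← hj, ← hj, hxy]))
  · rw [← LinearEquiv.map_eq_zero_iff W.obj.covEquiv, hq, h2]
    constructor
    · rintro ⟨x, hx⟩
      refine ⟨U.obj.covEquiv.symm x, V.obj.covEquiv.injective ?_⟩
      rw [hj, LinearEquiv.apply_symm_apply, hx]
    · rintro ⟨x, rfl⟩
      exact ⟨_, (hj x).symm⟩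
  · obtain ⟨y, hy⟩ := h3 (W.obj.covEquiv m)
    refine ⟨V.obj.covEquiv.symm y, W.obj.covEquiv.injective ?_⟩
    rw [hq, LinearEquiv.apply_symm_apply, hy]

/-- Every extension of link modules is isomorphic to the covering of a short exact sequence of
f.g. projective Seifert modules. -/
lemma exists_seiShortExact {M' M M'' : ModuleCat.{u} (GroupRing A μ)} (hM' : isFlk A μ M')
    (hM'' : isFlk A μ M'') (i : M' →ₗ[GroupRing A μ] M) (p : M →ₗ[GroupRing A μ] M'')
    (hi : Function.Injective i) (hip : Function.Exact i p) (hp : Function.Surjective p) :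
    ∃ (U V W : Sei A μ) (j : U ⟶ V) (q : V ⟶ W)
      (a : (seiCovering A μ).obj U ≃ₗ[GroupRing A μ] M')
      (b : (seiCovering A μ).obj V ≃ₗ[GroupRing A μ] M)
      (c : (seiCovering A μ).obj W ≃ₗ[GroupRing A μ] M''),
      seiShortExact A μ j q ∧ (∀ x, b (((seiCovering A μ).map j).hom x) = i (a x)) ∧
        ∀ y, c (((seiCovering A μ).map q).hom y) = p (b y) := by
  obtain ⟨D', hD', ⟨e'⟩⟩ := exists_cov_equiv hM'
  obtain ⟨D'', hD'', ⟨e''⟩⟩ := exists_cov_equiv hM''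
  obtain ⟨E, D, t, j, q, b, hE, hD, ht, hj, hjq, hq, hbi, hbp⟩ := FoxModule.exists_extension
    hD' hD'' (i ∘ₗ e'.toLinearMap) (e''.symm.toLinearMap ∘ₗ p) (hi.comp e'.injective)
    (fun m => by
      refine (LinearEquiv.map_eq_zero_iff e''.symm).trans ((hip m).trans ?_)
      exact ⟨fun ⟨x, hx⟩ => ⟨e'.symm x, by
        rw [LinearMap.comp_apply, LinearEquiv.coe_coe, LinearEquiv.apply_symm_apply, hx]⟩,
        fun ⟨x, hx⟩ => ⟨_, hx⟩⟩)
    (e''.symm.surjective.comp hp)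
  have hfox : ∀ {X Y : FoxModule A μ} (s : FoxModule.Hom X Y) (m),
      (SeifertModule.toFox_isCovEquiv Y).equiv.symm (Y.toSeifert.covEquiv
        (((SeifertModule.covering A μ).map (FoxModule.toSeifertMap s)).hom m))
      = FoxModule.covMap s ((SeifertModule.toFox_isCovEquiv X).equiv.symm
        (X.toSeifert.covEquiv m)) := fun {X Y} s m => by
    rw [LinearEquiv.symm_apply_eq, SeifertModule.covEquiv_naturality]
    obtain ⟨y, hy⟩ := (SeifertModule.toFox_isCovEquiv X).equiv.surjective (X.toSeifert.covEquiv m)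
    rw [← hy, LinearEquiv.symm_apply_apply]
    exact FoxModule.toSeifertMap_toFox s y
  refine ⟨toSei hE, toSei hD, toSei hD'', ⟨FoxModule.toSeifertMap j⟩, ⟨FoxModule.toSeifertMap q⟩,
    E.toSeifert.covEquiv.trans ((SeifertModule.toFox_isCovEquiv E).equiv.symm.trans
      (ht.equiv.symm.trans e')),
    D.toSeifert.covEquiv.trans ((SeifertModule.toFox_isCovEquiv D).equiv.symm.trans b),
    D''.toSeifert.covEquiv.trans ((SeifertModule.toFox_isCovEquiv D'').equiv.symm.trans e''),
    ⟨?_, ?_, ?_⟩, fun x => ?_, fun y => ?_⟩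
  · exact fun m n h => funext fun k => hj (congrFun h k)
  · intro m
    constructor
    · intro h
      choose x hx using fun k => (hjq (m k)).1 (congrFun h k)
      exact ⟨x, funext hx⟩
    · rintro ⟨x, rfl⟩
      exact funext fun k => hjq.apply_apply_eq_zero _
  · intro m
    choose x hx using fun k => hq (m k)
    exact ⟨x, funext hx⟩
  · have h : ∀ m, b (FoxModule.covMap j m) = i (e' (ht.equiv.symm m)) := fun m => by
      obtain ⟨y, rfl⟩ := ht.equiv.surjective m
      rw [LinearEquiv.symm_apply_apply]
      exact hbi y
    exact (congrArg b (hfox j x)).trans (h _)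
  · refine (congrArg e'' ((hfox q y).trans (hbp _))).trans ?_
    exact e''.apply_symm_apply _

/-- The link modules are closed under extensions. -/
lemma isFlk_of_extension {M' M M'' : ModuleCat.{u} (GroupRing A μ)} (hM' : isFlk A μ M')
    (hM'' : isFlk A μ M'') (i : M' →ₗ[GroupRing A μ] M) (p : M →ₗ[GroupRing A μ] M'')
    (hi : Function.Injective i) (hip : Function.Exact i p) (hp : Function.Surjective p) :
    isFlk A μ M := by
  obtain ⟨U, V, W, j, q, a, b, c, h⟩ := exists_seiShortExact hM' hM'' i p hi hip hp
  exact FoxModule.isFlk_of_cov (isFGProj_fox V) (V.obj.covEquiv.symm.trans b)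

end ShortExactCoverings

/-! ### Extension closed classes of modules are exact categories -/

section ModuleExact

section Factor

variable {R : Type u} [Ring R] {K L M N : Type*} [AddCommGroup K] [AddCommGroup L]
  [AddCommGroup M] [AddCommGroup N] [Module R K] [Module R L] [Module R M] [Module R N]

lemma exists_factor_of_injective {f : M →ₗ[R] N} (hf : Function.Injective f) (g : L →ₗ[R] N)
    (hg : ∀ x, ∃ y, f y = g x) : ∃ h : L →ₗ[R] M, ∀ x, f (h x) = g x :=
  ⟨(LinearEquiv.ofInjective f hf).symm.toLinearMap ∘ₗ g.codRestrict (LinearMap.range f) hg,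
    fun x => congrArg Subtype.val ((LinearEquiv.ofInjective f hf).apply_symm_apply ⟨g x, hg x⟩)⟩

lemma exists_factor_of_surjective {f : M →ₗ[R] N} (hf : Function.Surjective f) (g : M →ₗ[R] L)
    (hg : ∀ x, f x = 0 → g x = 0) : ∃ h : N →ₗ[R] L, ∀ x, h (f x) = g x :=
  ⟨(LinearMap.ker f).liftQ g hg ∘ₗ (f.quotKerEquivOfSurjective hf).symm.toLinearMap, fun x => by
    rw [LinearMap.comp_apply, LinearEquiv.coe_coe,
      show f x = f.quotKerEquivOfSurjective hf ((LinearMap.ker f).mkQ x) from rfl,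
      LinearEquiv.symm_apply_apply]
    rfl⟩

end Factor

variable {R : Type u} [Ring R] {P : ObjectProperty (ModuleCat.{u} R)}

/-- The morphism of a full subcategory given by a linear map. -/
abbrev ofLinearMap {X Y : P.FullSubcategory} (f : X.obj →ₗ[R] Y.obj) : X ⟶ Y := ⟨ModuleCat.ofHom f⟩

lemma fullSubcategory_hom_ext {X Y : P.FullSubcategory} {f g : X ⟶ Y}
    (h : ∀ x, f.hom.hom x = g.hom.hom x) : f = g :=
  InducedCategory.Hom.ext (ModuleCat.hom_ext (LinearMap.ext h))

lemma fullSubcategory_congr {X Y : P.FullSubcategory} {f g : X ⟶ Y} (h : f = g) (x : X.obj) :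
    f.hom.hom x = g.hom.hom x := by rw [h]

variable (P) in
/-- The short exact sequences of modules in a class of modules. -/
def moduleShortExact : PairClass P.FullSubcategory := fun _ _ _ i p =>
  Function.Injective i.hom.hom ∧ Function.Exact i.hom.hom p.hom.hom ∧
    Function.Surjective p.hom.hom

lemma exists_kernel_lift {W X Y Z : P.FullSubcategory} {i : X ⟶ Y} {p : Y ⟶ Z}
    (h : moduleShortExact P i p) (g : W ⟶ Y) (hg : g ≫ p = 0) : ∃ l : W ⟶ X, l ≫ i = g := by
  obtain ⟨l, hl⟩ := exists_factor_of_injective h.1 g.hom.hom fun x =>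
    (h.2.1 _).1 (fullSubcategory_congr hg x)
  exact ⟨ofLinearMap l, fullSubcategory_hom_ext hl⟩

lemma exists_cokernel_desc {W X Y Z : P.FullSubcategory} {i : X ⟶ Y} {p : Y ⟶ Z}
    (h : moduleShortExact P i p) (g : Y ⟶ W) (hg : i ≫ g = 0) : ∃ l : Z ⟶ W, p ≫ l = g := by
  obtain ⟨l, hl⟩ := exists_factor_of_surjective h.2.2 g.hom.hom fun x hx => by
    obtain ⟨y, rfl⟩ := (h.2.1 x).1 hx
    exact fullSubcategory_congr hg y
  exact ⟨ofLinearMap l, fullSubcategory_hom_ext hl⟩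

lemma cancel_of_injective {W X Y : P.FullSubcategory} {i : X ⟶ Y}
    (h : Function.Injective i.hom.hom) {f g : W ⟶ X} (hfg : f ≫ i = g ≫ i) : f = g :=
  fullSubcategory_hom_ext fun x => h (fullSubcategory_congr hfg x)

lemma cancel_of_surjective {W Y Z : P.FullSubcategory} {p : Y ⟶ Z}
    (h : Function.Surjective p.hom.hom) {f g : Z ⟶ W} (hfg : p ≫ f = p ≫ g) : f = g :=
  fullSubcategory_hom_ext fun x => by
    obtain ⟨y, rfl⟩ := h x
    exact fullSubcategory_congr hfg y

lemma moduleShortExact_isKernelCokernel {X Y Z : P.FullSubcategory} {i : X ⟶ Y} {p : Y ⟶ Z}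
    (h : moduleShortExact P i p) : ∃ h : i ≫ p = 0, Nonempty (IsLimit (KernelFork.ofι i h)) ∧
      Nonempty (IsColimit (CokernelCofork.ofπ p h)) := by
  refine ⟨fullSubcategory_hom_ext fun x => h.2.1.apply_apply_eq_zero x, ⟨?_⟩, ⟨?_⟩⟩
  · exact KernelFork.IsLimit.ofι _ _ (fun g hg => (exists_kernel_lift h g hg).choose)
      (fun g hg => (exists_kernel_lift h g hg).choose_spec) (fun g hg m hm =>
        cancel_of_injective h.1 (hm.trans (exists_kernel_lift h g hg).choose_spec.symm))
  · exact CokernelCofork.IsColimit.ofπ _ _ (fun g hg => (exists_cokernel_desc h g hg).choose)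
      (fun g hg => (exists_cokernel_desc h g hg).choose_spec) (fun g hg m hm =>
        cancel_of_surjective h.2.2 (hm.trans (exists_cokernel_desc h g hg).choose_spec.symm))

lemma moduleShortExact_of_iso {X Y Z X' Y' Z' : P.FullSubcategory} {i : X ⟶ Y} {p : Y ⟶ Z}
    {i' : X' ⟶ Y'} {p' : Y' ⟶ Z'} (a : X ≅ X') (b : Y ≅ Y') (c : Z ≅ Z')
    (hi : i ≫ b.hom = a.hom ≫ i') (hp : p ≫ c.hom = b.hom ≫ p') (h : moduleShortExact P i p) :
    moduleShortExact P i' p' := by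
  have ha : ∀ {U V : P.FullSubcategory} (e : U ≅ V) x, e.hom.hom.hom (e.inv.hom.hom x) = x :=
    fun e x => fullSubcategory_congr e.inv_hom_id x
  have ha' : ∀ {U V : P.FullSubcategory} (e : U ≅ V) x, e.inv.hom.hom (e.hom.hom.hom x) = x :=
    fun e x => fullSubcategory_congr e.hom_inv_id x
  have hi1 : ∀ x, b.hom.hom.hom (i.hom.hom x) = i'.hom.hom (a.hom.hom.hom x) :=
    fun x => fullSubcategory_congr hi x
  have hp1 : ∀ x, c.hom.hom.hom (p.hom.hom x) = p'.hom.hom (b.hom.hom.hom x) :=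
    fun x => fullSubcategory_congr hp x
  refine ⟨?_, fun y => ⟨fun hy => ?_, ?_⟩, fun z => ?_⟩
  · rw [injective_iff_map_eq_zero]
    intro x hx
    rw [← ha a x, ← hi1] at hx
    have h1 := congrArg b.inv.hom.hom hx
    rw [ha', map_zero, map_eq_zero_iff _ h.1] at h1
    rw [← ha a x, h1, map_zero]
  · rw [← ha b y, ← hp1] at hy
    have h1 := congrArg c.inv.hom.hom hy
    rw [ha', map_zero] at h1
    obtain ⟨x, hx⟩ := (h.2.1 _).1 h1
    exact ⟨a.hom.hom.hom x, by rw [← hi1, hx, ha]⟩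
  · rintro ⟨x, rfl⟩
    rw [← ha a x, ← hi1, ← hp1, h.2.1.apply_apply_eq_zero, map_zero]
  · obtain ⟨y, hy⟩ := h.2.2 (c.inv.hom.hom z)
    exact ⟨b.hom.hom.hom y, by rw [← hp1, hy, ha]⟩

/-- A class of modules is closed under extensions. -/
def IsExtensionClosed (P : ObjectProperty (ModuleCat.{u} R)) : Prop :=
  ∀ {M' M M'' : ModuleCat.{u} R}, P M' → P M'' → ∀ (i : M' →ₗ[R] M) (p : M →ₗ[R] M''),
    Function.Injective i → Function.Exact i p → Function.Surjective p → P M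

lemma exists_moduleShortExact_id (h0 : ∀ M : ModuleCat.{u} R, Subsingleton M → P M)
    (X : P.FullSubcategory) :
    IsInflation (moduleShortExact P) (𝟙 X) ∧ IsDeflation (moduleShortExact P) (𝟙 X) := by
  let Z : P.FullSubcategory := ⟨ModuleCat.of R PUnit.{u + 1},
    h0 _ (inferInstanceAs (Subsingleton PUnit))⟩
  have hZ : Subsingleton Z.obj := inferInstanceAs (Subsingleton PUnit.{u + 1})
  refine ⟨⟨Z, 0, Function.injective_id, fun x => ⟨fun _ => ⟨x, rfl⟩, fun _ => Subsingleton.elim _ _⟩,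
    fun z => ⟨0, Subsingleton.elim _ _⟩⟩, ⟨Z, 0, fun _ _ _ => Subsingleton.elim _ _,
      fun x => ⟨fun hx => ⟨0, ?_⟩, ?_⟩, Function.surjective_id⟩⟩
  · exact (map_zero _).trans (Eq.symm hx)
  · rintro ⟨z, rfl⟩
    rfl

/-- The cokernel of the composite is an extension of the cokernel of `j` by the cokernel of `i`. -/
lemma comp_inflation_of_isExtensionClosed (hext : IsExtensionClosed P) {X Y W : P.FullSubcategory}
    {i : X ⟶ Y} {j : Y ⟶ W} (hi : IsInflation (moduleShortExact P) i)
    (hj : IsInflation (moduleShortExact P) j) : IsInflation (moduleShortExact P) (i ≫ j) := by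
  obtain ⟨Z₀, p₀, hi1, hi2, hi3⟩ := hi
  obtain ⟨Z₁, p₁, hj1, hj2, hj3⟩ := hj
  let S : Submodule R W.obj := LinearMap.range (j.hom.hom ∘ₗ i.hom.hom)
  obtain ⟨α, hα⟩ := exists_factor_of_surjective hi3 (S.mkQ ∘ₗ j.hom.hom) fun y hy => by
    obtain ⟨x, rfl⟩ := (hi2 y).1 hy
    exact (Submodule.Quotient.mk_eq_zero _).2 ⟨x, rfl⟩
  obtain ⟨β, hβ⟩ := exists_factor_of_surjective S.mkQ_surjective p₁.hom.hom fun w hw => by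
    obtain ⟨x, rfl⟩ := (Submodule.Quotient.mk_eq_zero _).1 hw
    exact hj2.apply_apply_eq_zero _
  have hQ : P (ModuleCat.of R (W.obj ⧸ S)) := by
    refine hext (M := ModuleCat.of R (W.obj ⧸ S)) Z₀.property Z₁.property α β ?_ (fun w => ?_)
      (fun z => ?_)
    · rw [injective_iff_map_eq_zero]
      intro z hz
      obtain ⟨y, rfl⟩ := hi3 z
      rw [hα] at hz
      obtain ⟨x, hx⟩ := (Submodule.Quotient.mk_eq_zero _).1 hz
      rw [← hj1 hx]
      exact hi2.apply_apply_eq_zero x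
    · obtain ⟨w, rfl⟩ := S.mkQ_surjective w
      rw [hβ]
      constructor
      · intro hw
        obtain ⟨y, rfl⟩ := (hj2 w).1 hw
        exact ⟨_, hα y⟩
      · rintro ⟨z, hz⟩
        obtain ⟨y, rfl⟩ := hi3 z
        rw [hα] at hz
        rw [← hβ, ← hz]
        exact (hβ _).trans (hj2.apply_apply_eq_zero y)
    · obtain ⟨w, rfl⟩ := hj3 z
      exact ⟨_, hβ w⟩
  refine ⟨⟨_, hQ⟩, ofLinearMap S.mkQ, hj1.comp hi1, fun w => ?_, S.mkQ_surjective⟩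
  exact Submodule.Quotient.mk_eq_zero _

/-- The kernel of the composite is an extension of the kernel of `q` by the kernel of `p`. -/
lemma comp_deflation_of_isExtensionClosed (hext : IsExtensionClosed P) {X Y Z : P.FullSubcategory}
    {p : X ⟶ Y} {q : Y ⟶ Z} (hp : IsDeflation (moduleShortExact P) p)
    (hq : IsDeflation (moduleShortExact P) q) : IsDeflation (moduleShortExact P) (p ≫ q) := by
  obtain ⟨K, i, hp1, hp2, hp3⟩ := hp
  obtain ⟨L, j, hq1, hq2, hq3⟩ := hq
  let S : Submodule R X.obj := LinearMap.ker (q.hom.hom ∘ₗ p.hom.hom)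
  let α : K.obj →ₗ[R] S := i.hom.hom.codRestrict S fun k => by
    change q.hom.hom (p.hom.hom (i.hom.hom k)) = 0
    rw [hp2.apply_apply_eq_zero, map_zero]
  obtain ⟨β, hβ⟩ := exists_factor_of_injective hq1 (p.hom.hom ∘ₗ S.subtype) fun x =>
    (hq2 _).1 x.2
  have hS : P (ModuleCat.of R S) := by
    refine hext (M := ModuleCat.of R S) K.property L.property α β
      (fun x y h => hp1 (congrArg Subtype.val h)) (fun x => ?_) (fun l => ?_)
    · rw [← map_eq_zero_iff _ hq1, hβ]
      refine (hp2 x.1).trans ⟨fun ⟨k, hk⟩ => ⟨k, Subtype.ext hk⟩, fun ⟨k, hk⟩ => ⟨k, ?_⟩⟩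
      exact congrArg Subtype.val hk
    · obtain ⟨x, hx⟩ := hp3 (j.hom.hom l)
      refine ⟨⟨x, ?_⟩, hq1 ?_⟩
      · change q.hom.hom (p.hom.hom x) = 0
        rw [hx, hq2.apply_apply_eq_zero]
      · rw [hβ]
        exact hx
  refine ⟨⟨_, hS⟩, ofLinearMap S.subtype, Subtype.val_injective, fun x => ?_, hq3.comp hp3⟩
  exact ⟨fun hx => ⟨⟨x, hx⟩, rfl⟩, fun ⟨y, hy⟩ => hy ▸ y.2⟩

/-- The pushout of modules has the same cokernel as `i`, so it is an extension of that cokernel by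
`X'`. -/
lemma exists_pushout_of_isExtensionClosed (hext : IsExtensionClosed P) {X Y X' : P.FullSubcategory}
    (i : X ⟶ Y) (f : X ⟶ X') (hi : IsInflation (moduleShortExact P) i) :
    ∃ (Y' : P.FullSubcategory) (f' : Y ⟶ Y') (i' : X' ⟶ Y'),
      IsPushout i f f' i' ∧ IsInflation (moduleShortExact P) i' := by
  obtain ⟨Z, p, h1, h2, h3⟩ := hi
  let S : Submodule R (X'.obj × Y.obj) := LinearMap.range (f.hom.hom.prod (-i.hom.hom))
  let i' : X'.obj →ₗ[R] (X'.obj × Y.obj) ⧸ S := S.mkQ ∘ₗ LinearMap.inl R X'.obj Y.obj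
  let f' : Y.obj →ₗ[R] (X'.obj × Y.obj) ⧸ S := S.mkQ ∘ₗ LinearMap.inr R X'.obj Y.obj
  have hw : ∀ x, f' (i.hom.hom x) = i' (f.hom.hom x) := fun x => by
    refine (Submodule.Quotient.eq S).2 ⟨-x, ?_⟩
    simp
  have hsum : ∀ x y, S.mkQ (x, y) = i' x + f' y := fun x y => by
    change _ = S.mkQ (x, 0) + S.mkQ (0, y)
    rw [← map_add, Prod.mk_add_mk, add_zero, zero_add]
  obtain ⟨p', hp'⟩ := exists_factor_of_surjective S.mkQ_surjective
      (p.hom.hom ∘ₗ LinearMap.snd R X'.obj Y.obj) fun w hw => by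
    obtain ⟨x, rfl⟩ := (Submodule.Quotient.mk_eq_zero _).1 hw
    change p.hom.hom (-i.hom.hom x) = 0
    rw [map_neg, h2.apply_apply_eq_zero, neg_zero]
  have hi' : Function.Injective i' := by
    rw [injective_iff_map_eq_zero]
    intro x' hx'
    obtain ⟨x, hx⟩ := (Submodule.Quotient.mk_eq_zero _).1 hx'
    have hx1 : f.hom.hom x = x' := congrArg Prod.fst hx
    have hx2 : -i.hom.hom x = 0 := congrArg Prod.snd hx
    rw [neg_eq_zero, map_eq_zero_iff _ h1] at hx2
    rw [← hx1, hx2, map_zero]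
  have hi'p' : Function.Exact i' p' := fun w => by
    obtain ⟨⟨x', y⟩, rfl⟩ := S.mkQ_surjective w
    rw [hp']
    constructor
    · intro hy
      obtain ⟨x, rfl⟩ := (h2 y).1 hy
      exact ⟨x' + f.hom.hom x, by rw [hsum, hw, map_add]⟩
    · rintro ⟨x, hx⟩
      rw [← hp', ← hx]
      exact (hp' _).trans (map_zero p.hom.hom)
  have hp's : Function.Surjective p' := fun z => by
    obtain ⟨y, rfl⟩ := h3 z
    exact ⟨_, hp' (0, y)⟩
  have hQ : P (ModuleCat.of R ((X'.obj × Y.obj) ⧸ S)) :=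
    hext (M := ModuleCat.of R ((X'.obj × Y.obj) ⧸ S)) X'.property Z.property i' p' hi' hi'p' hp's
  refine ⟨⟨_, hQ⟩, ofLinearMap f', ofLinearMap i', ⟨⟨fullSubcategory_hom_ext hw⟩, ⟨?_⟩⟩,
    ⟨Z, ofLinearMap p', hi', hi'p', hp's⟩⟩
  have hdesc : ∀ s : PushoutCocone i f, ∃ l : ((X'.obj × Y.obj) ⧸ S) →ₗ[R] s.pt.obj,
      ∀ w, l (S.mkQ w) = s.inr.hom.hom w.1 + s.inl.hom.hom w.2 := fun s =>
    exists_factor_of_surjective S.mkQ_surjective (s.inr.hom.hom.coprod s.inl.hom.hom)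
      fun w hw => by
        obtain ⟨x, rfl⟩ := (Submodule.Quotient.mk_eq_zero _).1 hw
        change s.inr.hom.hom (f.hom.hom x) + s.inl.hom.hom (-i.hom.hom x) = 0
        rw [map_neg, add_neg_eq_zero]
        exact (fullSubcategory_congr s.condition x).symm
  refine PushoutCocone.IsColimit.mk _ (fun s => ofLinearMap (hdesc s).choose)
    (fun s => fullSubcategory_hom_ext fun y => ?_) (fun s => fullSubcategory_hom_ext fun x => ?_)
    (fun s m hm1 hm2 => fullSubcategory_hom_ext fun w => ?_)
  · refine ((hdesc s).choose_spec (0, y)).trans ?_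
    rw [map_zero, zero_add]
  · refine ((hdesc s).choose_spec (x, 0)).trans ?_
    rw [map_zero, add_zero]
  · obtain ⟨⟨x, y⟩, rfl⟩ := S.mkQ_surjective w
    refine Eq.trans ?_ ((hdesc s).choose_spec (x, y)).symm
    rw [hsum]
    refine (map_add m.hom.hom _ _).trans ?_
    rw [← hm1, ← hm2]
    rfl

/-- The pullback of modules has the same kernel as `p`, so it is an extension of `Z'` by that
kernel. -/
lemma exists_pullback_of_isExtensionClosed (hext : IsExtensionClosed P)
    {Y Z Z' : P.FullSubcategory} (p : Y ⟶ Z) (f : Z' ⟶ Z)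
    (hp : IsDeflation (moduleShortExact P) p) :
    ∃ (Y' : P.FullSubcategory) (f' : Y' ⟶ Y) (p' : Y' ⟶ Z'),
      IsPullback f' p' p f ∧ IsDeflation (moduleShortExact P) p' := by
  obtain ⟨X, i, h1, h2, h3⟩ := hp
  let S : Submodule R (Y.obj × Z'.obj) := LinearMap.ker
    (p.hom.hom ∘ₗ LinearMap.fst R Y.obj Z'.obj - f.hom.hom ∘ₗ LinearMap.snd R Y.obj Z'.obj)
  have hS : ∀ w : Y.obj × Z'.obj, w ∈ S ↔ p.hom.hom w.1 = f.hom.hom w.2 := fun w => by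
    rw [LinearMap.mem_ker, LinearMap.sub_apply, sub_eq_zero]
    rfl
  let f' : S →ₗ[R] Y.obj := LinearMap.fst R Y.obj Z'.obj ∘ₗ S.subtype
  let p' : S →ₗ[R] Z'.obj := LinearMap.snd R Y.obj Z'.obj ∘ₗ S.subtype
  let i' : X.obj →ₗ[R] S := (LinearMap.inl R Y.obj Z'.obj ∘ₗ i.hom.hom).codRestrict S fun x => by
    rw [hS]
    change p.hom.hom (i.hom.hom x) = f.hom.hom 0
    rw [h2.apply_apply_eq_zero, map_zero]
  have hi' : Function.Injective i' := fun x y h =>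
    h1 (congrArg (fun w : S => w.1.1) h)
  have hi'p' : Function.Exact i' p' := fun w => by
    constructor
    · intro hw
      have hw2 : w.1.2 = 0 := hw
      obtain ⟨x, hx⟩ := (h2 w.1.1).1 (by rw [(hS _).1 w.2, hw2, map_zero])
      exact ⟨x, Subtype.ext (Prod.ext hx hw2.symm)⟩
    · rintro ⟨x, rfl⟩
      rfl
  have hp's : Function.Surjective p' := fun z => by
    obtain ⟨y, hy⟩ := h3 (f.hom.hom z)
    exact ⟨⟨(y, z), (hS _).2 hy⟩, rfl⟩
  have hQ : P (ModuleCat.of R S) :=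
    hext (M := ModuleCat.of R S) X.property Z'.property i' p' hi' hi'p' hp's
  refine ⟨⟨_, hQ⟩, ofLinearMap f', ofLinearMap p',
    ⟨⟨fullSubcategory_hom_ext fun w => (hS _).1 w.2⟩, ⟨?_⟩⟩,
    ⟨X, ofLinearMap i', hi', hi'p', hp's⟩⟩
  refine PullbackCone.IsLimit.mk _ (fun s => ofLinearMap
    ((s.fst.hom.hom.prod s.snd.hom.hom).codRestrict S fun w => (hS _).2
      (fullSubcategory_congr s.condition w))) (fun s => rfl) (fun s => rfl)
    (fun s m hm1 hm2 => fullSubcategory_hom_ext fun w => ?_)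
  exact Subtype.ext (Prod.ext (fullSubcategory_congr hm1 w) (fullSubcategory_congr hm2 w))

lemma hasFiniteBiproducts_of_isExtensionClosed
    (h0 : ∀ M : ModuleCat.{u} R, Subsingleton M → P M) (hext : IsExtensionClosed P) :
    HasFiniteBiproducts P.FullSubcategory := by
  have hb : HasBinaryBiproducts P.FullSubcategory := ⟨fun X Y => by
    have h : P (ModuleCat.of R (X.obj × Y.obj)) :=
      hext (M := ModuleCat.of R (X.obj × Y.obj)) X.property Y.property
        (LinearMap.inl R X.obj Y.obj) (LinearMap.snd R X.obj Y.obj) LinearMap.inl_injective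
        Function.Exact.inl_snd LinearMap.snd_surjective
    let XY : P.FullSubcategory := ⟨_, h⟩
    refine hasBinaryBiproduct_of_total
      { pt := XY
        fst := ofLinearMap (X := XY) (LinearMap.fst R X.obj Y.obj)
        snd := ofLinearMap (X := XY) (LinearMap.snd R X.obj Y.obj)
        inl := ofLinearMap (Y := XY) (LinearMap.inl R X.obj Y.obj)
        inr := ofLinearMap (Y := XY) (LinearMap.inr R X.obj Y.obj)
        inl_fst := rfl
        inl_snd := rfl
        inr_fst := rfl
        inr_snd := rfl } (fullSubcategory_hom_ext fun x => ?_)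
    change ((x.1, 0) : X.obj × Y.obj) + (0, x.2) = x
    rw [Prod.mk_add_mk, add_zero, zero_add]⟩
  let Z : P.FullSubcategory := ⟨ModuleCat.of R PUnit.{u + 1},
    h0 _ (inferInstanceAs (Subsingleton PUnit))⟩
  have hZ : Subsingleton Z.obj := inferInstanceAs (Subsingleton PUnit.{u + 1})
  have : HasTerminal P.FullSubcategory := (IsTerminal.ofUniqueHom (Y := Z) (fun _ => 0)
    fun _ _ => fullSubcategory_hom_ext fun _ => Subsingleton.elim _ _).hasTerminal
  have := hasFiniteProducts_of_has_binary_and_terminal (C := P.FullSubcategory)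
  exact HasFiniteBiproducts.of_hasFiniteProducts

/-- A class of modules which is closed under extensions is an exact category. -/
lemma isExactStructure_of_isExtensionClosed
    (h0 : ∀ M : ModuleCat.{u} R, Subsingleton M → P M) (hext : IsExtensionClosed P) :
    IsExactStructure P.FullSubcategory (moduleShortExact P) where
  hasFiniteBiproducts := hasFiniteBiproducts_of_isExtensionClosed h0 hext
  isKernelCokernel _ _ _ _ _ h := moduleShortExact_isKernelCokernel h
  iso_closed _ _ _ _ _ _ _ _ _ _ a b c hi hp h := moduleShortExact_of_iso a b c hi hp h
  id_inflation X := (exists_moduleShortExact_id h0 X).1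
  id_deflation X := (exists_moduleShortExact_id h0 X).2
  comp_inflation _ _ _ _ _ hi hj := comp_inflation_of_isExtensionClosed hext hi hj
  comp_deflation _ _ _ _ _ hp hq := comp_deflation_of_isExtensionClosed hext hp hq
  pushout_inflation _ _ _ i f hi := exists_pushout_of_isExtensionClosed hext i f hi
  pullback_deflation _ _ _ p f hp := exists_pullback_of_isExtensionClosed hext p f hp

end ModuleExact

/-! ### Transport of exact structures along equivalences -/

section Transport

universe v₁ v₂ u₁ u₂

variable {C : Type u₁} {D : Type u₂} [Category.{v₁} C] [Category.{v₂} D] [Preadditive D] (F : C ⥤ D) [F.IsEquivalence] {EC : PairClass C} {ED : PairClass D}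

lemma isInflation_iff_of_equivalence (hD : IsExactStructure D ED)
    (hE : ∀ ⦃X Y Z : C⦄ (i : X ⟶ Y) (p : Y ⟶ Z), EC i p ↔ ED (F.map i) (F.map p))
    {X Y : C} (i : X ⟶ Y) : IsInflation EC i ↔ IsInflation ED (F.map i) := by
  constructor
  · rintro ⟨Z, p, h⟩
    exact ⟨_, _, (hE i p).1 h⟩
  · rintro ⟨Z, p, h⟩
    refine ⟨F.objPreimage Z, F.preimage (p ≫ (F.objObjPreimageIso Z).inv), (hE _ _).2 ?_⟩
    exact hD.iso_closed _ _ _ _ (Iso.refl _) (Iso.refl _) (F.objObjPreimageIso Z).symm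
      (by simp) (by simp) h

lemma isDeflation_iff_of_equivalence (hD : IsExactStructure D ED)
    (hE : ∀ ⦃X Y Z : C⦄ (i : X ⟶ Y) (p : Y ⟶ Z), EC i p ↔ ED (F.map i) (F.map p))
    {Y Z : C} (p : Y ⟶ Z) : IsDeflation EC p ↔ IsDeflation ED (F.map p) := by
  constructor
  · rintro ⟨X, i, h⟩
    exact ⟨_, _, (hE i p).1 h⟩
  · rintro ⟨X, i, h⟩
    refine ⟨F.objPreimage X, F.preimage ((F.objObjPreimageIso X).hom ≫ i), (hE _ _).2 ?_⟩
    exact hD.iso_closed _ _ _ _ (F.objObjPreimageIso X).symm (Iso.refl _) (Iso.refl _)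
      (by simp) (by simp) h

/-- A class of pairs of morphisms is an exact structure if an equivalence identifies it with an
exact structure. -/
lemma isExactStructure_of_equivalence [Preadditive C] [F.Additive] (hD : IsExactStructure D ED)
    (hE : ∀ ⦃X Y Z : C⦄ (i : X ⟶ Y) (p : Y ⟶ Z), EC i p ↔ ED (F.map i) (F.map p)) :
    IsExactStructure C EC where
  hasFiniteBiproducts := by
    have := hD.hasFiniteBiproducts
    have : HasFiniteProducts C := ⟨fun _ => Adjunction.hasLimitsOfShape_of_equivalence F⟩
    exact HasFiniteBiproducts.of_hasFiniteProducts
  isKernelCokernel X Y Z i p h := by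
    obtain ⟨w, ⟨hk⟩, ⟨hc⟩⟩ := hD.isKernelCokernel _ _ ((hE i p).1 h)
    have hw : i ≫ p = 0 := F.map_injective (by rw [F.map_comp, w, F.map_zero])
    have : Mono (F.map i) := Fork.IsLimit.mono hk
    have : Epi (F.map p) := Cofork.IsColimit.epi hc
    have : Mono i := F.mono_of_mono_map ‹_›
    have : Epi p := F.epi_of_epi_map ‹_›
    refine ⟨hw, ⟨?_⟩, ⟨?_⟩⟩
    · have hl : ∀ {W : C} (g : W ⟶ Y), g ≫ p = 0 → ∃ l, l ≫ i = g := fun g hg => by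
        obtain ⟨l, hl⟩ := KernelFork.IsLimit.lift' hk (F.map g)
          (by rw [← F.map_comp, hg, F.map_zero])
        exact ⟨F.preimage l, F.map_injective (by rw [F.map_comp, F.map_preimage]; exact hl)⟩
      exact KernelFork.IsLimit.ofι _ _ (fun g hg => (hl g hg).choose)
        (fun g hg => (hl g hg).choose_spec)
        (fun g hg m hm => by rw [← cancel_mono i, hm, (hl g hg).choose_spec])
    · have hl : ∀ {W : C} (g : Y ⟶ W), i ≫ g = 0 → ∃ l, p ≫ l = g := fun g hg => by
        obtain ⟨l, hl⟩ := CokernelCofork.IsColimit.desc' hc (F.map g)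
          (by rw [← F.map_comp, hg, F.map_zero])
        exact ⟨F.preimage l, F.map_injective (by rw [F.map_comp, F.map_preimage]; exact hl)⟩
      exact CokernelCofork.IsColimit.ofπ _ _ (fun g hg => (hl g hg).choose)
        (fun g hg => (hl g hg).choose_spec)
        (fun g hg m hm => by rw [← cancel_epi p, hm, (hl g hg).choose_spec])
  iso_closed X Y Z X' Y' Z' i p i' p' a b c hi hp h := by
    refine (hE _ _).2 (hD.iso_closed _ _ _ _ (F.mapIso a) (F.mapIso b) (F.mapIso c) ?_ ?_
      ((hE i p).1 h))
    · rw [F.mapIso_hom, F.mapIso_hom, ← F.map_comp, ← F.map_comp, hi]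
    · rw [F.mapIso_hom, F.mapIso_hom, ← F.map_comp, ← F.map_comp, hp]
  id_inflation X := (isInflation_iff_of_equivalence F hD hE _).2
    (by rw [F.map_id]; exact hD.id_inflation _)
  id_deflation X := (isDeflation_iff_of_equivalence F hD hE _).2
    (by rw [F.map_id]; exact hD.id_deflation _)
  comp_inflation X Y Z i j hi hj := (isInflation_iff_of_equivalence F hD hE _).2 (by
    rw [F.map_comp]
    exact hD.comp_inflation _ _ ((isInflation_iff_of_equivalence F hD hE _).1 hi)
      ((isInflation_iff_of_equivalence F hD hE _).1 hj))
  comp_deflation X Y Z p q hp hq := (isDeflation_iff_of_equivalence F hD hE _).2 (by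
    rw [F.map_comp]
    exact hD.comp_deflation _ _ ((isDeflation_iff_of_equivalence F hD hE _).1 hp)
      ((isDeflation_iff_of_equivalence F hD hE _).1 hq))
  pushout_inflation X Y X' i f hi := by
    obtain ⟨Y', f', i', hsq, Z, p, h⟩ := hD.pushout_inflation (F.map i) (F.map f)
      ((isInflation_iff_of_equivalence F hD hE _).1 hi)
    let e := (F.objObjPreimageIso Y').symm
    have hsq' : IsPushout (F.map i) (F.map f) (F.map (F.preimage (f' ≫ e.hom)))
        (F.map (F.preimage (i' ≫ e.hom))) :=
      hsq.of_iso (Iso.refl _) (Iso.refl _) (Iso.refl _) e (by simp) (by simp) (by simp) (by simp)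
    refine ⟨F.objPreimage Y', F.preimage (f' ≫ e.hom), F.preimage (i' ≫ e.hom),
      IsPushout.of_map F (F.map_injective ?_) hsq', (isInflation_iff_of_equivalence F hD hE _).2
        ⟨Z, e.inv ≫ p, ?_⟩⟩
    · rw [F.map_comp, F.map_comp, hsq'.w]
    · exact hD.iso_closed _ _ _ _ (Iso.refl _) e (Iso.refl _) (by simp) (by simp) h
  pullback_deflation Y Z Z' p f hp := by
    obtain ⟨Y', f', p', hsq, X, i, h⟩ := hD.pullback_deflation (F.map p) (F.map f)
      ((isDeflation_iff_of_equivalence F hD hE _).1 hp)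
    let e := F.objObjPreimageIso Y'
    have hsq' : IsPullback (F.map (F.preimage (e.hom ≫ f'))) (F.map (F.preimage (e.hom ≫ p')))
        (F.map p) (F.map f) :=
      hsq.of_iso e.symm (Iso.refl _) (Iso.refl _) (Iso.refl _) (by simp) (by simp) (by simp)
        (by simp)
    refine ⟨F.objPreimage Y', F.preimage (e.hom ≫ f'), F.preimage (e.hom ≫ p'),
      IsPullback.of_map F (F.map_injective ?_) hsq', (isDeflation_iff_of_equivalence F hD hE _).2
        ⟨X, i ≫ e.inv, ?_⟩⟩
    · rw [F.map_comp, F.map_comp, hsq'.w]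
    · exact hD.iso_closed _ _ _ _ (Iso.refl _) e.symm (Iso.refl _) (by simp) (by simp) h

end Transport

/-! ### The equivalence of the category of fractions with the category of link modules -/

section FractionsEquivalence

variable (A : Type u) [Ring A] (μ : ℕ)

/-- The link modules are an exact category. -/
lemma flk_isExactStructure : IsExactStructure (Flk A μ) (flkShortExact A μ) := by
  refine isExactStructure_of_isExtensionClosed (P := isFlk A μ) (fun M hM => ?_)
    (fun hM' hM'' i p hi hip hp => isFlk_of_extension hM' hM'' i p hi hip hp)
  let D : FoxModule A μ := ⟨ModuleCat.of A PUnit.{u + 1}, 0⟩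
  have hD : D.IsFGProj := ⟨inferInstanceAs (Module.Finite A PUnit.{u + 1}),
    inferInstanceAs (Module.Projective A PUnit.{u + 1})⟩
  have hN : Subsingleton D.N := inferInstanceAs (Subsingleton PUnit.{u + 1})
  have : Subsingleton (Induced μ D.N) :=
    ⟨fun _ _ => Induced.ext_coeff fun _ => Subsingleton.elim _ _⟩
  have : Subsingleton D.Cov := (Submodule.mkQ_surjective (LinearMap.range D.pres)).subsingleton
  exact FoxModule.isFlk_of_cov hD (LinearEquiv.ofSubsingleton _ _)

variable {A μ} (hB : ∀ V : Sei A μ, isFlk A μ ((seiCovering A μ).obj V))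

lemma inducedCovering_map_Q {V W : Sei A μ} (f : V ⟶ W) :
    (inducedCovering hB).map ((Xi A μ).Q.map f) = (coveringFlk hB).map f := by
  refine (Functor.congr_hom
    (Localization.Construction.fac (coveringFlk hB) (coveringFlk_inverts hB)) f).trans ?_
  exact (Category.id_comp _).trans (Category.comp_id _)

/-- The isomorphism of link modules given by an isomorphism of modules. -/
def flkIso {X Y : Flk A μ} (e : X.obj ≃ₗ[GroupRing A μ] Y.obj) : X ≅ Y where
  hom := ofLinearMap e.toLinearMap
  inv := ofLinearMap e.symm.toLinearMap
  hom_inv_id := fullSubcategory_hom_ext e.symm_apply_apply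
  inv_hom_id := fullSubcategory_hom_ext e.apply_symm_apply

/-- An identity `φ B(s) = B(f)` with `s` in `Ξ` exhibits `φ` as the image of the fraction formed by
`f` and `s`. -/
lemma exists_inducedCovering_map_eq {V W : Sei A μ}
    (φ : (inducedCovering hB).obj ((Xi A μ).Q.obj V) ⟶
      (inducedCovering hB).obj ((Xi A μ).Q.obj W)) :
    ∃ ψ, (inducedCovering hB).map ψ = φ := by
  obtain ⟨W', f, s, hs, h⟩ := exists_leftFraction_covering (V := V) (W := W) φ.hom
  have := Localization.inverts (Xi A μ).Q (Xi A μ) s hs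
  refine ⟨(Xi A μ).Q.map f ≫ inv ((Xi A μ).Q.map s), ?_⟩
  have h1 : φ ≫ (coveringFlk hB).map s = (coveringFlk hB).map f := InducedCategory.Hom.ext h
  rw [Functor.map_comp, Functor.map_inv, IsIso.comp_inv_eq]
  exact (inducedCovering_map_Q hB f).trans (h1.symm.trans
    (congrArg (fun k => φ ≫ k) (inducedCovering_map_Q hB s).symm))

lemma inducedCovering_full : (inducedCovering hB).Full where
  map_surjective {X Y} φ := by
    obtain ⟨V, rfl⟩ := (Localization.Construction.objEquiv (Xi A μ)).surjective X
    obtain ⟨W, rfl⟩ := (Localization.Construction.objEquiv (Xi A μ)).surjective Y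
    exact exists_inducedCovering_map_eq hB φ

lemma inducedCovering_essSurj : (inducedCovering hB).EssSurj where
  mem_essImage M := by
    obtain ⟨V, ⟨e⟩⟩ := exists_seiCovering_equiv M.property
    exact ⟨(Xi A μ).Q.obj V, ⟨flkIso e⟩⟩

instance : (coveringFlk hB).Additive where
  map_add {_ _ f g} := InducedCategory.Hom.ext ((seiCovering A μ).map_add (f := f) (g := g))

section

variable [(Xi A μ).HasLeftCalculusOfFractions]

lemma inducedCovering_additive : (inducedCovering hB).Additive := by
  rw [Localization.functor_additive_iff (Xi A μ).Q (Xi A μ)]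
  have h : (Xi A μ).Q ⋙ inducedCovering hB = coveringFlk hB :=
    Localization.Construction.fac (coveringFlk hB) (coveringFlk_inverts hB)
  rw [h]
  infer_instance

/-- With a left calculus of fractions it suffices to test morphisms of Seifert modules with zero
covering. These are killed by some `s` in `Ξ`, which the localization makes invertible. -/
lemma inducedCovering_faithful : (inducedCovering hB).Faithful := by
  have := inducedCovering_additive hB
  refine Functor.faithful_of_comp_cancel_zero_of_hasLeftCalculusOfFractions (Xi A μ).Q (Xi A μ)
    (inducedCovering hB) fun V W f hf => ?_
  have hf₀ : (coveringFlk hB).map f = 0 := (inducedCovering_map_Q hB f).symm.trans hf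
  have hf' : (seiCovering A μ).map f = 0 := congrArg (fun k => k.hom) hf₀
  obtain ⟨W', s, hs, h⟩ := exists_Xi_comp_eq_zero f hf'
  have := Localization.inverts (Xi A μ).Q (Xi A μ) s hs
  rw [← cancel_mono ((Xi A μ).Q.map s), ← Functor.map_comp, h, Functor.map_zero, zero_comp]

lemma inducedCovering_isEquivalence : (inducedCovering hB).IsEquivalence where
  faithful := inducedCovering_faithful hB
  full := inducedCovering_full hB
  essSurj := inducedCovering_essSurj hB

/-- The equivalence of the category of fractions with the category of link modules identifies the
short exact sequences. -/
lemma fractionsShortExact_iff ⦃X Y Z : (Xi A μ).Localization⦄ (i : X ⟶ Y) (p : Y ⟶ Z) :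
    fractionsShortExact A μ i p ↔
      flkShortExact A μ ((inducedCovering hB).map i) ((inducedCovering hB).map p) := by
  have := inducedCovering_isEquivalence hB
  constructor
  · rintro ⟨U, V, W, j, q, a, b, c, h, hj, hq⟩
    have h1 : flkShortExact A μ ((inducedCovering hB).map ((Xi A μ).Q.map j))
        ((inducedCovering hB).map ((Xi A μ).Q.map q)) := by
      rw [inducedCovering_map_Q, inducedCovering_map_Q]
      exact seiCovering_shortExact h
    refine (flk_isExactStructure A μ).iso_closed _ _ _ _ ((inducedCovering hB).mapIso a)
      ((inducedCovering hB).mapIso b) ((inducedCovering hB).mapIso c) ?_ ?_ h1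
    · rw [Functor.mapIso_hom, Functor.mapIso_hom, ← Functor.map_comp, ← Functor.map_comp, hj]
    · rw [Functor.mapIso_hom, Functor.mapIso_hom, ← Functor.map_comp, ← Functor.map_comp, hq]
  · intro h
    -- The extension of link modules is the covering of a Seifert sequence up to isomorphism; full
    -- faithfulness brings the isomorphisms back to the category of fractions.
    obtain ⟨U, V, W, j, q, a, b, c, hjq, hj, hq⟩ := exists_seiShortExact
      ((inducedCovering hB).obj X).property ((inducedCovering hB).obj Z).property _ _
      h.1 h.2.1 h.2.2
    let a' : (inducedCovering hB).obj ((Xi A μ).Q.obj U) ≅ (inducedCovering hB).obj X := flkIso a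
    let b' : (inducedCovering hB).obj ((Xi A μ).Q.obj V) ≅ (inducedCovering hB).obj Y := flkIso b
    let c' : (inducedCovering hB).obj ((Xi A μ).Q.obj W) ≅ (inducedCovering hB).obj Z := flkIso c
    refine ⟨U, V, W, j, q, (inducedCovering hB).preimageIso a', (inducedCovering hB).preimageIso b',
      (inducedCovering hB).preimageIso c', hjq, (inducedCovering hB).map_injective ?_,
      (inducedCovering hB).map_injective ?_⟩
    · rw [Functor.map_comp, Functor.map_comp, Functor.preimageIso_hom, Functor.preimageIso_hom,
        Functor.map_preimage, Functor.map_preimage, inducedCovering_map_Q]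
      exact fullSubcategory_hom_ext hj
    · rw [Functor.map_comp, Functor.map_comp, Functor.preimageIso_hom, Functor.preimageIso_hom,
        Functor.map_preimage, Functor.map_preimage, inducedCovering_map_Q]
      exact fullSubcategory_hom_ext hq

end

end FractionsEquivalence

/-! ### Retracts of Blanchfield modules -/

section Retracts

variable {A : Type u} [Ring A] {μ : ℕ}

/-- A retract of a Blanchfield module is a Blanchfield module. -/
lemma isBlanchfield_of_retract {M N : ModuleCat.{u} (GroupRing A μ)} (i : M ⟶ N) (r : N ⟶ M)
    (h : i ≫ r = 𝟙 M) (hN : IsBlanchfield A μ N) : IsBlanchfield A μ M := fun n => by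
  rw [IsZero.iff_id_eq_zero, ← (torFunctor (augmentation A μ) n).map_id, ← h, Functor.map_comp,
    (hN n).eq_of_tgt ((torFunctor (augmentation A μ) n).map i) 0, zero_comp]

/-- A retract of a Blanchfield module of homological dimension one is one. -/
lemma isBla_of_retract {M N : ModuleCat.{u} (GroupRing A μ)} (i : M ⟶ N) (r : N ⟶ M)
    (h : i ≫ r = 𝟙 M) (hN : isBla A μ N) : isBla A μ M := by
  refine ⟨isBlanchfield_of_retract i r h hN.1, ?_⟩
  obtain ⟨-, K, L, d, q, _, _, _, _, hd, hdq, hq⟩ := hN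
  have hri : ∀ m, r.hom (i.hom m) = m := fun m => by
    rw [← ModuleCat.comp_apply, h]; rfl
  obtain ⟨P, hP⟩ := Module.projective_lifting_property q ((i.hom ∘ₗ r.hom) ∘ₗ q) hq
  have hP' : ∀ l, q (P l) = i.hom (r.hom (q l)) := fun l => LinearMap.congr_fun hP l
  let K₁ : Submodule (GroupRing A μ) L := LinearMap.ker (r.hom ∘ₗ q)
  have hK₁ : ∀ l, l ∈ K₁ ↔ r.hom (q l) = 0 := fun l => Iff.rfl
  obtain ⟨φ, hφ⟩ := exists_factor_of_injective hd (P ∘ₗ K₁.subtype) fun l =>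
    (hdq _).1 (by
      rw [LinearMap.comp_apply, hP', Submodule.subtype_apply, (hK₁ _).1 l.2, map_zero])
  -- With `P` a lift of the idempotent `i r` to `L`, the map `(k, l) ↦ d k + (l - P l)` onto the
  -- kernel of `r q` is split by `l ↦ (φ l, l)`. So this kernel is a summand of `K × L`.
  let ψ : (K × L) →ₗ[GroupRing A μ] K₁ := (d.coprod (LinearMap.id - P)).codRestrict K₁ fun x => by
    rw [hK₁, LinearMap.coprod_apply, map_add, hdq.apply_apply_eq_zero, LinearMap.sub_apply,
      map_sub, hP', zero_add, map_sub, hri, LinearMap.id_apply, sub_self]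
  have hψφ : ψ ∘ₗ φ.prod K₁.subtype = LinearMap.id := LinearMap.ext fun l => Subtype.ext (by
    change d (φ l) + (l.1 - P l.1) = l.1
    rw [hφ]
    exact add_sub_cancel _ _)
  have hψs : Function.Surjective ψ := fun l => ⟨_, LinearMap.congr_fun hψφ l⟩
  refine ⟨ModuleCat.of _ K₁, L, K₁.subtype, r.hom ∘ₗ q, Module.Finite.of_surjective ψ hψs,
    Module.Projective.of_split _ ψ hψφ, ‹_›, ‹_›, Subtype.val_injective, fun l => ?_, ?_⟩
  · exact ⟨fun hl => ⟨⟨l, hl⟩, rfl⟩, fun ⟨x, hx⟩ => hx ▸ x.2⟩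
  · exact (Function.LeftInverse.surjective hri).comp hq

/-- The submodule generated by the multiples of the elements of the kernel of `φ`. -/
def kerSubmodule {R S : Type u} [Ring R] [Ring S] (φ : R →+* S) (M : Type u) [AddCommGroup M]
    [Module R M] : Submodule R M :=
  { kerSpan φ M with smul_mem' := fun r _ hm => smul_mem_kerSpan_of_mem r hm }

/-- A morphism to a projective module which is bijective modulo the kernel of `φ` has an inverse
modulo the kernel of `φ`. -/
lemma exists_inverse_modulo_kerSpan {R S : Type u} [Ring R] [Ring S] {φ : R →+* S} {K L : Type u}
    [AddCommGroup K] [Module R K] [AddCommGroup L] [Module R L] [Module.Projective R L]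
    (d : K →ₗ[R] L) (h1 : ∀ k, d k ∈ kerSpan φ L → k ∈ kerSpan φ K)
    (h2 : ∀ l, ∃ k, l - d k ∈ kerSpan φ L) :
    ∃ c : L →ₗ[R] K, (∀ k, c (d k) - k ∈ kerSpan φ K) ∧ ∀ l, d (c l) - l ∈ kerSpan φ L := by
  let d' : (K ⧸ kerSubmodule φ K) →ₗ[R] (L ⧸ kerSubmodule φ L) :=
    Submodule.mapQ _ _ d fun k hk => map_mem_kerSpan d hk
  have hd' : ∀ k, d' ((kerSubmodule φ K).mkQ k) = (kerSubmodule φ L).mkQ (d k) := fun _ => rfl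
  have hb : Function.Bijective d' := by
    constructor
    · rw [injective_iff_map_eq_zero]
      intro k hk
      obtain ⟨k, rfl⟩ := Submodule.mkQ_surjective _ k
      exact (Submodule.Quotient.mk_eq_zero _).2 (h1 k ((Submodule.Quotient.mk_eq_zero _).1 hk))
    · intro l
      obtain ⟨l, rfl⟩ := Submodule.mkQ_surjective _ l
      obtain ⟨k, hk⟩ := h2 l
      exact ⟨(kerSubmodule φ K).mkQ k, ((Submodule.Quotient.eq _).2 hk).symm⟩
  let e := LinearEquiv.ofBijective d' hb
  obtain ⟨c, hc⟩ := Module.projective_lifting_property (kerSubmodule φ K).mkQ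
    (e.symm.toLinearMap ∘ₗ (kerSubmodule φ L).mkQ) (Submodule.mkQ_surjective _)
  have hc' : ∀ l, d' ((kerSubmodule φ K).mkQ (c l)) = (kerSubmodule φ L).mkQ l := fun l =>
    (congrArg d' (LinearMap.congr_fun hc l)).trans (e.apply_symm_apply _)
  refine ⟨c, fun k => (Submodule.Quotient.eq (kerSubmodule φ K)).1 (hb.1 ?_),
    fun l => (Submodule.Quotient.eq (kerSubmodule φ L)).1 ?_⟩
  · exact hc' (d k)
  · exact hc' l

/-- The cokernel of an endomorphism of an induced module which is an involution modulo the
augmentation is a link module. -/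
lemma isFlk_of_involution {P : ModuleCat.{u} A} [Module.Finite A P] [Module.Projective A P]
    (f : Induced μ P →ₗ[GroupRing A μ] Induced μ P)
    (hf : ∀ y, f (f y) - y ∈ kerSpan (augmentation A μ) (Induced μ P)) :
    isFlk A μ (ModuleCat.of _ (Induced μ P ⧸ LinearMap.range f)) := by
  have hinj : Function.Injective f := by
    -- Only `f ∘ f` has identity augmentation, but its injectivity implies that of `f`.
    have h : Function.Injective (f ∘ₗ f) := Induced.injective_of_total_eq (f ∘ₗ f) fun x => by
      have := (Induced.mem_kerSpan_iff _).1 (hf (Induced.single 1 x))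
      rw [map_sub, Induced.total_single, sub_eq_zero] at this
      exact this
    exact Function.Injective.of_comp h
  have hex : Function.Exact f (LinearMap.range f).mkQ := by
    rw [LinearMap.exact_iff, Submodule.ker_mkQ]
  have hs : Function.Surjective (LinearMap.range f).mkQ := Submodule.mkQ_surjective _
  refine ⟨⟨?_, ModuleCat.of _ (Induced μ P), ModuleCat.of _ (Induced μ P), f,
      (LinearMap.range f).mkQ, Induced.finite, Induced.projective, Induced.finite,
      Induced.projective, hinj, hex, hs⟩,
    P, P, f, (LinearMap.range f).mkQ, ‹_›, ‹_›, ‹_›, ‹_›, hinj, hex, hs⟩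
  have h1 : Module.Projective (GroupRing A μ) (ModuleCat.of (GroupRing A μ) (Induced μ P)) :=
    Induced.projective
  refine (isBlanchfield_iff (K := ModuleCat.of _ (Induced μ P)) (L := ModuleCat.of _ (Induced μ P))
    (M := ModuleCat.of _ (Induced μ P ⧸ LinearMap.range f)) f (LinearMap.range f).mkQ
    hinj hex hs).2 ⟨fun k hk => ?_, fun l => ⟨f l, ?_⟩⟩
  · have h2 := sub_mem (map_mem_kerSpan f hk) (hf k)
    rwa [sub_sub_cancel] at h2
  · have h2 := neg_mem (hf l)
    rwa [neg_sub] at h2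

/-- Every Blanchfield module of homological dimension one is a retract of a link module. -/
lemma exists_retract_of_isBla {M : ModuleCat.{u} (GroupRing A μ)} (hM : isBla A μ M) :
    ∃ (N : ModuleCat.{u} (GroupRing A μ)) (i : M ⟶ N) (r : N ⟶ M), isFlk A μ N ∧ i ≫ r = 𝟙 M := by
  obtain ⟨hB, K, L, d, q, _, _, _, _, hd, hdq, hq⟩ := hM
  obtain ⟨h1, h2⟩ := (isBlanchfield_iff d q hd hdq hq).1 hB
  obtain ⟨c, hc1, hc2⟩ := exists_inverse_modulo_kerSpan d h1 h2
  obtain ⟨n, ρ, hρ⟩ := Induced.exists_surjective (A := A) (μ := μ) (K × L)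
  obtain ⟨i, hi⟩ := Module.projective_lifting_property ρ LinearMap.id hρ
  have hρi : ∀ x, ρ (i x) = x := fun x => LinearMap.congr_fun hi x
  -- The swap is an involution modulo the augmentation, and its cokernel is the sum of the cokernels
  -- of `c` and `d`, the latter being `M`. Neither `K` nor `L` need be induced, but `K × L` is a
  -- summand of an induced module.
  let f : (K × L) →ₗ[GroupRing A μ] (K × L) :=
    (c ∘ₗ LinearMap.snd (GroupRing A μ) K L).prod (d ∘ₗ LinearMap.fst (GroupRing A μ) K L)
  have hff : ∀ x, f (f x) - x ∈ kerSpan (augmentation A μ) (K × L) := fun x => by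
    have h3 := add_mem (map_mem_kerSpan (LinearMap.inl (GroupRing A μ) K L) (hc1 x.1))
      (map_mem_kerSpan (LinearMap.inr (GroupRing A μ) K L) (hc2 x.2))
    have h4 : f (f x) - x = LinearMap.inl (GroupRing A μ) K L (c (d x.1) - x.1)
        + LinearMap.inr (GroupRing A μ) K L (d (c x.2) - x.2) :=
      Prod.ext (add_zero _).symm (zero_add _).symm
    rwa [h4]
  let I : ModuleCat.{u} A := ModuleCat.of A (ULift.{u} (Fin n) → A)
  have : Module.Finite A I := inferInstanceAs (Module.Finite A (ULift.{u} (Fin n) → A))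
  have : Module.Projective A I := inferInstanceAs (Module.Projective A (ULift.{u} (Fin n) → A))
  -- Extension of the swap by the identity on the complement `ker ρ` of `i (K × L)`; this changes
  -- neither the cokernel nor the involution property.
  let F : Induced μ I →ₗ[GroupRing A μ] Induced μ I := i ∘ₗ f ∘ₗ ρ + (LinearMap.id - i ∘ₗ ρ)
  have hF : ∀ y, F y = i (f (ρ y)) + (y - i (ρ y)) := fun _ => rfl
  have hρF : ∀ y, ρ (F y) = f (ρ y) := fun y => by
    rw [hF, map_add, map_sub, hρi, hρi, sub_self, add_zero]
  have hFi : ∀ x, F (i x) = i (f x) := fun x => by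
    rw [hF, hρi, sub_self, add_zero]
  have hFlk := isFlk_of_involution F fun y => by
    have h3 : F (F y) - y = i (f (f (ρ y)) - ρ y) := by
      rw [hF (F y), hρF, hF y, map_sub]
      abel
    rw [h3]
    exact map_mem_kerSpan i (hff _)
  let α : (Induced μ I ⧸ LinearMap.range F) →ₗ[GroupRing A μ] M :=
    (LinearMap.range F).liftQ (q ∘ₗ LinearMap.snd (GroupRing A μ) K L ∘ₗ ρ) (by
      rintro _ ⟨y, rfl⟩
      change q (ρ (F y)).2 = 0
      rw [hρF]
      exact hdq.apply_apply_eq_zero _)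
  obtain ⟨β, hβ⟩ := exists_factor_of_surjective hq
    ((LinearMap.range F).mkQ ∘ₗ i ∘ₗ LinearMap.inr (GroupRing A μ) K L) fun l hl => by
      obtain ⟨k, rfl⟩ := (hdq l).1 hl
      refine (Submodule.Quotient.mk_eq_zero _).2 ⟨i (k, 0), ?_⟩
      rw [hFi]
      refine congrArg i (Prod.ext ?_ rfl)
      exact map_zero c
  refine ⟨_, ModuleCat.ofHom β, ModuleCat.ofHom α, hFlk, ModuleCat.hom_ext (LinearMap.ext fun m => ?_)⟩
  obtain ⟨l, rfl⟩ := hq m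
  change α (β (q l)) = q l
  rw [hβ]
  change q (ρ (i (0, l))).2 = q l
  rw [hρi]

end Retracts

/-! ### The idempotent completion of the category of link modules -/

section IdempotentCompletion

variable (A : Type u) [Ring A] (μ : ℕ)

variable {A μ} in
/-- The image of an idempotent of a link module. -/
def karoubiImage (X : Idempotents.Karoubi (Flk A μ)) : Bla A μ where
  obj := ModuleCat.of _ (LinearMap.range X.p.hom.hom)
  property := isBla_of_retract (N := X.X.obj)
    (ModuleCat.ofHom (LinearMap.range X.p.hom.hom).subtype)
    (ModuleCat.ofHom (X.p.hom.hom.codRestrict (LinearMap.range X.p.hom.hom) fun x => ⟨x, rfl⟩))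
    (ModuleCat.hom_ext (LinearMap.ext fun x => Subtype.ext (by
      obtain ⟨_, y, rfl⟩ := x
      exact fullSubcategory_congr X.idem y))) X.X.property.1

variable {A μ}

lemma karoubi_idem_apply (X : Idempotents.Karoubi (Flk A μ)) (x : X.X.obj) :
    X.p.hom.hom (X.p.hom.hom x) = X.p.hom.hom x := fullSubcategory_congr X.idem x

lemma karoubi_p_comp_apply {X Y : Idempotents.Karoubi (Flk A μ)} (f : X ⟶ Y) (x : X.X.obj) :
    f.f.hom.hom (X.p.hom.hom x) = f.f.hom.hom x :=
  fullSubcategory_congr (Idempotents.Karoubi.p_comp f) x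

lemma karoubi_comp_p_apply {X Y : Idempotents.Karoubi (Flk A μ)} (f : X ⟶ Y) (x : X.X.obj) :
    Y.p.hom.hom (f.f.hom.hom x) = f.f.hom.hom x :=
  fullSubcategory_congr (Idempotents.Karoubi.comp_p f) x

variable (A μ)

/-- The functor which sends an idempotent of a link module to its image. -/
def karoubiToBla : Idempotents.Karoubi (Flk A μ) ⥤ Bla A μ where
  obj := karoubiImage
  map {X Y} f := ofLinearMap (X := karoubiImage X) (Y := karoubiImage Y)
    ((f.f.hom.hom ∘ₗ (LinearMap.range X.p.hom.hom).subtype).codRestrict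
      (LinearMap.range Y.p.hom.hom) fun x => ⟨_, karoubi_comp_p_apply f x.1⟩)
  map_id X := fullSubcategory_hom_ext fun x => Subtype.ext (by
    obtain ⟨_, y, rfl⟩ := x
    exact karoubi_idem_apply X y)
  map_comp _ _ := rfl

instance : (karoubiToBla A μ).Additive where
  map_add := rfl

instance : (karoubiToBla A μ).Faithful where
  map_injective {X Y f g} h := by
    refine Idempotents.Karoubi.hom_ext _ _ (fullSubcategory_hom_ext fun x => ?_)
    rw [← karoubi_p_comp_apply f, ← karoubi_p_comp_apply g]
    exact congrArg Subtype.val (fullSubcategory_congr h ⟨X.p.hom.hom x, x, rfl⟩)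

instance : (karoubiToBla A μ).Full where
  map_surjective {X Y} g := by
    let g' : LinearMap.range X.p.hom.hom →ₗ[GroupRing A μ] LinearMap.range Y.p.hom.hom := g.hom.hom
    let f : X.X.obj →ₗ[GroupRing A μ] Y.X.obj := (LinearMap.range Y.p.hom.hom).subtype ∘ₗ
      g' ∘ₗ X.p.hom.hom.codRestrict (LinearMap.range X.p.hom.hom) fun x => ⟨x, rfl⟩
    have hg' : ∀ y : LinearMap.range Y.p.hom.hom, Y.p.hom.hom y.1 = y.1 := by
      rintro ⟨_, y, rfl⟩
      exact karoubi_idem_apply Y y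
    have hX : ∀ x : LinearMap.range X.p.hom.hom, X.p.hom.hom x.1 = x.1 := by
      rintro ⟨_, x, rfl⟩
      exact karoubi_idem_apply X x
    refine ⟨⟨ofLinearMap f, fullSubcategory_hom_ext fun x => ?_⟩,
      fullSubcategory_hom_ext fun x => Subtype.ext ?_⟩
    · change Y.p.hom.hom (g' ⟨X.p.hom.hom (X.p.hom.hom x), _⟩).1 = (g' ⟨X.p.hom.hom x, _⟩).1
      simp only [karoubi_idem_apply]
      exact hg' _
    · exact congrArg (fun y => (g' y).1) (Subtype.ext (hX x))

instance : (karoubiToBla A μ).EssSurj where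
  mem_essImage M := by
    obtain ⟨N, i, r, hN, h⟩ := exists_retract_of_isBla M.property
    have hri : ∀ m, r.hom (i.hom m) = m := fun m => by
      rw [← ModuleCat.comp_apply, h]; rfl
    let N' : Flk A μ := ⟨N, hN⟩
    let X : Idempotents.Karoubi (Flk A μ) :=
      { X := N'
        p := ofLinearMap (X := N') (Y := N') (i.hom ∘ₗ r.hom)
        idem := fullSubcategory_hom_ext fun x => congrArg i.hom (hri (r.hom x)) }
    refine ⟨X, ⟨⟨ofLinearMap (X := karoubiImage X)
      (r.hom ∘ₗ (LinearMap.range (i.hom ∘ₗ r.hom)).subtype),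
      ofLinearMap (Y := karoubiImage X) (i.hom.codRestrict (LinearMap.range (i.hom ∘ₗ r.hom))
        fun m => ⟨i.hom m, congrArg i.hom (hri m)⟩),
      fullSubcategory_hom_ext fun x => Subtype.ext ?_, fullSubcategory_hom_ext fun m => hri m⟩⟩⟩
    obtain ⟨_, y, rfl⟩ := x
    exact congrArg i.hom (hri (r.hom y))

instance : (karoubiToBla A μ).IsEquivalence where

/-- The functor on the idempotent completion extends the inclusion. -/
def toKaroubiCompKaroubiToBla :
    Idempotents.toKaroubi (Flk A μ) ⋙ karoubiToBla A μ ≅ flkToBla A μ :=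
  NatIso.ofComponents (fun M =>
    { hom := ofLinearMap (X := karoubiImage ((Idempotents.toKaroubi (Flk A μ)).obj M))
        (Y := (flkToBla A μ).obj M)
        (LinearMap.range (LinearMap.id : M.obj →ₗ[GroupRing A μ] M.obj)).subtype
      inv := ofLinearMap (X := (flkToBla A μ).obj M)
        (Y := karoubiImage ((Idempotents.toKaroubi (Flk A μ)).obj M))
        ((LinearMap.id : M.obj →ₗ[GroupRing A μ] M.obj).codRestrict (LinearMap.range LinearMap.id)
          fun m => ⟨m, rfl⟩)
      hom_inv_id := rfl
      inv_hom_id := rfl }) fun _ => rfl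

end IdempotentCompletion

end SeifertBlanchfield

end

theorem theorem2 (A : Type u) [Ring A] (μ : ℕ) (hμ : 1 ≤ μ) :
    -- the left calculus of fractions
    (Xi A μ).HasLeftCalculusOfFractions ∧
    -- the covering functor takes values in the h.d. 1 `F_μ`-link modules, and induces
    -- an equivalence of exact categories
    (∃ hB : ∀ V : Sei A μ, isFlk A μ ((seiCovering A μ).obj V),
      (inducedCovering hB).IsEquivalence ∧
      ∃ _ : Preadditive (Xi A μ).Localization,
        (Xi A μ).Q.Additive ∧
        (inducedCovering hB).Additive ∧
        IsExactStructure (Xi A μ).Localization (fractionsShortExact A μ) ∧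
        IsExactStructure (Flk A μ) (flkShortExact A μ) ∧
        ∀ ⦃X Y Z : (Xi A μ).Localization⦄ (i : X ⟶ Y) (p : Y ⟶ Z),
          fractionsShortExact A μ i p ↔
            flkShortExact A μ ((inducedCovering hB).map i) ((inducedCovering hB).map p)) ∧
    -- the idempotent completion
    (∃ E : Idempotents.Karoubi (Flk A μ) ≌ Bla A μ,
      E.functor.Additive ∧
      Nonempty (Idempotents.toKaroubi (Flk A μ) ⋙ E.functor ≅ flkToBla A μ)) := by
  have := hasLeftCalculusOfFractions A μ
  have := inducedCovering_isEquivalence (isFlk_seiCovering (A := A) (μ := μ))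
  have := inducedCovering_additive (isFlk_seiCovering (A := A) (μ := μ))
  refine ⟨‹_›, ⟨isFlk_seiCovering, inferInstance, inferInstance, inferInstance, inferInstance,
    isExactStructure_of_equivalence (inducedCovering isFlk_seiCovering) (flk_isExactStructure A μ)
      (fractionsShortExact_iff isFlk_seiCovering), flk_isExactStructure A μ,
    fractionsShortExact_iff isFlk_seiCovering⟩,
    (karoubiToBla A μ).asEquivalence, inferInstanceAs (karoubiToBla A μ).Additive,
    ⟨toKaroubiCompKaroubiToBla A μ⟩⟩
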